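/- **Setting.** Let $d\in\{2,3\}$, let $\Omega\subset\mathbb R^d$ be a polygonal/polyhedral domain with a polygonal/polyhedral subdomain $\Omega_f\subset\Omega$, and let $\mathcal T_h$ be a conforming simplicial decomposition of $\Omega$ containing a decomposition $\mathcal T_h^f$ of $\Omega_f$; $\varepsilon_h,\varepsilon_h^f$ are the corresponding sets of edges (faces), $h_K=\operatorname{diam}K$ and $n$ is the outward unit normal on $\partial K$. Let $k\ge1$, $l\in\{k-1,k\}$, $k-1\le m\le l$, $\Pr,Ra,\kappa>0$, $f\in[L^2(\Omega_f)]^d$, $g\in L^2(\Omega)$, and let $j$ be the last unit coordinate vector. Let $Q_l^b$ be the $L^2$-projection onto $P_l(e)$ on each edge (face), applied componentwise to vectors. For weak functions $v=\{v_0,v_b\}$ (interior part and single-valued trace), $\nabla_{w,r}v\in[P_r(K)]^d$ and, for vector-valued $w=\{w_0,w_b\}$, $\nabla_{w,r}\cdot w\in P_r(K)$ are defined on each $K$ by $(\nabla_{w,r}v,\tau)_K=-(v_0,\nabla\cdot\tau)_K+\langle v_b,\tau\cdot n\rangle_{\partial K}$ for all $\tau\in[P_r(K)]^d$ and $(\nabla_{w,r}\cdot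 w,\tau)_K=-(w_0,\nabla\tau)_K+\langle w_b\cdot n,\tau\rangle_{\partial K}$ for all $\tau\in P_r(K)$; for vectors (tensors) they act componentwise (row by row), and $u\otimes w=(u_iw_j)_{i,j}$. Products of weak functions are taken in both entries. Let $V_h^0$ be the space of velocities $v=\{v_0,v_b\}$ with $v_0|_K\in[P_k(K)]^d$, $v_b|_e\in[P_l(e)]^d$ for $K\in\mathcal T_h^f$, $e\in\varepsilon_h^f$ and $v_b=0$ on $\partial\Omega_f$ (extended by zero outside $\Omega_f$); $Q_h^0$ the space of pressures $q=\{q_0,q_b\}$ with $q_0|_K\in P_{k-1}(K)$, $q_b|_e\in P_k(e)$ on $\mathcal T_h^f,\varepsilon_h^f$ and $\int_{\Omega_f}q_0=0$; $S_h^0$ the space of temperatures $s=\{s_0,s_b\}$ with $s_0|_K\in P_k(K)$, $s_b|_e\in P_l(e)$ on $\mathcal T_h,\varepsilon_h$ and $s_b=0$ on $\partial\Omega$. With $\tau|_{\partial K}=h_K^{-1}$ put $$a_h(u,v)=\Pr(\nabla_{w,m}u,\nabla_{w,m}v)+\Pr\langle\tau(Q_l^bu_0-u_b),Q_l^bv_0-v_b\rangle_{\partial\mathcal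 T_h^f},$$ $$\bar a_h(T,s)=\kappa(\nabla_{w,m}T,\nabla_{w,m}s)+\kappa\langle\tau(Q_l^bT_0-T_b),Q_l^bs_0-s_b\rangle_{\partial\mathcal T_h},$$ $$b_h(v,q)=(\nabla_{w,k}q,v_0),\qquad d_h(T,v)=\Pr Ra\,(jT_0,v_0),$$ $$c_h(w;u,v)=\tfrac12(\nabla_{w,k}\cdot(u\otimes w),v_0)-\tfrac12(\nabla_{w,k}\cdot(v\otimes w),u_0),$$ $$\bar c_h(u;T,s)=\tfrac12(\nabla_{w,k}\cdot(uT),s_0)-\tfrac12(\nabla_{w,k}\cdot(us),T_0),$$ and define norms by $|||v|||^2=\Pr^{-1}a_h(v,v)$, $|||s|||^2=\kappa^{-1}\bar a_h(s,s)$, $\|q\|^2=\|q_0\|_0^2+\sum_{K\in\mathcal T_h^f}\|\nabla_{w,k}q\|_{0,K}^2$. Let $W_h=\{w\in V_h^0: b_h(w,q)=0\ \forall q\in Q_h^0\}$ and (suprema over non-zero arguments) $$\mathcal N_h=\sup_{w,u,v\in W_h}\frac{c_h(w;u,v)}{|||w|||\,|||u|||\,|||v|||},\quad \mathcal M_h=\sup_{w\in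 W_h,\;T,s\in S_h^0}\frac{\bar c_h(w;T,s)}{|||w|||\,|||T|||\,|||s|||},\quad \mathcal D_h=\sup_{T\in S_h^0,\;v\in W_h}\frac{(jT_0,v_0)}{|||T|||\,|||v|||},$$ $$\|f\|_h=\sup_{v\in W_h}\frac{(f,v_0)}{|||v|||},\qquad \|g\|_h=\sup_{s\in S_h^0}\frac{(g,s_0)}{|||s|||}.$$ **Theorem.** Let $\beta\ge\mathcal D_h$ (that is, $\beta$ is any constant with $d_h(T,v)\le\beta\Pr Ra\,|||T|||\,|||v|||$ on $S_h^0\times W_h$; if $\mathcal D_h\le1$ one may take $\beta=1$), and assume $$C_0:=1-\Big(\beta\big({\Pr}^{-1}\mathcal N_hRa\,\kappa^{-1}+\mathcal M_hRa\,\kappa^{-2}\big)\|g\|_h+\mathcal N_h{\Pr}^{-2}\|f\|_h\Big)>0.$$ Let $(u_h,p_h,T_h)\in V_h^0\times Q_h^0\times S_h^0$ be a solution of the WG scheme $$a_h(u_h,v)+c_h(u_h;u_h,v)+b_h(v,p_h)-b_h(u_h,q)-d_h(T_h,v)=(f,v_0),\qquad \bar a_h(T_h,s)+\bar c_h(u_h;T_h,s)=(g,s_0)$$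 for all $(v,q,s)\in V_h^0\times Q_h^0\times S_h^0$. Given $u_h^0\in V_h^0$, let $(u_h^n,p_h^n,T_h^n)\in V_h^0\times Q_h^0\times S_h^0$, $n\ge1$, satisfy the Oseen iteration $$a_h(u_h^n,v)+c_h(u_h^{n-1};u_h^n,v)+b_h(v,p_h^n)-b_h(u_h^n,q)=(f,v_0)+d_h(T_h^n,v),\qquad \bar a_h(T_h^n,s)+\bar c_h(u_h^{n-1};T_h^n,s)=(g,s_0)$$ for all $(v,q,s)\in V_h^0\times Q_h^0\times S_h^0$. Then, as $n\to\infty$, $$|||u_h^n-u_h|||\to0,\qquad \|p_h^n-p_h\|\to0,\qquad |||T_h^n-T_h|||\to0 .$$ Moreover, with $e_u^n=u_h^n-u_h$, one has $|||e_u^{n+1}|||\le(1-C_0)^n|||e_u^1|||$ for all $n\ge0$, and, if $u_h^0\in W_h$ (for instance $u_h^0=0$), $|||e_u^n|||\le(1-C_0)^n|||e_u^0|||$ for all $n\ge0$. -/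

import Mathlib

open MeasureTheory

noncomputable section

namespace WG

/-- The ambient space `ℝ^d` with its Euclidean structure. -/
abbrev Pt (d : ℕ) := EuclideanSpace ℝ (Fin d)

/-- A conforming simplicial decomposition `𝒯_h` of a polygonal / polyhedral domain `Ω ⊂ ℝ^d`
which is the union of simplicial decompositions `𝒯_h^f` of a subdomain `Ω_f` (the fluid cells)
and `𝒯_h^s` of the remaining part `Ω_s` (all other cells).  A simplex is given by its vertices.
The domain `Ω` is the interior of the union of all cells and `Ω_f` the interior of the union of
the fluid cells; both are connected and non-empty. -/
structure Mesh (d : ℕ) where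
  complex : Geometry.SimplicialComplex ℝ (Pt d)
  finite : complex.faces.Finite
  pure : ∀ s ∈ complex.faces, ∃ K ∈ complex.faces, s ⊆ K ∧ K.card = d + 1
  fluidCells : Set (Finset (Pt d))
  fluidCells_subset : ∀ K ∈ fluidCells, K ∈ complex.faces ∧ K.card = d + 1
  connected : IsConnected (interior complex.space)
  fluid_connected : IsConnected (interior (⋃ K ∈ fluidCells, convexHull ℝ (K : Set (Pt d))))

namespace Mesh

variable {d : ℕ} (M : Mesh d)

/-- The domain `Ω`. -/
def Om : Set (Pt d) := interior M.complex.space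

/-- The fluid subdomain `Ω_f`. -/
def OmF : Set (Pt d) := interior (⋃ K ∈ M.fluidCells, convexHull ℝ (K : Set (Pt d)))

/-- The elements `K ∈ 𝒯_h`. -/
def Cell := {K : Finset (Pt d) // K ∈ M.complex.faces ∧ K.card = d + 1}

/-- The edges (`d = 2`) or faces (`d = 3`) `e ∈ ε_h`: the codimension one simplices. -/
def Facet := {e : Finset (Pt d) // e ∈ M.complex.faces ∧ e.card = d}

/-- The edges (faces) of the element `K`. -/
def FacetOf (K : M.Cell) := {e : M.Facet // e.1 ⊆ K.1}

instance : Finite M.Cell := (M.finite.subset fun _ h => h.1 : Set.Finite _)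

instance : Finite M.Facet := (M.finite.subset fun _ h => h.1 : Set.Finite _)

instance (K : M.Cell) : Finite (M.FacetOf K) := inferInstanceAs (Finite {e : M.Facet // e.1 ⊆ K.1})

instance : Fintype M.Cell := Fintype.ofFinite _

instance (K : M.Cell) : Fintype (M.FacetOf K) := Fintype.ofFinite _

/-- `𝒯_h` as a finite set. -/
def cells : Finset M.Cell := Finset.univ

open Classical in
/-- `𝒯_h^f` as a finite set. -/
def cellsF : Finset M.Cell := Finset.univ.filter fun K => K.1 ∈ M.fluidCells

/-- The closed simplex `K`. -/
def cellSet (K : M.Cell) : Set (Pt d) := convexHull ℝ (K.1 : Set (Pt d))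

/-- The closed edge (face) `e`. -/
def facetSet (e : M.Facet) : Set (Pt d) := convexHull ℝ (e.1 : Set (Pt d))

/-- `h_K`, the diameter of `K`. -/
def hK (K : M.Cell) : ℝ := Metric.diam (M.cellSet K)

/-- Integration over `K` with respect to Lebesgue measure. -/
def cellInt (K : M.Cell) (F : M.cellSet K → ℝ) : ℝ :=
  ∫ x, F x ∂((volume : Measure (Pt d)).comap Subtype.val)

/-- Integration over `e` with respect to the `(d-1)`-dimensional surface measure. -/
def facetInt (e : M.Facet) (F : M.facetSet e → ℝ) : ℝ :=
  ∫ x, F x ∂((Measure.euclideanHausdorffMeasure (d - 1) : Measure (Pt d)).comap Subtype.val)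

/-- The component orthogonal to `e` of the vector from the barycentre of `e` to that of `K`;
it is orthogonal to `e` and points into `K`. -/
def inward (K : M.Cell) (e : M.FacetOf K) : Pt d :=
  (vectorSpan ℝ (e.1.1 : Set (Pt d)))ᗮ.starProjection
    (K.1.centroid ℝ id - e.1.1.centroid ℝ id)

/-- The unit normal vector `n_K` on the edge (face) `e` of `K`, outward to `K`. -/
def normal (K : M.Cell) (e : M.FacetOf K) : Pt d := -(‖M.inward K e‖⁻¹ • M.inward K e)

/-- The restriction to `e` of a function on `K`. -/
def trace (K : M.Cell) (e : M.FacetOf K) (v : M.cellSet K → ℝ) : M.facetSet e.1 → ℝ :=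
  fun x => v ⟨x.1, convexHull_mono (Finset.coe_subset.mpr e.2) x.2⟩

end Mesh

/-- The value of a polynomial in `d` variables at a point of `ℝ^d`. -/
def pval {d : ℕ} (p : MvPolynomial (Fin d) ℝ) (x : Pt d) : ℝ := MvPolynomial.eval (fun i => x i) p

/-- `P_j(D)`: restrictions to `D` of the polynomials of total degree at most `j`. -/
def polyOn {d : ℕ} (D : Set (Pt d)) (j : ℕ) : Submodule ℝ (D → ℝ) where
  carrier := {F | ∃ p : MvPolynomial (Fin d) ℝ, p.totalDegree ≤ j ∧ ∀ x : D, F x = pval p x}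
  add_mem' := by
    rintro F G ⟨p, hp, hF⟩ ⟨q, hq, hG⟩
    exact ⟨p + q, (MvPolynomial.totalDegree_add p q).trans (max_le hp hq),
      fun x => by simp [pval, hF, hG]⟩
  zero_mem' := ⟨0, by simp, fun x => by simp [pval]⟩
  smul_mem' := by
    rintro c F ⟨p, hp, hF⟩
    exact ⟨c • p, (MvPolynomial.totalDegree_smul_le c p).trans hp,
      fun x => by simp [pval, hF, MvPolynomial.smul_eval]⟩

section

variable {d : ℕ} (M : Mesh d)

/-- Scalar weak functions `v = {v_0, v_b}`: `v_0 = v.1` is given on each element and `v_b = v.2` on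
each edge (face).  Sums and products are taken entrywise. -/
abbrev Scal := ((K : M.Cell) → M.cellSet K → ℝ) × ((e : M.Facet) → M.facetSet e → ℝ)

/-- Vector valued weak functions, given by their `d` components. -/
abbrev Vect := Fin d → Scal M

/-- `G` satisfies the defining equations of the discrete weak gradient `∇_{w,r,K} v`. -/
def IsWeakGrad (r : ℕ) (K : M.Cell) (v : Scal M) (G : Fin d → M.cellSet K → ℝ) : Prop :=
  (∀ i, G i ∈ polyOn (M.cellSet K) r) ∧
  ∀ t : Fin d → MvPolynomial (Fin d) ℝ, (∀ i, (t i).totalDegree ≤ r) →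
    M.cellInt K (fun x => ∑ i, G i x * pval (t i) x) =
      - M.cellInt K (fun x => v.1 K x * ∑ i, pval (MvPolynomial.pderiv i (t i)) x)
      + ∑ e : M.FacetOf K,
          M.facetInt e.1 (fun x => v.2 e.1 x * ∑ i, pval (t i) x * M.normal K e i)

/-- The discrete weak gradient `∇_{w,r} v` on `K`. -/
def wgrad (r : ℕ) (K : M.Cell) (v : Scal M) : Fin d → M.cellSet K → ℝ :=
  Classical.epsilon (IsWeakGrad M r K v)

/-- `D` satisfies the defining equations of the discrete weak divergence `∇_{w,r,K} · w`. -/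
def IsWeakDiv (r : ℕ) (K : M.Cell) (w : Vect M) (D : M.cellSet K → ℝ) : Prop :=
  D ∈ polyOn (M.cellSet K) r ∧
  ∀ t : MvPolynomial (Fin d) ℝ, t.totalDegree ≤ r →
    M.cellInt K (fun x => D x * pval t x) =
      - M.cellInt K (fun x => ∑ i, (w i).1 K x * pval (MvPolynomial.pderiv i t) x)
      + ∑ e : M.FacetOf K,
          M.facetInt e.1 (fun x => (∑ i, (w i).2 e.1 x * M.normal K e i) * pval t x)

/-- The discrete weak divergence `∇_{w,r} · w` on `K`. -/
def wdiv (r : ℕ) (K : M.Cell) (w : Vect M) : M.cellSet K → ℝ :=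
  Classical.epsilon (IsWeakDiv M r K w)

/-- `q` satisfies the defining equations of the `L²(e)`-projection of `v` onto `P_j(e)`. -/
def IsProj (j : ℕ) (e : M.Facet) (v q : M.facetSet e → ℝ) : Prop :=
  q ∈ polyOn (M.facetSet e) j ∧
  ∀ t ∈ polyOn (M.facetSet e) j,
    M.facetInt e (fun x => q x * t x) = M.facetInt e (fun x => v x * t x)

/-- The `L²`-projection `Q_j^b : L²(e) → P_j(e)`. -/
def Qb (j : ℕ) (e : M.Facet) (v : M.facetSet e → ℝ) : M.facetSet e → ℝ :=
  Classical.epsilon (IsProj M j e v)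

/-- Weak functions on the partition `C` whose interior part is in `P_j(K)` for `K ∈ C` and whose
trace is in `P_l(e)` for the edges (faces) `e` of elements of `C`, with `v_b = 0` on the edges
(faces) in `Z`.  They are extended by zero to the elements outside `C` and to the edges (faces)
which belong to no element of `C`. -/
def wgSpace (C : Finset M.Cell) (Z : Set M.Facet) (j l : ℕ) : Submodule ℝ (Scal M) where
  carrier := {v | (∀ K ∈ C, v.1 K ∈ polyOn (M.cellSet K) j) ∧ (∀ K, K ∉ C → v.1 K = 0) ∧
    (∀ e, v.2 e ∈ polyOn (M.facetSet e) l) ∧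
    (∀ e, (¬ ∃ K ∈ C, e.1 ⊆ K.1) ∨ e ∈ Z → v.2 e = 0)}
  add_mem' := by
    rintro v w ⟨h1, h2, h3, h4⟩ ⟨g1, g2, g3, g4⟩
    refine ⟨fun K hK => add_mem (h1 K hK) (g1 K hK), fun K hK => ?_,
      fun e => add_mem (h3 e) (g3 e), fun e he => ?_⟩
    · simp [h2 K hK, g2 K hK]
    · simp [h4 e he, g4 e he]
  zero_mem' := ⟨fun _ _ => zero_mem _, fun _ _ => rfl, fun _ => zero_mem _, fun _ _ => rfl⟩
  smul_mem' := by
    rintro c v ⟨h1, h2, h3, h4⟩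
    refine ⟨fun K hK => Submodule.smul_mem _ c (h1 K hK), fun K hK => ?_,
      fun e => Submodule.smul_mem _ c (h3 e), fun e he => ?_⟩
    · simp [h2 K hK]
    · simp [h4 e he]

/-- The velocity space `V_h^0` (velocities live on `𝒯_h^f` and vanish in `Ω_s` and on `∂Ω_f`). -/
def V0 (k l : ℕ) : Submodule ℝ (Vect M) :=
  Submodule.pi Set.univ fun _ => wgSpace M M.cellsF {e | M.facetSet e ⊆ frontier M.OmF} k l

/-- The pressure space `Q_h^0`: piecewise `P_{k-1}` and `P_k` on `𝒯_h^f`, with `q_{h0}` of mean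
value zero. -/
def Q0 (k : ℕ) : Set (Scal M) :=
  {q | q ∈ wgSpace M M.cellsF ∅ (k - 1) k ∧ ∑ K ∈ M.cellsF, M.cellInt K (q.1 K) = 0}

/-- The temperature space `S_h^0`. -/
def S0 (k l : ℕ) : Submodule ℝ (Scal M) :=
  wgSpace M M.cells {e | M.facetSet e ⊆ frontier M.Om} k l

/-- `(∇_{w,m} v, ∇_{w,m} w) + ⟨τ(Q_l^b v_0 - v_b), Q_l^b w_0 - w_b⟩`, the sum being over the
elements in `C`, with `τ = h_K⁻¹` on `∂K`. -/
def diffusion (C : Finset M.Cell) (l m : ℕ) (v w : Scal M) : ℝ :=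
  ∑ K ∈ C, (M.cellInt K (fun x => ∑ i, wgrad M m K v i x * wgrad M m K w i x) +
    ∑ e : M.FacetOf K, (M.hK K)⁻¹ * M.facetInt e.1 (fun x =>
      (Qb M l e.1 (M.trace K e (v.1 K)) x - v.2 e.1 x) *
      (Qb M l e.1 (M.trace K e (w.1 K)) x - w.2 e.1 x)))

/-- `a_h(u, v)`. -/
def aForm (l m : ℕ) (Pr : ℝ) (u v : Vect M) : ℝ :=
  Pr * ∑ i, diffusion M M.cellsF l m (u i) (v i)

/-- `ā_h(T, s)`. -/
def aBar (l m : ℕ) (κ : ℝ) (T s : Scal M) : ℝ := κ * diffusion M M.cells l m T s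

/-- `b_h(v, q)`. -/
def bForm (k : ℕ) (v : Vect M) (q : Scal M) : ℝ :=
  ∑ K ∈ M.cellsF, M.cellInt K (fun x => ∑ i, wgrad M k K q i x * (v i).1 K x)

/-- The vector `j`: the last standard basis vector. -/
def jvec (i : Fin d) : ℝ := if (i : ℕ) + 1 = d then 1 else 0

/-- `(j T_0, v_0)`. -/
def buoyancy (T : Scal M) (v : Vect M) : ℝ :=
  ∑ K ∈ M.cellsF, M.cellInt K (fun x => ∑ i, jvec i * T.1 K x * (v i).1 K x)

/-- `d_h(T, v)`. -/
def dForm (Pr Ra : ℝ) (T : Scal M) (v : Vect M) : ℝ := Pr * Ra * buoyancy M T v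

/-- `c_h(w; u, v)`; the `i`-th row of `u ⊗ w` is `u_i w`. -/
def cForm (k : ℕ) (w u v : Vect M) : ℝ :=
  1 / 2 * ∑ K ∈ M.cellsF, M.cellInt K (fun x =>
    ∑ i, wdiv M k K (fun j => u i * w j) x * (v i).1 K x) -
  1 / 2 * ∑ K ∈ M.cellsF, M.cellInt K (fun x =>
    ∑ i, wdiv M k K (fun j => v i * w j) x * (u i).1 K x)

/-- `c̄_h(u; T, s)`. -/
def cBar (k : ℕ) (u : Vect M) (T s : Scal M) : ℝ :=
  1 / 2 * ∑ K ∈ M.cells, M.cellInt K (fun x => wdiv M k K (fun j => u j * T) x * s.1 K x) -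
  1 / 2 * ∑ K ∈ M.cells, M.cellInt K (fun x => wdiv M k K (fun j => u j * s) x * T.1 K x)

/-- `(f, v_0)`. -/
def loadF (f : Pt d → Pt d) (v : Vect M) : ℝ :=
  ∑ K ∈ M.cellsF, M.cellInt K (fun x => ∑ i, f x i * (v i).1 K x)

/-- `(g, s_0)`. -/
def loadG (g : Pt d → ℝ) (s : Scal M) : ℝ :=
  ∑ K ∈ M.cells, M.cellInt K (fun x => g x * s.1 K x)

/-- The velocity norm `|||v|||`. -/
def normV (l m : ℕ) (v : Vect M) : ℝ :=
  Real.sqrt (∑ i, diffusion M M.cellsF l m (v i) (v i))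

/-- The temperature norm `|||s|||`. -/
def normS (l m : ℕ) (s : Scal M) : ℝ := Real.sqrt (diffusion M M.cells l m s s)

/-- The pressure norm `‖q‖`. -/
def normQ (k : ℕ) (q : Scal M) : ℝ :=
  Real.sqrt (∑ K ∈ M.cellsF, M.cellInt K (fun x => q.1 K x ^ 2) +
    ∑ K ∈ M.cellsF, M.cellInt K (fun x => ∑ i, wgrad M k K q i x ^ 2))

/-- The space `W_h` of discretely divergence-free velocities. -/
def W (k l : ℕ) : Set (Vect M) := {w | w ∈ V0 M k l ∧ ∀ q ∈ Q0 M k, bForm M k w q = 0}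

/-- `𝒩_h`. -/
def Nh (k l m : ℕ) : ℝ :=
  sSup {r | ∃ w ∈ W M k l, ∃ u ∈ W M k l, ∃ v ∈ W M k l, w ≠ 0 ∧ u ≠ 0 ∧ v ≠ 0 ∧
    r = cForm M k w u v / (normV M l m w * normV M l m u * normV M l m v)}

/-- `ℳ_h`. -/
def Mh (k l m : ℕ) : ℝ :=
  sSup {r | ∃ w ∈ W M k l, ∃ T ∈ S0 M k l, ∃ s ∈ S0 M k l, w ≠ 0 ∧ T ≠ 0 ∧ s ≠ 0 ∧
    r = cBar M k w T s / (normV M l m w * normS M l m T * normS M l m s)}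

/-- `𝒟_h`, the norm of the bilinear form `(j T_0, v_0)` on `S_h^0 × W_h`. -/
def Dh (k l m : ℕ) : ℝ :=
  sSup {r | ∃ T ∈ S0 M k l, ∃ v ∈ W M k l, T ≠ 0 ∧ v ≠ 0 ∧
    r = buoyancy M T v / (normS M l m T * normV M l m v)}

/-- `‖f‖_h`. -/
def normF (k l m : ℕ) (f : Pt d → Pt d) : ℝ :=
  sSup {r | ∃ v ∈ W M k l, v ≠ 0 ∧ r = loadF M f v / normV M l m v}

/-- `‖g‖_h`. -/
def normG (k l m : ℕ) (g : Pt d → ℝ) : ℝ :=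
  sSup {r | ∃ s ∈ S0 M k l, s ≠ 0 ∧ r = loadG M g s / normS M l m s}

/-- The quantity `C_0`; `β` is a constant in the estimate
`d_h(T, v) ≤ β Pr Ra |||T||| |||v|||`. -/
def C0 (k l m : ℕ) (Pr Ra κ β : ℝ) (f : Pt d → Pt d) (g : Pt d → ℝ) : ℝ :=
  1 - (β * (Pr⁻¹ * Nh M k l m * Ra * κ⁻¹ + Mh M k l m * Ra * (κ ^ 2)⁻¹) * normG M k l m g
    + Nh M k l m * (Pr ^ 2)⁻¹ * normF M k l m f)

/-- `(u, p, T)` is a solution of the nonlinear WG scheme. -/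
def IsWGSolution (k l m : ℕ) (Pr Ra κ : ℝ) (f : Pt d → Pt d) (g : Pt d → ℝ)
    (u : Vect M) (p T : Scal M) : Prop :=
  u ∈ V0 M k l ∧ p ∈ Q0 M k ∧ T ∈ S0 M k l ∧
  (∀ v ∈ V0 M k l, ∀ q ∈ Q0 M k,
    aForm M l m Pr u v + cForm M k u u v + bForm M k v p - bForm M k u q - dForm M Pr Ra T v
      = loadF M f v) ∧
  (∀ s ∈ S0 M k l, aBar M l m κ T s + cBar M k u T s = loadG M g s)

/-- `(u, p, T)` is obtained from the previous velocity iterate `u'` by one step of the Oseen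
iteration. -/
def IsOseenStep (k l m : ℕ) (Pr Ra κ : ℝ) (f : Pt d → Pt d) (g : Pt d → ℝ)
    (u' u : Vect M) (p T : Scal M) : Prop :=
  u ∈ V0 M k l ∧ p ∈ Q0 M k ∧ T ∈ S0 M k l ∧
  (∀ v ∈ V0 M k l, ∀ q ∈ Q0 M k,
    aForm M l m Pr u v + cForm M k u' u v + bForm M k v p - bForm M k u q
      = loadF M f v + dForm M Pr Ra T v) ∧
  (∀ s ∈ S0 M k l, aBar M l m κ T s + cBar M k u' T s = loadG M g s)

end

end WG

end

/-! Both schemes are instances of one abstract step with a convecting velocity `w`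
(`ConvectionData.IsStep`): the nonlinear scheme has `w = u`, the Oseen iteration takes for `w` the
previous iterate. Testing with `v = 0` puts every computed velocity in W_h. Since c_h and c̄_h
vanish when their last two arguments coincide, testing with the solution itself gives |||T||| ≤
κ⁻¹‖g‖_h and |||u||| ≤ Pr⁻¹(‖f‖_h + Pr Ra β κ⁻¹‖g‖_h).

Subtract the two schemes. The difference of the convection terms is c_h(uⁿ; eⁿ⁺¹, ·) + c_h(eⁿ; u,
·), and the first summand disappears when tested with eⁿ⁺¹; the same happens for the temperature.
Hence the temperature error of step n+1 is at most κ⁻² ℳ_h ‖g‖_h |||eⁿ|||, and the momentum equation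
then yields |||eⁿ⁺¹||| ≤ ρ |||eⁿ||| with ρ = 1 - C₀ (`IsStep.velocity_error_le`). This needs uⁿ ∈
W_h, which is automatic for n ≥ 1 and an assumption for n = 0; that is why there are two rate
statements.

For the pressure, the momentum equation expresses b_h(v, pⁿ - p) through terms that tend to zero for
each fixed v. The spaces are finite dimensional and b_h separates pressures, so pⁿ → p
(`tendsto_form_of_separating`); no uniform inf-sup constant is required.

The rest checks the hypotheses of this argument on a mesh. The weak operators and the projection are
given by a choice, so existence and uniqueness (`exists_riesz`) must precede linearity. The energies
are definite: zero energy forces a weak function to be constant on each element, with the same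
constant as trace, and these constants propagate to the boundary, where they are zero
(`eq_const_of_diffusion_self`, `Mesh.const_eq_zero`). A pressure orthogonal to all velocities has
zero weak gradient; testing with barycentric bubbles makes it constant on each element, and
connectedness of Ω_f with mean value zero makes it vanish (`eq_zero_of_bForm_eq_zero`). Definiteness
makes the suprema 𝒩_h, ℳ_h, 𝒟_h, ‖f‖_h, ‖g‖_h finite, hence true bounds (`Nh_bound` and its
companions). The integration by parts used for the two kernels rests on the divergence theorem on a
simplex, obtained from Fubini and the fundamental theorem of calculus along an edge
(`integral_simplex_deriv`). -/

namespace WG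

set_option linter.unusedSectionVars false

/-! ### Bilinear and trilinear forms on finite-dimensional spaces. -/

section FiniteDimensional

variable {U V S Q : Type*} [AddCommGroup U] [Module ℝ U] [AddCommGroup V] [Module ℝ V]
  [AddCommGroup S] [Module ℝ S] [AddCommGroup Q] [Module ℝ Q]

/-- A non-negative function on a vector space which controls every linear functional. -/
def Dominates (N : V → ℝ) : Prop :=
  (∀ v, 0 ≤ N v) ∧ ∀ φ : V →ₗ[ℝ] ℝ, ∃ C, 0 ≤ C ∧ ∀ v, |φ v| ≤ C * N v

theorem cauchySchwarz_form {A : V →ₗ[ℝ] V →ₗ[ℝ] ℝ} (hs : ∀ u v, A u v = A v u)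
    (hp : ∀ v, 0 ≤ A v v) (u v : V) : |A u v| ≤ √(A u u) * √(A v v) := by
  rw [← Real.sqrt_mul (hp u)]
  apply Real.abs_le_sqrt
  exact LinearMap.BilinForm.apply_sq_le_of_symm A hp ⟨fun x y => by simpa using hs x y⟩ u v

/-- A definite form is nondegenerate, so in finite dimension every functional is `A w` for some `w`;
Cauchy–Schwarz then bounds it with constant `√(A w w)`. -/
theorem dominates_sqrt [FiniteDimensional ℝ V] {A : V →ₗ[ℝ] V →ₗ[ℝ] ℝ}
    (hs : ∀ u v, A u v = A v u) (hp : ∀ v, 0 ≤ A v v) (hd : ∀ v, A v v = 0 → v = 0) :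
    Dominates fun v => √(A v v) := by
  refine ⟨fun v => Real.sqrt_nonneg _, fun φ => ?_⟩
  have hinj : Function.Injective (A : V →ₗ[ℝ] Module.Dual ℝ V) := by
    rw [injective_iff_map_eq_zero]
    exact fun v hv => hd v (by rw [hv]; rfl)
  obtain ⟨w, hw⟩ := ((LinearMap.injective_iff_surjective_of_finrank_eq_finrank
    (Subspace.dual_finrank_eq (K := ℝ) (V := V)).symm).1 hinj) φ
  refine ⟨√(A w w), Real.sqrt_nonneg _, fun v => ?_⟩
  rw [← hw]
  exact cauchySchwarz_form hs hp w v

theorem Dominates.tendsto {N : V → ℝ} (hN : Dominates N) (φ : V →ₗ[ℝ] ℝ) {x : ℕ → V}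
    (hx : Filter.Tendsto (fun n => N (x n)) Filter.atTop (nhds 0)) :
    Filter.Tendsto (fun n => φ (x n)) Filter.atTop (nhds 0) := by
  obtain ⟨C, hC, h⟩ := hN.2 φ
  exact squeeze_zero_norm (fun n => h (x n)) (by simpa using hx.const_mul C)

theorem map_eq_sum_coord {ι X : Type*} [Fintype ι] [AddCommMonoid X] [Module ℝ X]
    (e : Module.Basis ι ℝ U) (φ : U →ₗ[ℝ] X) (u : U) :
    φ u = ∑ i, e.coord i u • φ (e i) := by
  conv_lhs => rw [← e.sum_repr u]
  simp only [map_sum, map_smul, Module.Basis.coord_apply]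

/-- Expanding the first argument in a basis reduces the claim to coordinate functionals and to the
functionals `φ (e i)`, all controlled by hypothesis. Such bounds make the suprema in the theorem
finite. -/
theorem Dominates.bound₂ [FiniteDimensional ℝ U] {N : U → ℝ} {N' : V → ℝ} (hN : Dominates N)
    (hN' : Dominates N') (φ : U →ₗ[ℝ] V →ₗ[ℝ] ℝ) :
    ∃ C, 0 ≤ C ∧ ∀ u v, |φ u v| ≤ C * (N u * N' v) := by
  let e := Module.finBasis ℝ U
  choose C hC hC' using fun i => hN.2 (e.coord i)
  choose D hD hD' using fun i => hN'.2 (φ (e i))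
  refine ⟨∑ i, C i * D i, Finset.sum_nonneg fun i _ => mul_nonneg (hC i) (hD i), fun u v => ?_⟩
  have : φ u v = ∑ i, e.coord i u * φ (e i) v := by
    rw [map_eq_sum_coord e φ u]
    simp
  rw [this, Finset.sum_mul]
  refine (Finset.abs_sum_le_sum_abs _ _).trans (Finset.sum_le_sum fun i _ => ?_)
  rw [abs_mul]
  calc |e.coord i u| * |φ (e i) v| ≤ (C i * N u) * (D i * N' v) :=
        mul_le_mul (hC' i u) (hD' i v) (abs_nonneg _) (mul_nonneg (hC i) (hN.1 u))
    _ = C i * D i * (N u * N' v) := by ring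

theorem Dominates.bound₃ [FiniteDimensional ℝ U] [FiniteDimensional ℝ V] {N : U → ℝ} {N' : V → ℝ}
    {N'' : S → ℝ} (hN : Dominates N) (hN' : Dominates N') (hN'' : Dominates N'')
    (φ : U →ₗ[ℝ] V →ₗ[ℝ] S →ₗ[ℝ] ℝ) :
    ∃ C, 0 ≤ C ∧ ∀ u v s, |φ u v s| ≤ C * (N u * N' v * N'' s) := by
  let e := Module.finBasis ℝ U
  choose C hC hC' using fun i => hN.2 (e.coord i)
  choose D hD hD' using fun i => hN'.bound₂ hN'' (φ (e i))
  refine ⟨∑ i, C i * D i, Finset.sum_nonneg fun i _ => mul_nonneg (hC i) (hD i),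
    fun u v s => ?_⟩
  have : φ u v s = ∑ i, e.coord i u * φ (e i) v s := by
    rw [map_eq_sum_coord e φ u]
    simp
  rw [this, Finset.sum_mul]
  refine (Finset.abs_sum_le_sum_abs _ _).trans (Finset.sum_le_sum fun i _ => ?_)
  rw [abs_mul]
  calc |e.coord i u| * |φ (e i) v s| ≤ (C i * N u) * (D i * (N' v * N'' s)) :=
        mul_le_mul (hC' i u) (hD' i v s) (abs_nonneg _) (mul_nonneg (hC i) (hN.1 u))
    _ = C i * D i * (N u * N' v * N'' s) := by ring

/-- In finite dimensions, if a bilinear form separates the points of `Q` and `b(v, q_n) → 0` for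
every `v`, then `q_n → 0`. -/
theorem tendsto_form_of_separating [FiniteDimensional ℝ V] [FiniteDimensional ℝ Q]
    (b : V →ₗ[ℝ] Q →ₗ[ℝ] ℝ) (hb : ∀ q, (∀ v, b v q = 0) → q = 0) (R : Q →ₗ[ℝ] Q →ₗ[ℝ] ℝ)
    (q : ℕ → Q) (hq : ∀ v, Filter.Tendsto (fun n => b v (q n)) Filter.atTop (nhds 0)) :
    Filter.Tendsto (fun n => R (q n) (q n)) Filter.atTop (nhds 0) := by
  have hker : LinearMap.ker b.flip = ⊥ := by
    rw [LinearMap.ker_eq_bot']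
    exact fun q h => hb q fun v => by simpa using congrArg (fun φ => φ v) h
  obtain ⟨g, hg⟩ := LinearMap.exists_leftInverse_of_injective b.flip hker
  -- With a left inverse `g` of `q ↦ b(·, q)`, the functional `ψ ∘ g` on the dual of `V` is
  -- evaluation at some `v`. So every functional on `Q` has the form `b v`, and the hypothesis gives
  -- weak convergence.
  have key (ψ : Q →ₗ[ℝ] ℝ) : Filter.Tendsto (fun n => ψ (q n)) Filter.atTop (nhds 0) := by
    obtain ⟨v, hv⟩ := (Module.evalEquiv ℝ V).surjective (ψ ∘ₗ g)
    refine (hq v).congr fun n => Eq.symm ?_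
    have h1 : g (b.flip (q n)) = q n := by
      simpa using congrArg (fun φ => φ (q n)) hg
    calc ψ (q n) = (ψ ∘ₗ g) (b.flip (q n)) := by simp [h1]
      _ = b v (q n) := by rw [← hv]; simp
  let e := Module.finBasis ℝ Q
  have : (fun n => R (q n) (q n)) = fun n => ∑ i, e.coord i (q n) * R (e i) (q n) := by
    funext n
    rw [map_eq_sum_coord e R (q n)]
    simp
  rw [this]
  simpa using tendsto_finsetSum Finset.univ fun i (_ : i ∈ Finset.univ) =>
    (key (e.coord i)).mul (key (R (e i)))

/-- Testing an equation with its own solution gives a quadratic bound of this shape, where `x` is an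
energy norm. One factor `x` is cancelled; if `x = 0`, nonnegativity of `y` suffices. -/
theorem le_inv_mul_of_mul_sq_le {a x y : ℝ} (ha : 0 < a) (hx : 0 ≤ x) (hy : 0 ≤ y)
    (h : a * x ^ 2 ≤ y * x) : x ≤ a⁻¹ * y := by
  rcases hx.eq_or_lt with rfl | hx
  · positivity
  · rw [inv_mul_eq_div, le_div_iff₀ ha]
    refine le_of_mul_le_mul_right ?_ hx
    nlinarith

/-! ### The abstract convection problem and the contraction estimate. -/

/-- The data of a discrete natural convection problem on spaces of velocities, pressures and
temperatures, together with the bounds for its forms on the kernel of `b`. -/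
structure ConvectionData (V S Q : Type*) [AddCommGroup V] [Module ℝ V] [AddCommGroup S] [Module ℝ S]
    [AddCommGroup Q] [Module ℝ Q] where
  A : V →ₗ[ℝ] V →ₗ[ℝ] ℝ
  A_symm : ∀ u v, A u v = A v u
  A_nonneg : ∀ v, 0 ≤ A v v
  A_def : ∀ v, A v v = 0 → v = 0
  B : S →ₗ[ℝ] S →ₗ[ℝ] ℝ
  B_symm : ∀ u v, B u v = B v u
  B_nonneg : ∀ v, 0 ≤ B v v
  B_def : ∀ v, B v v = 0 → v = 0
  b : V →ₗ[ℝ] Q →ₗ[ℝ] ℝ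
  b_sep : ∀ q, (∀ v, b v q = 0) → q = 0
  j : S →ₗ[ℝ] V →ₗ[ℝ] ℝ
  c : V →ₗ[ℝ] V →ₗ[ℝ] V →ₗ[ℝ] ℝ
  c_self : ∀ w u, c w u u = 0
  cb : V →ₗ[ℝ] S →ₗ[ℝ] S →ₗ[ℝ] ℝ
  cb_self : ∀ w s, cb w s s = 0
  F : V →ₗ[ℝ] ℝ
  G : S →ₗ[ℝ] ℝ
  Pr : ℝ
  Ra : ℝ
  κ : ℝ
  Pr_pos : 0 < Pr
  Ra_pos : 0 < Ra
  κ_pos : 0 < κ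
  β : ℝ
  N : ℝ
  L : ℝ
  nF : ℝ
  nG : ℝ
  β_nonneg : 0 ≤ β
  N_nonneg : 0 ≤ N
  L_nonneg : 0 ≤ L
  nF_nonneg : 0 ≤ nF
  nG_nonneg : 0 ≤ nG
  j_le : ∀ T v, (∀ q, b v q = 0) → j T v ≤ β * (√(B T T) * √(A v v))
  c_le : ∀ w u v, (∀ q, b w q = 0) → (∀ q, b u q = 0) → (∀ q, b v q = 0) →
    c w u v ≤ N * (√(A w w) * √(A u u) * √(A v v))
  cb_le : ∀ w T s, (∀ q, b w q = 0) → cb w T s ≤ L * (√(A w w) * √(B T T) * √(B s s))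
  F_le : ∀ v, (∀ q, b v q = 0) → F v ≤ nF * √(A v v)
  G_le : ∀ s, G s ≤ nG * √(B s s)

namespace ConvectionData

variable (D : ConvectionData V S Q)

/-- The contraction factor of the Oseen iteration. -/
noncomputable def rho : ℝ :=
  D.β * (D.Pr⁻¹ * D.N * D.Ra * D.κ⁻¹ + D.L * D.Ra * (D.κ ^ 2)⁻¹) * D.nG + D.N * (D.Pr ^ 2)⁻¹ * D.nF

/-- One step of the Oseen iteration with convecting velocity `w`; the solutions of the nonlinear
scheme are those with `w = u`. -/
def IsStep (w u : V) (p : Q) (T : S) : Prop :=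
  (∀ v q, D.Pr * D.A u v + D.c w u v + D.b v p - D.b u q = D.F v + D.Pr * D.Ra * D.j T v) ∧
  ∀ s, D.κ * D.B T s + D.cb w T s = D.G s

variable {D}

theorem IsStep.b_eq_zero {w u : V} {p : Q} {T : S} (h : D.IsStep w u p T) (q : Q) : D.b u q = 0 := by
  simpa using h.1 0 q

/-- Test with `s = T`: the convection term drops out whatever the convecting velocity is. -/
theorem IsStep.temperature_le {w u : V} {p : Q} {T : S} (h : D.IsStep w u p T) :
    √(D.B T T) ≤ D.κ⁻¹ * D.nG := by
  refine le_inv_mul_of_mul_sq_le D.κ_pos (Real.sqrt_nonneg _) D.nG_nonneg ?_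
  rw [Real.sq_sqrt (D.B_nonneg T)]
  have := h.2 T
  rw [D.cb_self] at this
  linarith [D.G_le T]

/-- Test with `v = u`: convection vanishes by skewness, the pressure term because `u` is discretely
divergence-free, and the buoyancy is controlled by the temperature bound. -/
theorem IsStep.velocity_le {w u : V} {p : Q} {T : S} (h : D.IsStep w u p T) :
    √(D.A u u) ≤ D.Pr⁻¹ * (D.nF + D.Pr * D.Ra * D.β * (D.κ⁻¹ * D.nG)) := by
  have hPr := D.Pr_pos
  have hRa := D.Ra_pos
  have hκ := D.κ_pos
  have hβ := D.β_nonneg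
  have hF := D.nF_nonneg
  have hG := D.nG_nonneg
  refine le_inv_mul_of_mul_sq_le D.Pr_pos (Real.sqrt_nonneg _) (by positivity) ?_
  rw [Real.sq_sqrt (D.A_nonneg u)]
  have h1 := h.1 u 0
  rw [D.c_self, h.b_eq_zero, map_zero] at h1
  have h2 := D.F_le u h.b_eq_zero
  have h3 : D.Pr * D.Ra * D.j T u ≤ D.Pr * D.Ra * D.β * (D.κ⁻¹ * D.nG) * √(D.A u u) := by
    calc D.Pr * D.Ra * D.j T u
        ≤ D.Pr * D.Ra * (D.β * (√(D.B T T) * √(D.A u u))) := by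
          gcongr; exact D.j_le T u h.b_eq_zero
      _ ≤ D.Pr * D.Ra * (D.β * ((D.κ⁻¹ * D.nG) * √(D.A u u))) := by
          gcongr; exact h.temperature_le
      _ = _ := by ring
  linarith

variable {u₀ u : V} {p : Q} {T : S} {u₁ u₂ : V} {p₂ : Q} {T₂ : S}

theorem IsStep.temperature_error_le (h : D.IsStep u u p T) (h₂ : D.IsStep u₁ u₂ p₂ T₂)
    (hu₁ : ∀ q, D.b u₁ q = 0) :
    √(D.B (T₂ - T) (T₂ - T)) ≤ D.κ⁻¹ * (D.L * (D.κ⁻¹ * D.nG) * √(D.A (u₁ - u) (u₁ - u))) := by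
  have hκ := D.κ_pos
  have hL := D.L_nonneg
  have hG := D.nG_nonneg
  refine le_inv_mul_of_mul_sq_le D.κ_pos (Real.sqrt_nonneg _) (by positivity) ?_
  rw [Real.sq_sqrt (D.B_nonneg _)]
  set E := T₂ - T with hE
  have hT₂ : T₂ = T + E := by rw [hE]; abel
  have h1 := h.2 E
  have h2 := h₂.2 E
  have hu₁' : u₁ = u + (u₁ - u) := by abel
  rw [hT₂] at h2
  have h0 := D.cb_self u₁ E
  -- The convection terms differ by `cb u₁ E E + cb (u₁ - u) T E`. The first is zero; the second
  -- contains the temperature of the nonlinear scheme, whose norm is already bounded.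
  have h3 : D.cb u₁ T E = D.cb u T E + D.cb (u₁ - u) T E := by
    conv_lhs => rw [hu₁']
    simp only [map_add, LinearMap.add_apply]
  simp only [map_add, LinearMap.add_apply] at h2
  have hb : ∀ q, D.b (u₁ - u) q = 0 := fun q => by
    rw [map_sub, LinearMap.sub_apply, hu₁, h.b_eq_zero, sub_zero]
  -- The assumed bounds are one-sided and the term enters with a minus sign, hence the argument
  -- `-E`.
  have h4 := D.cb_le (u₁ - u) T (-E) hb
  simp only [map_neg, LinearMap.neg_apply, neg_neg] at h4
  have h5 : D.L * (√(D.A (u₁ - u) (u₁ - u)) * √(D.B T T) * √(D.B E E)) ≤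
      D.L * (√(D.A (u₁ - u) (u₁ - u)) * (D.κ⁻¹ * D.nG) * √(D.B E E)) := by
    gcongr; exact h.temperature_le
  linarith

/-- The factor has two sources: convection of the fixed velocity `u` by the previous error,
estimated with the a priori bound for `u`, and the buoyancy of the temperature error, which is
itself linear in the previous velocity error. -/
theorem IsStep.velocity_error_le (h : D.IsStep u u p T) (h₂ : D.IsStep u₁ u₂ p₂ T₂)
    (hu₁ : ∀ q, D.b u₁ q = 0) :
    √(D.A (u₂ - u) (u₂ - u)) ≤ D.rho * √(D.A (u₁ - u) (u₁ - u)) := by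
  have hκ := D.κ_pos
  have hL := D.L_nonneg
  have hG := D.nG_nonneg
  have hPr := D.Pr_pos
  have hRa := D.Ra_pos
  have hβ := D.β_nonneg
  have hF := D.nF_nonneg
  have hN := D.N_nonneg
  have hTe := h.temperature_error_le h₂ hu₁
  set E := T₂ - T with hE
  have hT₂ : T₂ = T + E := by rw [hE]; abel
  set e := u₂ - u with he
  have hu₂ : u₂ = u + e := by rw [he]; abel
  set e₁ := u₁ - u with he₁
  have hu₁' : u₁ = u + e₁ := by rw [he₁]; abel
  have hbe : ∀ q, D.b e q = 0 := fun q => by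
    rw [he, map_sub, LinearMap.sub_apply, h₂.b_eq_zero, h.b_eq_zero, sub_zero]
  have hbe₁ : ∀ q, D.b e₁ q = 0 := fun q => by
    rw [he₁, map_sub, LinearMap.sub_apply, hu₁, h.b_eq_zero, sub_zero]
  have h1 := h.1 e 0
  have h2 := h₂.1 e 0
  have h0 := D.c_self u₁ e
  have h3 : D.c u₁ u e = D.c u u e + D.c e₁ u e := by
    conv_lhs => rw [hu₁']
    simp only [map_add, LinearMap.add_apply]
  rw [hu₂, hT₂] at h2
  simp only [map_add, LinearMap.add_apply, hbe, map_zero] at h1 h2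
  have h4 := D.c_le e₁ u (-e) hbe₁ h.b_eq_zero fun q => by
    rw [map_neg, LinearMap.neg_apply, hbe, neg_zero]
  simp only [map_neg, LinearMap.neg_apply, neg_neg] at h4
  have h5 := D.j_le E e hbe
  have h6 : √(D.A e e) ≤ D.Pr⁻¹ *
      (D.N * (D.Pr⁻¹ * (D.nF + D.Pr * D.Ra * D.β * (D.κ⁻¹ * D.nG))) * √(D.A e₁ e₁) +
        D.Pr * D.Ra * D.β * (D.κ⁻¹ * (D.L * (D.κ⁻¹ * D.nG) * √(D.A e₁ e₁)))) := by
    refine le_inv_mul_of_mul_sq_le D.Pr_pos (Real.sqrt_nonneg _) (by positivity) ?_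
    rw [Real.sq_sqrt (D.A_nonneg _)]
    have h7 : D.N * (√(D.A e₁ e₁) * √(D.A u u) * √(D.A e e)) ≤ D.N * (√(D.A e₁ e₁) *
        (D.Pr⁻¹ * (D.nF + D.Pr * D.Ra * D.β * (D.κ⁻¹ * D.nG))) * √(D.A e e)) := by
      gcongr; exact h.velocity_le
    have h8 : D.Pr * D.Ra * D.j E e ≤ D.Pr * D.Ra * (D.β *
        ((D.κ⁻¹ * (D.L * (D.κ⁻¹ * D.nG) * √(D.A e₁ e₁))) * √(D.A e e))) := by
      gcongr
      refine h5.trans ?_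
      gcongr
    linarith
  refine h6.trans (le_of_eq ?_)
  unfold rho
  field_simp
  ring

theorem tendsto (hρ : D.rho < 1) [FiniteDimensional ℝ V] [FiniteDimensional ℝ S]
    [FiniteDimensional ℝ Q] (R : Q →ₗ[ℝ] Q →ₗ[ℝ] ℝ) (h : D.IsStep u u p T)
    (us : ℕ → V) (ps : ℕ → Q) (Ts : ℕ → S)
    (hs : ∀ n, D.IsStep (us n) (us (n + 1)) (ps (n + 1)) (Ts (n + 1))) :
    (∀ n, √(D.A (us (n + 1) - u) (us (n + 1) - u)) ≤
      D.rho ^ n * √(D.A (us 1 - u) (us 1 - u))) ∧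
    ((∀ q, D.b (us 0) q = 0) → ∀ n, √(D.A (us n - u) (us n - u)) ≤
      D.rho ^ n * √(D.A (us 0 - u) (us 0 - u))) ∧
    Filter.Tendsto (fun n => √(D.A (us n - u) (us n - u))) Filter.atTop (nhds 0) ∧
    Filter.Tendsto (fun n => √(D.B (Ts n - T) (Ts n - T))) Filter.atTop (nhds 0) ∧
    Filter.Tendsto (fun n => R (ps n - p) (ps n - p)) Filter.atTop (nhds 0) := by
  have hρ0 : 0 ≤ D.rho := by
    have := D.κ_pos
    have := D.L_nonneg
    have := D.nG_nonneg
    have := D.Pr_pos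
    have := D.Ra_pos
    have := D.β_nonneg
    have := D.nF_nonneg
    have := D.N_nonneg
    unfold rho
    positivity
  -- The starting index is left free: `m = 1` is always admissible, while `m = 0` requires the
  -- initial velocity to be divergence-free.
  have rate (m : ℕ) (hm : ∀ q, D.b (us m) q = 0) (n : ℕ) :
      √(D.A (us (m + n) - u) (us (m + n) - u)) ≤
        D.rho ^ n * √(D.A (us m - u) (us m - u)) := by
    induction n with
    | zero => simp
    | succ n ih =>
      have hb : ∀ q, D.b (us (m + n)) q = 0 := by
        cases n with
        | zero => exact hm
        | succ n => exact (hs (m + n)).b_eq_zero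
      calc √(D.A (us (m + (n + 1)) - u) (us (m + (n + 1)) - u))
          ≤ D.rho * √(D.A (us (m + n) - u) (us (m + n) - u)) := h.velocity_error_le (hs (m + n)) hb
        _ ≤ D.rho * (D.rho ^ n * √(D.A (us m - u) (us m - u))) := by gcongr
        _ = _ := by ring
  have rate₁ : ∀ n, √(D.A (us (n + 1) - u) (us (n + 1) - u)) ≤
      D.rho ^ n * √(D.A (us 1 - u) (us 1 - u)) := fun n => by
    rw [add_comm n 1]
    exact rate 1 (hs 0).b_eq_zero n
  have hu1 : Filter.Tendsto (fun n => √(D.A (us (n + 1) - u) (us (n + 1) - u)))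
      Filter.atTop (nhds 0) := by
    refine squeeze_zero (fun n => Real.sqrt_nonneg _) rate₁ ?_
    simpa using (tendsto_pow_atTop_nhds_zero_of_lt_one hρ0 hρ).mul_const
      √(D.A (us 1 - u) (us 1 - u))
  -- The shift is by two because the temperature estimate at step `n + 2` needs the convecting
  -- velocity at `n + 1` to be divergence-free, which step `n` guarantees.
  have hT2 : Filter.Tendsto (fun n => √(D.B (Ts (n + 2) - T) (Ts (n + 2) - T)))
      Filter.atTop (nhds 0) := by
    refine squeeze_zero (fun n => Real.sqrt_nonneg _)
      (fun n => h.temperature_error_le (hs (n + 1)) (hs n).b_eq_zero) ?_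
    simpa using (hu1.const_mul (D.L * (D.κ⁻¹ * D.nG))).const_mul D.κ⁻¹
  refine ⟨rate₁, fun h0 n => by simpa using rate 0 h0 n, (Filter.tendsto_add_atTop_iff_nat 1).1 hu1,
    (Filter.tendsto_add_atTop_iff_nat 2).1 hT2, ?_⟩
  rw [← Filter.tendsto_add_atTop_iff_nat 2]
  refine tendsto_form_of_separating D.b D.b_sep R (fun n => ps (n + 2) - p) fun v => ?_
  have dA := dominates_sqrt D.A_symm D.A_nonneg D.A_def
  have dB := dominates_sqrt D.B_symm D.B_nonneg D.B_def
  have hu2 := (Filter.tendsto_add_atTop_iff_nat 1).2 hu1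
  have l1 := dA.tendsto (D.A.flip v) hu2
  have l2 := dB.tendsto (D.j.flip v) hT2
  -- Writing both velocities as `u` plus an error splits the difference of the convection terms into
  -- two parts linear in the errors and one bilinear part; the latter needs the joint bound of `l5`.
  have l3 := dA.tendsto ((D.c u).flip v) hu2
  have l4 := dA.tendsto ((D.c.flip u).flip v) hu1
  have l5 : Filter.Tendsto (fun n => D.c (us (n + 1) - u) (us (n + 2) - u) v)
      Filter.atTop (nhds 0) := by
    obtain ⟨C, hC, hb⟩ := dA.bound₂ dA (LinearMap.compr₂ D.c (LinearMap.applyₗ v))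
    exact squeeze_zero_norm (fun n => hb (us (n + 1) - u) (us (n + 2) - u))
      (by simpa using (hu1.mul hu2).const_mul C)
  have := ((l2.const_mul (D.Pr * D.Ra)).sub (l1.const_mul D.Pr)).sub ((l3.add l4).add l5)
  simp only [mul_zero, sub_zero, add_zero] at this
  refine this.congr fun n => ?_
  have e1 := h.1 v 0
  have e2 := (hs (n + 1)).1 v 0
  simp only [map_zero, sub_zero] at e1 e2
  simp only [LinearMap.flip_apply, map_sub, LinearMap.sub_apply]
  linarith

end ConvectionData

end FiniteDimensional

/-! ### Lebesgue and surface measure in affine coordinates. -/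

section Measure

variable {U V : Type*} [NormedAddCommGroup U] [InnerProductSpace ℝ U] [FiniteDimensional ℝ U]
  [MeasurableSpace U] [BorelSpace U] [NormedAddCommGroup V] [InnerProductSpace ℝ V]
  [FiniteDimensional ℝ V] [MeasurableSpace V] [BorelSpace V]

-- On an inner product space the Euclidean Hausdorff measure of full dimension is the volume; it is
-- preserved by the inclusion of the range and scaled by `normDet` under `L`.
omit [FiniteDimensional ℝ V] in
theorem volume_range_eq_map (L : U →ₗ[ℝ] V) (hL : Function.Injective L) :
    (volume : Measure (LinearMap.range L)) =
      ENNReal.ofReal L.normDet • (volume : Measure U).map L.rangeRestrict := by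
  have hr : Module.finrank ℝ (LinearMap.range L) = Module.finrank ℝ U :=
    LinearMap.finrank_range_of_inj hL
  have hc : Continuous L.rangeRestrict := LinearMap.continuous_of_finiteDimensional _
  ext A hA
  rw [Measure.smul_apply, Measure.map_apply hc.measurable hA, smul_eq_mul,
    ← L.euclideanHausdorffMeasure_image_eq_normDet_mul_volume,
    ← InnerProductSpace.euclideanHausdorffMeasure_eq_volume, hr,
    ← isometry_subtype_coe.euclideanHausdorffMeasure_image A]
  congr 1
  ext x
  simp only [Set.mem_image, Set.mem_preimage, Subtype.exists, LinearMap.mem_range]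
  constructor
  · rintro ⟨_, ⟨y, rfl⟩, hy, rfl⟩
    exact ⟨y, hy, rfl⟩
  · rintro ⟨y, hy, rfl⟩
    exact ⟨L y, ⟨y, rfl⟩, hy, rfl⟩

/-- Lebesgue measure in the oblique coordinates `(y, r) ↦ L y + r t`; `v` is the component of `t`
orthogonal to the range of `L`. -/
theorem lintegral_oblique (L : U →ₗ[ℝ] V) (hL : Function.Injective L)
    (hd : Module.finrank ℝ V = Module.finrank ℝ U + 1) (t v : V) (hv : v ∈ (LinearMap.range L)ᗮ)
    (htv : t - v ∈ LinearMap.range L) (hv0 : v ≠ 0) {f : V → ENNReal} (hf : Measurable f) :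
    ∫⁻ x, f x = ENNReal.ofReal (L.normDet * ‖v‖) * ∫⁻ r : ℝ, ∫⁻ y : U, f (L y + r • t) := by
  set F := LinearMap.range L with hF
  have hr : Module.finrank ℝ F = Module.finrank ℝ U := LinearMap.finrank_range_of_inj hL
  have hr' : Module.finrank ℝ Fᗮ = 1 := by
    have := F.finrank_add_finrank_orthogonal
    omega
  have hcL : Continuous L := LinearMap.continuous_of_finiteDimensional _
  have hcR : Continuous L.rangeRestrict := LinearMap.continuous_of_finiteDimensional _
  -- Fubini is applied to the orthogonal splitting into the range `F` and its one-dimensional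
  -- complement, the line through `v`.
  have mp := F.orthogonalDecomposition.symm.measurePreserving
  have mp2 := WithLp.volume_preserving_toLp F Fᗮ
  have h1 : ∫⁻ x, f x = ∫⁻ w : Fᗮ, ∫⁻ x : F, f ((x : V) + w) := by
    rw [← (mp.comp mp2).lintegral_comp hf, Measure.volume_eq_prod, lintegral_prod_symm]
    · refine lintegral_congr fun w => lintegral_congr fun x => ?_
      simp
    · exact (hf.comp (mp.comp mp2).measurable).aemeasurable
  have hv1 : (⟨v, hv⟩ : Fᗮ) ≠ 0 := fun h => hv0 (congrArg Subtype.val h)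
  have hm : Measurable fun w : Fᗮ => ∫⁻ x : F, f ((x : V) + w) := by
    refine Measurable.lintegral_prod_right' (f := fun z : Fᗮ × F => f ((z.2 : V) + z.1)) ?_
    exact hf.comp (by fun_prop)
  rw [h1, volume_eq_of_finrank_eq_one hr' hv1, lintegral_smul_measure,
    lintegral_map hm (by fun_prop)]
  have h2 (r : ℝ) : ∫⁻ x : F, f ((x : V) + ((r • (⟨v, hv⟩ : Fᗮ) : Fᗮ) : V)) =
      ENNReal.ofReal L.normDet * ∫⁻ y : U, f (L y + r • t) := by
    -- Replacing `r • v` by `r • t` shifts the slice by `r • (t - v)`, a vector of `F`, and the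
    -- integral over `F` is translation invariant.
    have hs := lintegral_add_right_eq_self (μ := (volume : Measure F))
      (fun x : F => f ((x : V) + r • v)) (⟨r • (t - v), F.smul_mem r htv⟩ : F)
    calc ∫⁻ x : F, f ((x : V) + ((r • (⟨v, hv⟩ : Fᗮ) : Fᗮ) : V))
        = ∫⁻ x : F, f ((x : V) + r • v) := rfl
      _ = ∫⁻ x : F, f ((x : V) + r • t) := by
          rw [← hs]
          refine lintegral_congr fun x => ?_
          congr 1
          simp only [Submodule.coe_add]
          module
      _ = _ := by
          rw [volume_range_eq_map L hL, lintegral_smul_measure, lintegral_map _ hcR.measurable]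
          · rfl
          · exact hf.comp (by fun_prop)
  simp_rw [h2]
  rw [lintegral_const_mul, smul_eq_mul, ← mul_assoc, ENNReal.ofReal_mul L.normDet_nonneg,
    ofReal_norm, mul_comm (ENNReal.ofReal L.normDet)]
  · rfl
  · refine Measurable.lintegral_prod_right' (f := fun z : ℝ × U => f (L z.2 + z.1 • t)) ?_
    exact hf.comp (by fun_prop)

omit [FiniteDimensional ℝ V] in
/-- Surface measure on an affinely parametrized set. -/
theorem euclideanHausdorffMeasure_restrict_image (L : U →ₗ[ℝ] V)
    (x₀ : V) (s : Set U) :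
    (Measure.euclideanHausdorffMeasure (Module.finrank ℝ U) : Measure V).restrict
      ((fun y => x₀ + L y) '' s) =
    ENNReal.ofReal L.normDet • (volume.restrict s).map (fun y => x₀ + L y) := by
  have hcL : Continuous L := LinearMap.continuous_of_finiteDimensional _
  have hc : Continuous fun y => x₀ + L y := by fun_prop
  ext A hA
  rw [Measure.smul_apply, Measure.map_apply hc.measurable hA, smul_eq_mul,
    Measure.restrict_apply (hA.preimage hc.measurable), Measure.restrict_apply hA,
    ← L.euclideanHausdorffMeasure_image_eq_normDet_mul_volume,
    ← (IsometryEquiv.vaddConst x₀).isometry.euclideanHausdorffMeasure_image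
      (L '' _)]
  congr 1
  ext x
  constructor
  · rintro ⟨hx, y, hy, rfl⟩
    exact ⟨L y, ⟨y, ⟨hx, hy⟩, rfl⟩, add_comm _ _⟩
  · rintro ⟨_, ⟨y, ⟨hx, hy⟩, rfl⟩, rfl⟩
    have e : (IsometryEquiv.vaddConst x₀) (L y) = x₀ + L y := add_comm _ _
    rw [e]
    exact ⟨hx, y, hy, rfl⟩

end Measure

/-! ### Barycentric description and oblique parametrization of a simplex. -/

section Simplex

variable {ι J V : Type*} [Fintype ι] [DecidableEq ι] [Fintype J] [NormedAddCommGroup V]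
  [InnerProductSpace ℝ V] [FiniteDimensional ℝ V] (b : AffineBasis ι ℝ V)

theorem continuous_coord (i : ι) : Continuous (b.coord i) := continuous_barycentric_coord b i

/-- The described set is convex and contains the chosen vertices; conversely a point is the
combination of the vertices with its own barycentric weights. With `s` all vertices but one this
characterizes a facet. -/
theorem mem_convexHull_image_iff (s : Set ι) (x : V) :
    x ∈ convexHull ℝ (b '' s) ↔ (∀ i, 0 ≤ b.coord i x) ∧ ∀ i, i ∉ s → b.coord i x = 0 := by
  classical
  constructor
  · intro hx
    have hc : Convex ℝ {x | (∀ i, 0 ≤ b.coord i x) ∧ ∀ i, i ∉ s → b.coord i x = 0} := by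
      intro x hx y hy p q hp hq hpq
      have h (i : ι) : b.coord i (p • x + q • y) = p * b.coord i x + q * b.coord i y := by
        rw [Convex.combo_affine_apply hpq]
        simp
      refine ⟨fun i => ?_, fun i hi => ?_⟩
      · rw [h]
        have := hx.1 i
        have := hy.1 i
        positivity
      · rw [h, hx.2 i hi, hy.2 i hi]
        simp
    refine convexHull_min ?_ hc hx
    rintro _ ⟨j, hj, rfl⟩
    refine ⟨fun i => ?_, fun i hi => ?_⟩
    · rw [b.coord_apply]
      split_ifs <;> simp
    · rw [b.coord_apply, if_neg]
      rintro rfl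
      exact hi hj
  · rintro ⟨h0, h1⟩
    have e := b.linear_combination_coord_eq_self x
    have e2 := b.sum_coord_apply_eq_one x
    rw [← Finset.sum_filter_of_ne (p := fun i => i ∈ s)] at e e2
    · rw [← e]
      refine (convex_convexHull ℝ _).sum_mem (fun i _ => h0 i) e2 fun i hi => ?_
      exact subset_convexHull ℝ _ ⟨i, (Finset.mem_filter.1 hi).2, rfl⟩
    · intro i _ hi
      by_contra h
      exact hi (h1 i h)
    · intro i _ hi
      by_contra h
      exact hi (by rw [h1 i h, zero_smul])

theorem mem_convexHull_range_iff (x : V) :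
    x ∈ convexHull ℝ (Set.range b) ↔ ∀ i, 0 ≤ b.coord i x := by
  rw [b.convexHull_eq_nonneg_coord]
  rfl

/-- `σ` enumerates the indices different from `a` and `o`. -/
structure Splits (a o : ι) (σ : J → ι) : Prop where
  ne : a ≠ o
  inj : Function.Injective σ
  ne_left : ∀ j, σ j ≠ a
  ne_right : ∀ j, σ j ≠ o
  cover : ∀ i, i = a ∨ i = o ∨ ∃ j, σ j = i

theorem Splits.symm {a o : ι} {σ : J → ι} (h : Splits a o σ) : Splits o a σ :=
  ⟨h.ne.symm, h.inj, h.ne_right, h.ne_left, fun i => by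
    rcases h.cover i with h | h | h
    · exact Or.inr (Or.inl h)
    · exact Or.inl h
    · exact Or.inr (Or.inr h)⟩

theorem Splits.sum_eq {a o : ι} {σ : J → ι} (h : Splits a o σ) (f : ι → ℝ) :
    ∑ i, f i = f a + f o + ∑ j, f (σ j) := by
  classical
  have : (Finset.univ : Finset ι) = insert a (insert o (Finset.univ.image σ)) := by
    ext i
    simpa [eq_comm] using h.cover i
  rw [this, Finset.sum_insert, Finset.sum_insert, Finset.sum_image h.inj.injOn, add_assoc]
  · simp [h.ne_right]
  · simp [h.ne, h.ne_left]

theorem Splits.card {a o : ι} {σ : J → ι} (h : Splits a o σ) :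
    Fintype.card ι = Fintype.card J + 2 := by
  have := h.sum_eq (fun _ => 1)
  simp only [Finset.sum_const, Finset.card_univ, nsmul_eq_mul, mul_one] at this
  have h2 : ((Fintype.card ι : ℕ) : ℝ) = ((Fintype.card J + 2 : ℕ) : ℝ) := by
    push_cast
    linarith
  exact_mod_cast h2

variable {b}

/-- The linear part `y ↦ ∑ y_j (b_{σ j} - p)` of the parametrization of a face. -/
noncomputable def edgeMap (b : AffineBasis ι ℝ V) (σ : J → ι) (p : V) :
    EuclideanSpace ℝ J →ₗ[ℝ] V where
  toFun y := ∑ j, y j • (b (σ j) - p)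
  map_add' y z := by simp [add_smul, Finset.sum_add_distrib]
  map_smul' c y := by simp [Finset.smul_sum, smul_smul]

/-- The parametrization of a simplex with apex `b a`, base point `b o`. -/
noncomputable def oblique (b : AffineBasis ι ℝ V) (a o : ι) (σ : J → ι)
    (z : EuclideanSpace ℝ J × ℝ) : V :=
  b o + (edgeMap b σ (b o) z.1 + z.2 • (b a - b o))

theorem coord_oblique (a o : ι) (σ : J → ι) (z : EuclideanSpace ℝ J × ℝ) (i : ι) :
    b.coord i (oblique b a o σ z) = b.coord i (b o) +
      (∑ j, z.1 j * (b.coord i (b (σ j)) - b.coord i (b o)) +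
        z.2 * (b.coord i (b a) - b.coord i (b o))) := by
  have h : ∀ v w : V, b.coord i (v + w) = b.coord i v + (b.coord i).linear w := fun v w => by
    rw [add_comm v w, ← vadd_eq_add, AffineMap.map_vadd, vadd_eq_add, add_comm]
  have h2 : ∀ v w : V, (b.coord i).linear (v - w) = b.coord i v - b.coord i w := fun v w => by
    rw [← vsub_eq_sub, AffineMap.linearMap_vsub, vsub_eq_sub]
  rw [oblique, h, edgeMap]
  simp only [LinearMap.coe_mk, AddHom.coe_mk, map_add, map_sum, map_smul, h2, smul_eq_mul]

section

variable {a o : ι} {σ : J → ι} (h : Splits a o σ)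
include h

theorem coord_oblique_left (z : EuclideanSpace ℝ J × ℝ) :
    b.coord a (oblique b a o σ z) = z.2 := by
  rw [coord_oblique]
  simp [b.coord_apply, h.ne, fun j => (h.ne_left j).symm]

theorem coord_oblique_right (z : EuclideanSpace ℝ J × ℝ) :
    b.coord o (oblique b a o σ z) = 1 - ∑ j, z.1 j - z.2 := by
  rw [coord_oblique]
  simp [b.coord_apply, h.ne.symm, fun j => (h.ne_right j).symm]
  ring

theorem coord_oblique_apply (z : EuclideanSpace ℝ J × ℝ) (j : J) :
    b.coord (σ j) (oblique b a o σ z) = z.1 j := by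
  classical
  rw [coord_oblique]
  simp [b.coord_apply, h.ne_left, h.ne_right, h.inj.eq_iff]

theorem oblique_coord (x : V) :
    oblique b a o σ (WithLp.toLp 2 fun j => b.coord (σ j) x, b.coord a x) = x := by
  refine b.ext_elem fun i => ?_
  have hs := h.sum_eq (fun i => b.coord i x)
  rw [b.sum_coord_apply_eq_one] at hs
  rcases h.cover i with rfl | rfl | ⟨j, rfl⟩
  · rw [coord_oblique_left h]
  · rw [coord_oblique_right h]
    simp only
    linarith
  · rw [coord_oblique_apply h]

theorem edgeMap_injective : Function.Injective (edgeMap b σ (b o)) := by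
  classical
  intro y y' hy
  have : oblique b a o σ (y, 0) = oblique b a o σ (y', 0) := by simp [oblique, hy]
  ext j
  simpa [coord_oblique_apply h] using congrArg (b.coord (σ j)) this

theorem finrank_eq_of_splits (b : AffineBasis ι ℝ V) :
    Module.finrank ℝ V = Module.finrank ℝ (EuclideanSpace ℝ J) + 1 := by
  classical
  have h1 := b.card_eq_finrank_add_one
  have h2 := h.card
  simp only [finrank_euclideanSpace]
  omega

/-- The unit simplex. -/
def unitSimplex (J : Type*) [Fintype J] : Set (EuclideanSpace ℝ J) :=
  {y | (∀ j, 0 ≤ y j) ∧ ∑ j, y j ≤ 1}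

/-- The coordinates of the parameter are the barycentric weights, so the simplex becomes the region
under the graph of `1 - ∑ y_j` over the unit simplex. -/
theorem oblique_mem_convexHull_iff (z : EuclideanSpace ℝ J × ℝ) :
    oblique b a o σ z ∈ convexHull ℝ (Set.range b) ↔
      z.1 ∈ unitSimplex J ∧ z.2 ∈ Set.Icc 0 (1 - ∑ j, z.1 j) := by
  rw [mem_convexHull_range_iff]
  constructor
  · intro hz
    have h1 := hz a
    have h2 := hz o
    rw [coord_oblique_left h] at h1
    rw [coord_oblique_right h] at h2
    refine ⟨⟨fun j => ?_, by linarith⟩, h1, by linarith⟩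
    have h3 := hz (σ j)
    rwa [coord_oblique_apply h] at h3
  · rintro ⟨⟨h1, h2⟩, h3, h4⟩ i
    rcases h.cover i with rfl | rfl | ⟨j, rfl⟩
    · rwa [coord_oblique_left h]
    · rw [coord_oblique_right h]
      linarith
    · rw [coord_oblique_apply h]
      exact h1 j

/-- The facet is the slice where the weight of the apex `a`, that is the last oblique coordinate,
vanishes. -/
theorem convexHull_facet_eq_image :
    convexHull ℝ (b '' {a}ᶜ) = (fun y => b o + edgeMap b σ (b o) y) '' unitSimplex J := by
  have e (y : EuclideanSpace ℝ J) : b o + edgeMap b σ (b o) y = oblique b a o σ (y, 0) := by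
    simp [oblique]
  ext x
  rw [mem_convexHull_image_iff]
  constructor
  · rintro ⟨h0, h1⟩
    have h1 := h1 a (by simp)
    have hs := h.sum_eq (fun i => b.coord i x)
    rw [b.sum_coord_apply_eq_one] at hs
    refine ⟨WithLp.toLp 2 fun j => b.coord (σ j) x, ⟨fun j => h0 _, ?_⟩, ?_⟩
    · have := h0 o
      simp only
      linarith
    · simp only [e]
      conv_rhs => rw [← oblique_coord (b := b) h x]
      rw [h1]
  · rintro ⟨y, hy, rfl⟩
    simp only [e]
    refine ⟨?_, ?_⟩
    · rw [← mem_convexHull_range_iff, oblique_mem_convexHull_iff h]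
      exact ⟨hy, le_rfl, by simpa using hy.2⟩
    · intro i hi
      have hi : i = a := by simpa using hi
      rw [hi, coord_oblique_left h]

end

end Simplex

/-! ### The unit simplex is a convex body. -/

section UnitSimplex

variable {J : Type*} [Fintype J]

theorem convex_unitSimplex : Convex ℝ (unitSimplex J) := by
  intro x hx y hy p q hp hq hpq
  refine ⟨fun j => ?_, ?_⟩
  · have := hx.1 j
    have := hy.1 j
    simp only [PiLp.add_apply, PiLp.smul_apply, smul_eq_mul]
    positivity
  · simp only [PiLp.add_apply, PiLp.smul_apply, smul_eq_mul, Finset.sum_add_distrib,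
      ← Finset.mul_sum]
    nlinarith [hx.2, hy.2]

theorem isCompact_unitSimplex : IsCompact (unitSimplex J) := by
  refine Metric.isCompact_of_isClosed_isBounded ?_ ?_
  · have : unitSimplex J = (⋂ j, {y | 0 ≤ y j}) ∩ {y | ∑ j, y j ≤ 1} := by
      ext y
      simp [unitSimplex]
    rw [this]
    exact (isClosed_iInter fun j => isClosed_le continuous_const (by fun_prop)).inter
      (isClosed_le (by fun_prop) continuous_const)
  · refine isBounded_iff_forall_norm_le.2 ⟨√(Fintype.card J), fun y hy => ?_⟩
    rw [EuclideanSpace.norm_eq]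
    refine Real.sqrt_le_sqrt ?_
    calc ∑ j, ‖y j‖ ^ 2 ≤ ∑ _j : J, (1 : ℝ) := by
          refine Finset.sum_le_sum fun j _ => ?_
          have h1 : y j ≤ 1 := (Finset.single_le_sum (fun i _ => hy.1 i) (Finset.mem_univ j)).trans hy.2
          have h0 := hy.1 j
          rw [Real.norm_eq_abs, sq_abs]
          nlinarith
      _ = Fintype.card J := by simp

theorem interior_unitSimplex_nonempty : (interior (unitSimplex J)).Nonempty := by
  -- With `n` coordinates all equal to `1/(n+1)`, every coordinate is positive and the sum is
  -- `n/(n+1) < 1`.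
  refine ⟨WithLp.toLp 2 fun _ => ((Fintype.card J : ℝ) + 1)⁻¹, ?_⟩
  have ho : IsOpen {y : EuclideanSpace ℝ J | (∀ j, 0 < y j) ∧ ∑ j, y j < 1} := by
    have : {y : EuclideanSpace ℝ J | (∀ j, 0 < y j) ∧ ∑ j, y j < 1} =
        (⋂ j, {y | 0 < y j}) ∩ {y | ∑ j, y j < 1} := by
      ext y
      simp
    rw [this]
    exact (isOpen_iInter_of_finite fun j => isOpen_lt continuous_const (by fun_prop)).inter
      (isOpen_lt (by fun_prop) continuous_const)
  have hsub : {y : EuclideanSpace ℝ J | (∀ j, 0 < y j) ∧ ∑ j, y j < 1} ⊆ unitSimplex J :=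
    fun y hy => ⟨fun j => (hy.1 j).le, hy.2.le⟩
  refine interior_maximal hsub ho ⟨fun j => ?_, ?_⟩
  · simp only
    positivity
  · simp only [Finset.sum_const, Finset.card_univ, nsmul_eq_mul]
    rw [← div_eq_mul_inv, div_lt_one (by positivity)]
    linarith

end UnitSimplex

/-- A continuous function whose square has zero integral over a convex body vanishes there. -/
theorem eqOn_zero_of_integral_sq {E : Type*} [NormedAddCommGroup E] [NormedSpace ℝ E]
    [MeasurableSpace E] [BorelSpace E] (μ : Measure E) [μ.IsOpenPosMeasure]
    [IsFiniteMeasureOnCompacts μ] {s : Set E} (hs : Convex ℝ s) (hc : IsCompact s)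
    (hi : (interior s).Nonempty) {f : E → ℝ} (hf : Continuous f)
    (h : ∫ x in s, f x ^ 2 ∂μ = 0) : ∀ x ∈ s, f x = 0 := by
  have hint : Integrable (fun x => f x ^ 2) (μ.restrict s) :=
    (hf.pow 2).continuousOn.integrableOn_compact hc
  rw [integral_eq_zero_iff_of_nonneg (fun x => sq_nonneg _) hint] at h
  have h1 : (fun x => f x ^ 2) =ᵐ[μ.restrict (interior s)] fun _ => 0 :=
    ae_restrict_of_ae_restrict_of_subset interior_subset h
  have h2 := Measure.eqOn_open_of_ae_eq h1 isOpen_interior (hf.pow 2).continuousOn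
    continuousOn_const
  have h3 : Set.EqOn f (fun _ => 0) (interior s) := fun x hx => by simpa using h2 hx
  have h4 := h3.closure hf continuous_const
  rw [hs.closure_interior_eq_closure_of_nonempty_interior hi] at h4
  exact fun x hx => h4 (subset_closure hx)

/-! ### Integration over a simplex and its facets; the divergence theorem. -/

section Simplex

variable {ι J V : Type*} [Fintype ι] [DecidableEq ι] [Fintype J] [NormedAddCommGroup V]
  [InnerProductSpace ℝ V] [FiniteDimensional ℝ V] [MeasurableSpace V] [BorelSpace V]
  {b : AffineBasis ι ℝ V} {a o : ι} {σ : J → ι}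

theorem isCompact_convexHull_range (b : AffineBasis ι ℝ V) :
    IsCompact (convexHull ℝ (Set.range b)) :=
  (Set.finite_range b).isCompact_convexHull (𝕜 := ℝ)

theorem interior_convexHull_range_nonempty (b : AffineBasis ι ℝ V) :
    (interior (convexHull ℝ (Set.range b))).Nonempty :=
  ⟨_, b.centroid_mem_interior_convexHull⟩

theorem continuous_oblique : Continuous (oblique b a o σ) := by
  have : Continuous (edgeMap b σ (b o)) := LinearMap.continuous_of_finiteDimensional _
  unfold oblique
  fun_prop

theorem continuous_facetParam : Continuous fun y => b o + edgeMap b σ (b o) y := by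
  have : Continuous (edgeMap b σ (b o)) := LinearMap.continuous_of_finiteDimensional _
  fun_prop

/-- `ν` is a unit normal vector of the facet of the simplex opposite to the vertex `a`. -/
structure IsNormal (b : AffineBasis ι ℝ V) (a : ι) (ν : V) : Prop where
  norm : ‖ν‖ = 1
  inner_eq : ∀ i j, i ≠ a → j ≠ a → inner ℝ ν (b i - b j) = 0
  inner_neg : ∀ i, i ≠ a → inner ℝ ν (b a - b i) < 0

variable (h : Splits a o σ) {ν : V} (hν : IsNormal b a ν)
include h hν

theorem volume_eq_map_oblique : (volume : Measure V) =
    ENNReal.ofReal ((edgeMap b σ (b o)).normDet * |inner ℝ ν (b a - b o)|) •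
      ((volume : Measure (EuclideanSpace ℝ J)).prod (volume : Measure ℝ)).map
        (oblique b a o σ) := by
  set L := edgeMap b σ (b o) with hL
  have hinj : Function.Injective L := edgeMap_injective h
  have hd := finrank_eq_of_splits h b
  have hν0 : ν ≠ 0 := fun h0 => by simpa [h0] using hν.norm
  -- The direction space of the facet is orthogonal to `ν`, with equality by dimension. Hence the
  -- normal component of the edge `t` is `⟨ν, t⟩ ν`, and the height of the apex is `|⟨ν, t⟩|`.
  have hrange : LinearMap.range L = (ℝ ∙ ν)ᗮ := by
    refine Submodule.eq_of_le_of_finrank_eq ?_ ?_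
    · rintro _ ⟨y, rfl⟩
      rw [Submodule.mem_orthogonal_singleton_iff_inner_right]
      simp only [hL, edgeMap, LinearMap.coe_mk, AddHom.coe_mk, inner_sum, inner_smul_right]
      exact Finset.sum_eq_zero fun j _ => by
        rw [hν.inner_eq _ _ (h.ne_left j) h.ne.symm, mul_zero]
    · rw [LinearMap.finrank_range_of_inj hinj]
      have := (ℝ ∙ ν).finrank_add_finrank_orthogonal
      rw [finrank_span_singleton hν0] at this
      omega
  set t := b a - b o with ht
  set v := (inner ℝ ν t) • ν with hv
  have hv0 : v ≠ 0 := smul_ne_zero (hν.inner_neg o h.ne.symm).ne hν0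
  have hvn : ‖v‖ = |inner ℝ ν t| := by rw [hv, norm_smul, hν.norm, mul_one, Real.norm_eq_abs]
  have hcont : Continuous (oblique b a o σ) := continuous_oblique
  refine Measure.ext_of_lintegral _ fun f hf => ?_
  have h0 := lintegral_oblique L hinj hd t v (by
      rw [hrange]
      exact Submodule.le_orthogonal_orthogonal _
        (Submodule.smul_mem _ _ (Submodule.mem_span_singleton_self ν)))
    (by
      rw [hrange, Submodule.mem_orthogonal_singleton_iff_inner_right, hv, inner_sub_right,
        inner_smul_right, real_inner_self_eq_norm_sq, hν.norm]
      ring) hv0 (hf.comp (measurable_const_add (b o)))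
  have h1 := lintegral_add_left_eq_self (μ := (volume : Measure V)) f (b o)
  rw [← h1, ← hvn]
  simp only [Function.comp_def] at h0
  rw [h0, lintegral_smul_measure, lintegral_map hf hcont.measurable, lintegral_prod_symm]
  · rfl
  · exact (hf.comp hcont.measurable).aemeasurable

/-- Fubini in oblique coordinates. The inner integral runs along the direction of one edge, which
prepares the use of the fundamental theorem of calculus. -/
theorem integral_simplex {F : V → ℝ} (hF : Continuous F) :
    ∫ x in convexHull ℝ (Set.range b), F x =
      ((edgeMap b σ (b o)).normDet * |inner ℝ ν (b a - b o)|) *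
        ∫ y in unitSimplex J, ∫ r in (0 : ℝ)..(1 - ∑ j, y j), F (oblique b a o σ (y, r)) := by
  set K := convexHull ℝ (Set.range b) with hK
  have hKc : IsCompact K := isCompact_convexHull_range b
  have hcont : Continuous (oblique b a o σ) := continuous_oblique
  have hc : 0 ≤ (edgeMap b σ (b o)).normDet * |inner ℝ ν (b a - b o)| :=
    mul_nonneg (LinearMap.normDet_nonneg _) (abs_nonneg _)
  have hc0 : (edgeMap b σ (b o)).normDet * |inner ℝ ν (b a - b o)| ≠ 0 := by
    refine mul_ne_zero ?_ (abs_ne_zero.2 (hν.inner_neg o h.ne.symm).ne)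
    rw [Ne, LinearMap.normDet_eq_zero_iff_ker_ne_bot, not_not]
    exact LinearMap.ker_eq_bot.2 (edgeMap_injective h)
  have hint : Integrable (K.indicator F) :=
    (integrable_indicator_iff hKc.measurableSet).2 (hF.continuousOn.integrableOn_compact hKc)
  rw [← integral_indicator hKc.measurableSet]
  have hvol := volume_eq_map_oblique h hν
  set c := (edgeMap b σ (b o)).normDet * |inner ℝ ν (b a - b o)| with hcdef
  rw [hvol] at hint ⊢
  rw [integrable_smul_measure (by simpa using lt_of_le_of_ne hc hc0.symm) (by simp)] at hint
  rw [integral_smul_measure, ENNReal.toReal_ofReal hc, smul_eq_mul,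
    integral_map hcont.measurable.aemeasurable hint.aestronglyMeasurable]
  have hint2 := hint.comp_measurable hcont.measurable
  simp only [Function.comp_def] at hint2
  rw [integral_prod _ hint2, ← integral_indicator isCompact_unitSimplex.measurableSet]
  congr 1
  refine integral_congr_ae (Filter.Eventually.of_forall fun y => ?_)
  by_cases hy : y ∈ unitSimplex J
  · have hle : (0 : ℝ) ≤ 1 - ∑ j, y j := by linarith [hy.2]
    simp only [Set.indicator_of_mem hy]
    rw [intervalIntegral.integral_of_le hle, ← integral_Icc_eq_integral_Ioc,
      ← integral_indicator measurableSet_Icc]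
    refine integral_congr_ae (Filter.Eventually.of_forall fun r => ?_)
    by_cases hr : r ∈ Set.Icc 0 (1 - ∑ j, y j)
    · simp only [Set.indicator_of_mem hr]
      rw [Set.indicator_of_mem ((oblique_mem_convexHull_iff h (y, r)).2 ⟨hy, hr⟩)]
    · simp only [Set.indicator_of_notMem hr]
      rw [Set.indicator_of_notMem fun hm => hr ((oblique_mem_convexHull_iff h (y, r)).1 hm).2]
  · simp only [Set.indicator_of_notMem hy]
    rw [← integral_zero ℝ ℝ (μ := volume)]
    refine integral_congr_ae (Filter.Eventually.of_forall fun r => ?_)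
    simp only
    rw [Set.indicator_of_notMem fun hm => hy ((oblique_mem_convexHull_iff h (y, r)).1 hm).1]

omit hν in
theorem facet_restrict_eq {n : ℕ} (hn : Module.finrank ℝ V = n + 1) :
    (Measure.euclideanHausdorffMeasure n : Measure V).restrict (convexHull ℝ (b '' {a}ᶜ)) =
      ENNReal.ofReal (edgeMap b σ (b o)).normDet •
        ((volume : Measure (EuclideanSpace ℝ J)).restrict (unitSimplex J)).map
          (fun y => b o + edgeMap b σ (b o) y) := by
  have : n = Module.finrank ℝ (EuclideanSpace ℝ J) := by
    have := finrank_eq_of_splits h b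
    omega
  rw [this, convexHull_facet_eq_image h]
  exact euclideanHausdorffMeasure_restrict_image (edgeMap b σ (b o)) (b o) (unitSimplex J)

omit hν in
theorem integral_facet {n : ℕ} (hn : Module.finrank ℝ V = n + 1) {F : V → ℝ} (hF : Continuous F) :
    ∫ x in convexHull ℝ (b '' {a}ᶜ), F x ∂(Measure.euclideanHausdorffMeasure n) =
      (edgeMap b σ (b o)).normDet * ∫ y in unitSimplex J, F (b o + edgeMap b σ (b o) y) := by
  have hcont : Continuous fun y => b o + edgeMap b σ (b o) y := continuous_facetParam
  rw [facet_restrict_eq h hn, integral_smul_measure, ENNReal.toReal_ofReal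
    (LinearMap.normDet_nonneg _), smul_eq_mul,
    integral_map hcont.measurable.aemeasurable hF.aestronglyMeasurable]

omit hν in
theorem facet_measure_lt_top {n : ℕ} (hn : Module.finrank ℝ V = n + 1) :
    (Measure.euclideanHausdorffMeasure n : Measure V) (convexHull ℝ (b '' {a}ᶜ)) < ⊤ := by
  have hcont : Continuous fun y => b o + edgeMap b σ (b o) y := continuous_facetParam
  have := congrArg (fun μ => μ Set.univ) (facet_restrict_eq h hn (b := b))
  simp only [Measure.restrict_apply_univ, Measure.smul_apply, smul_eq_mul] at this
  rw [this, Measure.map_apply hcont.measurable MeasurableSet.univ]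
  simp only [Set.preimage_univ, Measure.restrict_apply_univ]
  exact ENNReal.mul_lt_top (by simp) isCompact_unitSimplex.measure_lt_top

omit hν in
theorem eq_zero_of_integral_facet_sq {n : ℕ} (hn : Module.finrank ℝ V = n + 1) {F : V → ℝ}
    (hF : Continuous F)
    (h0 : ∫ x in convexHull ℝ (b '' {a}ᶜ), F x ^ 2 ∂(Measure.euclideanHausdorffMeasure n) = 0) :
    ∀ x ∈ convexHull ℝ (b '' {a}ᶜ), F x = 0 := by
  have hcont : Continuous fun y => b o + edgeMap b σ (b o) y := continuous_facetParam
  rw [integral_facet h hn (F := fun x => F x ^ 2) (hF.pow 2)] at h0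
  have hJ : (edgeMap b σ (b o)).normDet ≠ 0 := by
    rw [Ne, LinearMap.normDet_eq_zero_iff_ker_ne_bot, not_not]
    exact LinearMap.ker_eq_bot.2 (edgeMap_injective h)
  have h1 := (mul_eq_zero.1 h0).resolve_left hJ
  rw [convexHull_facet_eq_image h]
  rintro _ ⟨y, hy, rfl⟩
  exact eqOn_zero_of_integral_sq volume convex_unitSimplex isCompact_unitSimplex
    interior_unitSimplex_nonempty (f := fun y => F (b o + edgeMap b σ (b o) y))
    (hF.comp hcont) h1 y hy

/-- The divergence theorem on a simplex, in the direction of an edge. -/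
theorem integral_simplex_deriv {n : ℕ} (hn : Module.finrank ℝ V = n + 1) {ν' : V}
    (hν' : IsNormal b o ν') {F F' : V → ℝ} (hF' : Continuous F')
    (hd : ∀ x (r : ℝ), HasDerivAt (fun r : ℝ => F (x + r • (b a - b o))) (F' (x + r • (b a - b o))) r)
    (hF : Continuous F) :
    ∫ x in convexHull ℝ (Set.range b), F' x =
      inner ℝ ν (b a - b o) *
        ∫ x in convexHull ℝ (b '' {a}ᶜ), F x ∂(Measure.euclideanHausdorffMeasure n) +
      inner ℝ ν' (b a - b o) *
        ∫ x in convexHull ℝ (b '' {o}ᶜ), F x ∂(Measure.euclideanHausdorffMeasure n) := by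
  have hcont : Continuous fun y => b o + edgeMap b σ (b o) y := continuous_facetParam
  have hcont' : Continuous fun y => b a + edgeMap b σ (b a) y := continuous_facetParam
  have h1 := hν.inner_neg o h.ne.symm
  have h2 : 0 < inner ℝ ν' (b a - b o) := by
    have := hν'.inner_neg a h.ne
    rw [← neg_sub, inner_neg_right] at this
    linarith
  -- The volume is computed once from the facet opposite `a` and once from the facet opposite `o`.
  -- Cancelling the common nonzero integral shows that the two Jacobian factors agree (`hc`).
  have hone := integral_simplex h hν (F := fun _ => 1) continuous_const
  have hone' := integral_simplex h.symm hν' (F := fun _ => 1) continuous_const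
  have hvol : ∫ x in convexHull ℝ (Set.range b), (1 : ℝ) ≠ 0 := by
    rw [setIntegral_const, smul_eq_mul, mul_one]
    refine (ENNReal.toReal_pos ?_ (isCompact_convexHull_range b).measure_lt_top.ne).ne'
    exact (Measure.measure_pos_of_nonempty_interior _ (interior_convexHull_range_nonempty b)).ne'
  simp only [intervalIntegral.integral_const, sub_zero, smul_eq_mul, mul_one] at hone hone'
  have hI : ∫ y in unitSimplex J, (1 - ∑ j, y j) ≠ 0 := fun h0 => hvol (by
    rw [hone, h0, mul_zero])
  have hc : (edgeMap b σ (b o)).normDet * |inner ℝ ν (b a - b o)| =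
      (edgeMap b σ (b a)).normDet * |inner ℝ ν' (b o - b a)| :=
    mul_right_cancel₀ hI (hone.symm.trans hone')
  rw [abs_of_neg h1, ← neg_sub (b a), inner_neg_right, abs_neg, abs_of_pos h2] at hc
  rw [integral_facet h hn hF, integral_facet h.symm hn hF, integral_simplex h hν hF',
    abs_of_neg h1]
  -- Each segment parallel to the edge runs from the facet opposite `a` to the facet opposite `o`.
  -- Its upper endpoint, at `r = 1 - ∑ y_j`, has the same parameter `y` relative to the base point
  -- `b a`.
  have hftc (y : EuclideanSpace ℝ J) :
      ∫ r in (0 : ℝ)..(1 - ∑ j, y j), F' (oblique b a o σ (y, r)) =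
        F (b a + edgeMap b σ (b a) y) - F (b o + edgeMap b σ (b o) y) := by
    have hd' : ∀ r ∈ Set.uIcc (0 : ℝ) (1 - ∑ j, y j),
        HasDerivAt (fun r : ℝ => F (oblique b a o σ (y, r))) (F' (oblique b a o σ (y, r))) r := by
      intro r _
      have := hd (b o + edgeMap b σ (b o) y) r
      simpa only [oblique, add_assoc] using this
    rw [intervalIntegral.integral_eq_sub_of_hasDerivAt hd']
    · congr 2
      · simp only [oblique, edgeMap, LinearMap.coe_mk, AddHom.coe_mk, smul_sub,
          Finset.sum_sub_distrib, ← Finset.sum_smul]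
        module
      · simp [oblique]
    · refine Continuous.intervalIntegrable ?_ _ _
      exact hF'.comp (continuous_oblique.comp (by fun_prop))
  simp_rw [hftc]
  rw [integral_sub]
  · linear_combination (∫ y in unitSimplex J, F (b a + edgeMap b σ (b a) y)) * hc
  · exact (hF.comp hcont').continuousOn.integrableOn_compact isCompact_unitSimplex
  · exact (hF.comp hcont).continuousOn.integrableOn_compact isCompact_unitSimplex

end Simplex

/-! ### Polynomials as functions and their directional derivatives. -/

section Polynomials

variable {d : ℕ}

/-- The restriction of polynomials to a set, as an algebra homomorphism. -/
noncomputable def restr (D : Set (Pt d)) : MvPolynomial (Fin d) ℝ →ₐ[ℝ] (D → ℝ) :=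
  MvPolynomial.aeval fun i => fun x : D => x.1 i

theorem restr_apply (D : Set (Pt d)) (p : MvPolynomial (Fin d) ℝ) (x : D) :
    restr D p x = pval p x := by
  have h : (Pi.evalAlgHom ℝ (fun _ : D => ℝ) x).comp (restr D) =
      MvPolynomial.aeval (fun i => x.1 i) := by
    ext i
    simp [restr]
  have := congrArg (fun φ => φ p) h
  simp only [AlgHom.comp_apply, Pi.evalAlgHom_apply] at this
  rw [this]
  simp [pval, MvPolynomial.aeval_def, MvPolynomial.eval, MvPolynomial.eval₂_eq]

theorem pval_add (p q : MvPolynomial (Fin d) ℝ) (x : Pt d) :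
    pval (p + q) x = pval p x + pval q x := by simp [pval]

theorem pval_mul (p q : MvPolynomial (Fin d) ℝ) (x : Pt d) :
    pval (p * q) x = pval p x * pval q x := by simp [pval]

theorem pval_sum {α : Type*} (s : Finset α) (p : α → MvPolynomial (Fin d) ℝ) (x : Pt d) :
    pval (∑ i ∈ s, p i) x = ∑ i ∈ s, pval (p i) x := by simp [pval]

theorem pval_C (c : ℝ) (x : Pt d) : pval (MvPolynomial.C c) x = c := by simp [pval]

theorem continuous_pval (p : MvPolynomial (Fin d) ℝ) : Continuous (pval p) := by
  unfold pval
  exact (MvPolynomial.continuous_eval p).comp (by fun_prop)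

/-- The derivative of a polynomial in the direction `t`. -/
noncomputable def dirDeriv (t : Pt d) (p : MvPolynomial (Fin d) ℝ) : MvPolynomial (Fin d) ℝ :=
  ∑ i, MvPolynomial.C (t i) * MvPolynomial.pderiv i p

theorem hasDerivAt_pval (p : MvPolynomial (Fin d) ℝ) (x t : Pt d) (r : ℝ) :
    HasDerivAt (fun r : ℝ => pval p (x + r • t)) (pval (dirDeriv t p) (x + r • t)) r := by
  induction p using MvPolynomial.induction_on with
  | C a =>
    have : dirDeriv t (MvPolynomial.C a) = 0 := by simp [dirDeriv]
    simpa [this, pval] using hasDerivAt_const r a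
  | add p q hp hq =>
    have : dirDeriv t (p + q) = dirDeriv t p + dirDeriv t q := by
      simp [dirDeriv, mul_add, Finset.sum_add_distrib]
    rw [this, pval_add]
    simp only [pval_add]
    exact hp.add hq
  | mul_X p i hp =>
    have : dirDeriv t (p * MvPolynomial.X i) =
        dirDeriv t p * MvPolynomial.X i + p * MvPolynomial.C (t i) := by
      simp only [dirDeriv, MvPolynomial.pderiv_mul, mul_add, Finset.sum_add_distrib, Finset.sum_mul,
        MvPolynomial.pderiv_X]
      congr 1
      · exact Finset.sum_congr rfl fun j _ => by ring
      · rw [Finset.sum_eq_single i]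
        · rw [Pi.single_eq_same]
          ring
        · intro j _ hj
          rw [Pi.single_eq_of_ne (by exact fun h => hj h.symm)]
          ring
        · simp
    rw [this, pval_add, pval_mul, pval_mul]
    simp only [pval_mul, pval_C]
    have hX : ∀ y, pval (MvPolynomial.X i : MvPolynomial (Fin d) ℝ) y = y i := by simp [pval]
    simp only [hX]
    refine hp.mul (d' := t i) ?_
    simpa using ((hasDerivAt_id r).mul_const (t i)).const_add (x i)

end Polynomials

/-! ### Elements, their facets and outward normals. -/

namespace Mesh

variable {d : ℕ} (M : Mesh d)

theorem isCompact_cellSet (K : M.Cell) : IsCompact (M.cellSet K) :=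
  K.1.finite_toSet.isCompact_convexHull (𝕜 := ℝ)

theorem isCompact_facetSet (e : M.Facet) : IsCompact (M.facetSet e) :=
  e.1.finite_toSet.isCompact_convexHull (𝕜 := ℝ)

theorem cellInt_eq (K : M.Cell) (F : Pt d → ℝ) :
    M.cellInt K (fun x => F x) = ∫ x in M.cellSet K, F x :=
  integral_subtype_comap (M.isCompact_cellSet K).measurableSet F

theorem facetInt_eq (e : M.Facet) (F : Pt d → ℝ) :
    M.facetInt e (fun x => F x) =
      ∫ x in M.facetSet e, F x ∂(Measure.euclideanHausdorffMeasure (d - 1)) :=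
  integral_subtype_comap (M.isCompact_facetSet e).measurableSet F

/-- The vertices of an element as an affine basis. -/
noncomputable def cellBasis (K : M.Cell) : AffineBasis {x // x ∈ K.1} ℝ (Pt d) where
  toFun := Subtype.val
  ind' := M.complex.indep K.2.1
  tot' := by
    rw [(M.complex.indep K.2.1).affineSpan_eq_top_iff_card_eq_finrank_add_one]
    simp [K.2.2]

@[simp]
theorem cellBasis_apply (K : M.Cell) (a : {x // x ∈ K.1}) : M.cellBasis K a = a.1 := rfl

theorem cellSet_eq (K : M.Cell) : M.cellSet K = convexHull ℝ (Set.range (M.cellBasis K)) := by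
  have : Set.range (M.cellBasis K) = (K.1 : Set (Pt d)) := by
    ext x
    simp
  rw [this]
  rfl

theorem interior_cellSet_nonempty (K : M.Cell) : (interior (M.cellSet K)).Nonempty := by
  rw [cellSet_eq]
  exact interior_convexHull_range_nonempty _

variable [NeZero d]

/-- The edge (face) of `K` opposite to the vertex `a`. -/
noncomputable def opp (K : M.Cell) (a : {x // x ∈ K.1}) : M.FacetOf K := by
  classical
  refine ⟨⟨K.1.erase a, ?_, ?_⟩, Finset.erase_subset _ _⟩
  · refine M.complex.down_closed K.2.1 (Finset.erase_subset _ _) (Finset.card_pos.1 ?_)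
    rw [Finset.card_erase_of_mem a.2, K.2.2]
    have := NeZero.pos d
    omega
  · rw [Finset.card_erase_of_mem a.2, K.2.2]
    omega

theorem mem_opp_iff (K : M.Cell) (a : {x // x ∈ K.1}) (x : Pt d) :
    x ∈ (M.opp K a).1.1 ↔ x ≠ a ∧ x ∈ K.1 := by
  classical
  exact Finset.mem_erase

/-- A facet has `d` of the `d + 1` vertices and so misses exactly one. Sums over facets thereby
become sums over vertices. -/
theorem opp_bijective (K : M.Cell) : Function.Bijective (M.opp K) := by
  classical
  constructor
  · intro a c hac
    by_contra hne
    have h1 : a.1 ∈ (M.opp K c).1.1 := by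
      rw [mem_opp_iff]
      exact ⟨fun h => hne (Subtype.ext h), a.2⟩
    rw [← hac, mem_opp_iff] at h1
    exact h1.1 rfl
  · rintro ⟨e, he⟩
    have hcard : (K.1 \ e.1).card = 1 := by
      rw [Finset.card_sdiff_of_subset he, K.2.2, e.2.2]
      omega
    obtain ⟨a, ha⟩ := Finset.card_eq_one.1 hcard
    have haK : a ∈ K.1 \ e.1 := by rw [ha]; simp
    refine ⟨⟨a, (Finset.mem_sdiff.1 haK).1⟩, Subtype.ext (Subtype.ext ?_)⟩
    ext x
    rw [mem_opp_iff]
    constructor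
    · rintro ⟨h1, h2⟩
      by_contra h3
      have : x ∈ K.1 \ e.1 := Finset.mem_sdiff.2 ⟨h2, h3⟩
      rw [ha] at this
      exact h1 (Finset.mem_singleton.1 this)
    · intro hx
      refine ⟨?_, he hx⟩
      rintro rfl
      exact (Finset.mem_sdiff.1 haK).2 hx

theorem sum_facetOf (K : M.Cell) (f : M.FacetOf K → ℝ) :
    ∑ e, f e = ∑ a, f (M.opp K a) :=
  ((Equiv.ofBijective _ (M.opp_bijective K)).sum_comp f).symm

theorem coe_opp (K : M.Cell) (a : {x // x ∈ K.1}) :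
    ((M.opp K a).1.1 : Set (Pt d)) = M.cellBasis K '' {a}ᶜ := by
  ext x
  simp only [Finset.mem_coe, mem_opp_iff, Set.mem_image, Set.mem_compl_iff, Set.mem_singleton_iff]
  constructor
  · rintro ⟨h1, h2⟩
    exact ⟨⟨x, h2⟩, fun h => h1 (congrArg Subtype.val h), rfl⟩
  · rintro ⟨c, hc, rfl⟩
    exact ⟨fun h => hc (Subtype.ext h), c.2⟩

theorem facetSet_opp (K : M.Cell) (a : {x // x ∈ K.1}) :
    M.facetSet (M.opp K a).1 = convexHull ℝ (M.cellBasis K '' {a}ᶜ) := by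
  rw [← coe_opp]
  rfl

theorem exists_ne_vertex (K : M.Cell) (a : {x // x ∈ K.1}) : ∃ o : {x // x ∈ K.1}, o ≠ a := by
  have : 1 < Fintype.card {x // x ∈ K.1} := by
    rw [Fintype.card_coe, K.2.2]
    have := NeZero.pos d
    omega
  have := Fintype.one_lt_card_iff_nontrivial.1 this
  exact exists_ne a

theorem splits (K : M.Cell) {a o : {x // x ∈ K.1}} (h : a ≠ o) :
    Splits a o (Subtype.val : {s : {x // x ∈ K.1} // s ≠ a ∧ s ≠ o} → {x // x ∈ K.1}) :=
  ⟨h, Subtype.val_injective, fun j => j.2.1, fun j => j.2.2, fun i => by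
    by_cases h1 : i = a
    · exact Or.inl h1
    by_cases h2 : i = o
    · exact Or.inr (Or.inl h2)
    exact Or.inr (Or.inr ⟨⟨i, h1, h2⟩, rfl⟩)⟩

theorem finrank_pt : Module.finrank ℝ (Pt d) = (d - 1) + 1 := by
  have := NeZero.pos d
  simp only [finrank_euclideanSpace, Fintype.card_fin]
  omega

theorem centroid_id_eq (s : Finset (Pt d)) (hs : s.Nonempty) :
    s.centroid ℝ id = (s.card : ℝ)⁻¹ • ∑ x ∈ s, x := by
  rw [Finset.centroid_def, Finset.affineCombination_eq_linear_combination _ _ _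
    (s.sum_centroidWeights_eq_one_of_nonempty ℝ hs)]
  simp [Finset.smul_sum]

/-- Modulo the direction space `S` of the facet, the vector joining the barycentres is a positive
multiple of any edge from the facet to `a`. Its projection orthogonal to `S` therefore points to the
side of `a`, and it is nonzero because `a` is not in the span of the facet. -/
theorem isNormal_normal (K : M.Cell) (a : {x // x ∈ K.1}) :
    IsNormal (M.cellBasis K) a (M.normal K (M.opp K a)) := by
  classical
  set e := (M.opp K a).1.1 with he
  set S := vectorSpan ℝ (e : Set (Pt d)) with hS
  set w : Pt d := K.1.centroid ℝ id - e.centroid ℝ id with hw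
  set N := M.inward K (M.opp K a) with hN
  have hNw : N = Sᗮ.starProjection w := rfl
  have hNS : ∀ s ∈ S, inner ℝ N s = 0 := fun s hs => by
    have : N ∈ Sᗮ := by rw [hNw]; exact Submodule.starProjection_apply_mem _ _
    rw [real_inner_comm]
    exact this s hs
  have hd := NeZero.pos d
  have hcard : e.card = d := (M.opp K a).1.2.2
  have hene : e.Nonempty := Finset.card_pos.1 (by omega)
  have hsum : ∑ x ∈ K.1, x = a.1 + ∑ x ∈ e, x := by
    have : e = K.1.erase a.1 := rfl
    rw [this, Finset.add_sum_erase _ (fun x => x) a.2]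
  have hd0 : (d : ℝ) ≠ 0 := by exact_mod_cast hd.ne'
  have hd1 : ((d : ℝ) + 1) ≠ 0 := by positivity
  have hw2 : ((d : ℝ) + 1) • w = a.1 - e.centroid ℝ id := by
    rw [hw, centroid_id_eq K.1 ⟨_, a.2⟩, centroid_id_eq e hene, hsum, K.2.2, hcard]
    push_cast
    rw [smul_sub, smul_smul, mul_inv_cancel₀ hd1, one_smul, smul_smul, add_mul, one_mul,
      mul_inv_cancel₀ hd0, add_smul, one_smul]
    abel
  have hvs : ∀ x ∈ e, ∀ y ∈ e, x - y ∈ S := fun x hx y hy =>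
    vsub_mem_vectorSpan ℝ (Finset.mem_coe.2 hx) (Finset.mem_coe.2 hy)
  have hcS : ∀ x ∈ e, e.centroid ℝ id - x ∈ S := fun x hx => by
    have h1 : e.centroid ℝ id - x = (e.card : ℝ)⁻¹ • ∑ y ∈ e, (y - x) := by
      rw [centroid_id_eq e hene, Finset.sum_sub_distrib, Finset.sum_const, smul_sub,
        ← Nat.cast_smul_eq_nsmul ℝ, smul_smul, inv_mul_cancel₀ (by rw [hcard]; exact hd0), one_smul]
    rw [h1]
    exact S.smul_mem _ (S.sum_mem fun y hy => hvs y hy x hx)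
  have hmem : ∀ i : {x // x ∈ K.1}, i ≠ a → i.1 ∈ e := fun i hi => by
    rw [he, mem_opp_iff]
    exact ⟨fun h => hi (Subtype.ext h), i.2⟩
  have hN0 : N ≠ 0 := by
    intro h0
    have hwS : w ∈ S := by
      have h1 : w ∈ Sᗮᗮ := by
        rw [← Submodule.starProjection_apply_eq_zero_iff]
        exact h0
      rwa [Submodule.orthogonal_orthogonal] at h1
    -- The barycentric coordinate of `a` is constant on the facet, so its linear part kills `S`; but
    -- that linear part takes the value 1 on any edge ending at `a`.
    have hle : S ≤ LinearMap.ker ((M.cellBasis K).coord a).linear := by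
      rw [hS, vectorSpan_def, Submodule.span_le]
      rintro _ ⟨x, hx, y, hy, rfl⟩
      simp only [Finset.mem_coe] at hx hy
      have hx' := (M.mem_opp_iff K a x).1 hx
      have hy' := (M.mem_opp_iff K a y).1 hy
      simp only [SetLike.mem_coe, LinearMap.mem_ker, AffineMap.linearMap_vsub]
      have e1 := (M.cellBasis K).coord_apply_ne (i := a) (j := ⟨x, hx'.2⟩)
        (fun h => hx'.1 (congrArg Subtype.val h).symm)
      have e2 := (M.cellBasis K).coord_apply_ne (i := a) (j := ⟨y, hy'.2⟩)
        (fun h => hy'.1 (congrArg Subtype.val h).symm)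
      simp only [cellBasis_apply] at e1 e2
      rw [e1, e2, vsub_self]
    obtain ⟨o, ho⟩ := M.exists_ne_vertex K a
    have h3 : a.1 - o.1 ∈ S := by
      have : a.1 - o.1 = ((d : ℝ) + 1) • w + (e.centroid ℝ id - o.1) := by rw [hw2]; abel
      rw [this]
      exact S.add_mem (S.smul_mem _ hwS) (hcS _ (hmem o ho))
    have h4 := hle h3
    rw [LinearMap.mem_ker, ← vsub_eq_sub, AffineMap.linearMap_vsub] at h4
    have e1 := (M.cellBasis K).coord_apply_eq a
    have e2 := (M.cellBasis K).coord_apply_ne (i := a) (j := o) ho.symm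
    simp only [cellBasis_apply] at e1 e2
    rw [e1, e2] at h4
    simp at h4
  have hNn : 0 < ‖N‖ := norm_pos_iff.2 hN0
  have hnorm : M.normal K (M.opp K a) = -(‖N‖⁻¹ • N) := rfl
  refine ⟨?_, ?_, ?_⟩
  · rw [hnorm, norm_neg, norm_smul, norm_inv, norm_norm, inv_mul_cancel₀ hNn.ne']
  · intro i j hi hj
    rw [hnorm, inner_neg_left, real_inner_smul_left, cellBasis_apply, cellBasis_apply,
      hNS _ (hvs _ (hmem i hi) _ (hmem j hj))]
    simp
  · intro i hi
    have h1 : a.1 - i.1 = ((d : ℝ) + 1) • w + (e.centroid ℝ id - i.1) := by rw [hw2]; abel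
    have h2 : inner ℝ N w = ‖N‖ ^ 2 := by
      have h3 : w = N + S.starProjection w := by
        rw [hNw, add_comm]
        exact (Submodule.starProjection_add_starProjection_orthogonal w).symm
      conv_lhs => rw [h3]
      rw [inner_add_right, real_inner_self_eq_norm_sq,
        hNS _ (Submodule.starProjection_apply_mem _ _), add_zero]
    rw [hnorm, inner_neg_left, real_inner_smul_left, cellBasis_apply, cellBasis_apply, h1,
      inner_add_right, real_inner_smul_right, h2, hNS _ (hcS _ (hmem i hi))]
    rw [neg_lt_zero]
    positivity

/-- The divergence theorem on an element. -/
theorem integral_pderiv (K : M.Cell) (p : MvPolynomial (Fin d) ℝ) (i : Fin d) :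
    M.cellInt K (fun x => pval (MvPolynomial.pderiv i p) x) =
      ∑ e : M.FacetOf K, M.normal K e i * M.facetInt e.1 (fun x => pval p x) := by
  classical
  have hint (q : MvPolynomial (Fin d) ℝ) : IntegrableOn (pval q) (M.cellSet K) :=
    (continuous_pval q).continuousOn.integrableOn_compact (M.isCompact_cellSet K)
  -- Both sides are made linear in a direction `t`. The edges issuing from one vertex form a basis,
  -- and for an edge the identity is `integral_simplex_deriv`.
  let φ : Pt d →ₗ[ℝ] ℝ := ∑ i : Fin d, M.cellInt K (fun x => pval (MvPolynomial.pderiv i p) x) •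
    (EuclideanSpace.proj i : Pt d →L[ℝ] ℝ).toLinearMap
  let ψ : Pt d →ₗ[ℝ] ℝ := ∑ e : M.FacetOf K, M.facetInt e.1 (fun x => pval p x) •
    (innerSL ℝ (M.normal K e)).toLinearMap
  have hφ (t : Pt d) : φ t = M.cellInt K (fun x => pval (dirDeriv t p) x) := by
    rw [cellInt_eq]
    simp only [dirDeriv, pval_sum, pval_mul, pval_C]
    rw [integral_finsetSum _ fun i _ => (hint _).const_mul _]
    simp only [φ, LinearMap.sum_apply, LinearMap.smul_apply, smul_eq_mul, cellInt_eq,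
      integral_const_mul]
    exact Finset.sum_congr rfl fun i _ => mul_comm _ _
  obtain ⟨o⟩ : Nonempty {x // x ∈ K.1} := by
    have : 0 < K.1.card := by rw [K.2.2]; omega
    obtain ⟨x, hx⟩ := Finset.card_pos.1 this
    exact ⟨⟨x, hx⟩⟩
  have hφψ : φ = ψ := by
    refine ((M.cellBasis K).basisOf o).ext fun j => ?_
    obtain ⟨a, hao⟩ := j
    rw [AffineBasis.basisOf_apply, hφ, vsub_eq_sub, cellInt_eq, cellSet_eq]
    rw [integral_simplex_deriv (M.splits K hao) (M.isNormal_normal K a) finrank_pt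
      (M.isNormal_normal K o) (continuous_pval _) (fun x r => hasDerivAt_pval p x _ r)
      (continuous_pval p)]
    simp only [ψ, LinearMap.sum_apply, LinearMap.smul_apply, smul_eq_mul]
    -- A facet opposite to a third vertex contains the edge from `o` to `a`, so its normal is
    -- orthogonal to this edge and it contributes nothing.
    rw [M.sum_facetOf K, (M.splits K hao).sum_eq, Finset.sum_eq_zero, add_zero, facetInt_eq,
      facetInt_eq, facetSet_opp, facetSet_opp]
    · simp [mul_comm]
    · rintro ⟨s, hs1, hs2⟩ -
      have := (M.isNormal_normal K s).inner_eq a o (Ne.symm hs1) (Ne.symm hs2)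
      simp only [ContinuousLinearMap.coe_coe, innerSL_apply_apply, this, mul_zero]
  have := congrArg (fun φ => φ (EuclideanSpace.single i 1)) hφψ
  simp only [φ, ψ, LinearMap.sum_apply, LinearMap.smul_apply, smul_eq_mul] at this
  rw [Finset.sum_eq_single i] at this
  · simpa [EuclideanSpace.inner_single_right, mul_comm] using this
  · intro j _ hj
    simp [hj]
  · simp

end Mesh

theorem affineMap_eq_sum_coord {ι V : Type*} [Fintype ι] [AddCommGroup V] [Module ℝ V]
    (b : AffineBasis ι ℝ V) (f : V →ᵃ[ℝ] ℝ) (x : V) : f x = ∑ i, b.coord i x * f (b i) := by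
  have hf : ∀ v, f v = f.linear v + f 0 := fun v => congrFun f.decomp v
  conv_lhs => rw [← b.linear_combination_coord_eq_self x, hf]
  simp_rw [hf (b _), mul_add, Finset.sum_add_distrib, ← Finset.sum_mul, b.sum_coord_apply_eq_one,
    one_mul, map_sum, map_smul, smul_eq_mul]

/-! ### Generic segments and propagation of cellwise constants through the mesh. -/

namespace Mesh

variable {d : ℕ} (M : Mesh d)

/-- The points which lie on no face of codimension at least two (nor on its affine span). -/
def Generic (x : Pt d) : Prop :=
  ∀ K : M.Cell, ∀ s ⊆ K.1, s.card < d → x ∉ affineSpan ℝ (s : Set (Pt d))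

theorem affineSpan_ne_top {s : Finset (Pt d)} (hs : s.card ≤ d) :
    affineSpan ℝ (s : Set (Pt d)) ≠ ⊤ := by
  classical
  intro h
  rcases s.eq_empty_or_nonempty with rfl | hne
  · simp only [Finset.coe_empty, AffineSubspace.span_empty] at h
    exact AffineSubspace.bot_ne_top ℝ (Pt d) (Pt d) h
  · obtain ⟨n, hn⟩ : ∃ n, s.card = n + 1 := ⟨s.card - 1, by have := hne.card_pos; omega⟩
    have h1 := finrank_vectorSpan_image_finset_le ℝ (id : Pt d → Pt d) s hn
    rw [Finset.image_id, ← direction_affineSpan, h, AffineSubspace.direction_top, finrank_top] at h1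
    simp only [finrank_euclideanSpace, Fintype.card_fin] at h1
    omega

/-- At most `d` points span a proper affine subspace; finitely many of these form a null set, which
cannot contain a nonempty open set. -/
theorem exists_mem_notMem_affineSpan {A : Set (Pt d)} (hA : IsOpen A) (hne : A.Nonempty)
    (S : Finset (Finset (Pt d))) (hS : ∀ s ∈ S, s.card ≤ d) :
    ∃ x ∈ A, ∀ s ∈ S, x ∉ affineSpan ℝ (s : Set (Pt d)) := by
  by_contra hcon
  push Not at hcon
  have h0 : volume (⋃ s ∈ S, (affineSpan ℝ (s : Set (Pt d)) : Set (Pt d))) = 0 := by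
    refine (measure_biUnion_null_iff S.countable_toSet).2 fun s hs => ?_
    exact Measure.addHaar_affineSubspace _ _ (affineSpan_ne_top (hS s hs))
  refine (hA.measure_pos volume hne).ne' (measure_mono_null (fun x hx => ?_) h0)
  obtain ⟨s, hs, hxs⟩ := hcon x hx
  exact Set.mem_biUnion hs hxs

/-- Between two open sets there is a segment of generic points. -/
theorem exists_generic_segment {A B : Set (Pt d)} (hA : IsOpen A) (hAne : A.Nonempty)
    (hB : IsOpen B) (hBne : B.Nonempty) :
    ∃ x ∈ A, ∃ y ∈ B, ∀ t : ℝ, M.Generic (AffineMap.lineMap x y t) := by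
  classical
  let S : Finset (Finset (Pt d)) :=
    (Finset.univ : Finset M.Cell).biUnion fun K => K.1.powerset.filter fun s => s.card < d
  have hS : ∀ s, s ∈ S ↔ ∃ K : M.Cell, s ⊆ K.1 ∧ s.card < d := fun s => by simp [S]
  obtain ⟨x, hxA, hx⟩ := exists_mem_notMem_affineSpan hA hAne S fun s hs => by
    obtain ⟨K, -, h⟩ := (hS s).1 hs
    exact h.le
  -- The point `y` avoids the spans of `x` together with each small face, which still involve at
  -- most `d` points. If a point of the line other than `x` lay in the span of `s`, the whole line
  -- and hence `y` would lie in the span of `insert x s`.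
  obtain ⟨y, hyB, hy⟩ := exists_mem_notMem_affineSpan hB hBne (S.image (insert x)) fun s hs => by
    obtain ⟨s', hs', rfl⟩ := Finset.mem_image.1 hs
    obtain ⟨K, -, h⟩ := (hS s').1 hs'
    exact (Finset.card_insert_le _ _).trans h
  refine ⟨x, hxA, y, hyB, fun t K s hsK hs hmem => ?_⟩
  have hsS := (hS s).2 ⟨K, hsK, hs⟩
  have ht : t ≠ 0 := by
    rintro rfl
    rw [AffineMap.lineMap_apply_zero] at hmem
    exact hx s hsS hmem
  refine hy _ (Finset.mem_image_of_mem _ hsS) ?_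
  have h1 : AffineMap.lineMap x y t ∈ affineSpan ℝ ((insert x s : Finset (Pt d)) : Set (Pt d)) :=
    affineSpan_mono ℝ (Finset.coe_subset.2 (Finset.subset_insert x s)) hmem
  have h2 : x ∈ affineSpan ℝ ((insert x s : Finset (Pt d)) : Set (Pt d)) :=
    subset_affineSpan ℝ _ (Finset.mem_coe.2 (Finset.mem_insert_self x s))
  have h3 : y = AffineMap.lineMap x (AffineMap.lineMap x y t : Pt d) t⁻¹ := by
    simp only [AffineMap.lineMap_apply, vsub_eq_sub, vadd_eq_add, add_sub_cancel_right, smul_smul,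
      inv_mul_cancel₀ ht, one_smul, sub_add_cancel]
  rw [h3]
  exact AffineMap.lineMap_mem _ h2 h1

theorem mem_cellSet_iff (K : M.Cell) (x : Pt d) :
    x ∈ M.cellSet K ↔ ∀ i, 0 ≤ (M.cellBasis K).coord i x := by
  rw [cellSet_eq, mem_convexHull_range_iff]

theorem mem_interior_cellSet_iff (K : M.Cell) (x : Pt d) :
    x ∈ interior (M.cellSet K) ↔ ∀ i, 0 < (M.cellBasis K).coord i x := by
  rw [cellSet_eq, AffineBasis.interior_convexHull]
  rfl

/-- The vertices of `K` with positive weight at a point of `K ∩ K'` belong to `K'`. -/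
theorem mem_of_coord_pos {K K' : M.Cell} {x : Pt d} (hx : x ∈ M.cellSet K) (hx' : x ∈ M.cellSet K')
    {i : {x // x ∈ K.1}} (hi : 0 < (M.cellBasis K).coord i x) : i.1 ∈ K'.1 := by
  by_contra hcon
  have h1 : x ∈ convexHull ℝ ((K.1 : Set (Pt d)) ∩ K'.1) :=
    M.complex.inter_subset_convexHull K.2.1 K'.2.1 ⟨hx, hx'⟩
  have h2 : (K.1 : Set (Pt d)) ∩ K'.1 = M.cellBasis K '' {j | j.1 ∈ K'.1} := by
    ext y
    simp only [Set.mem_inter_iff, Finset.mem_coe, Set.mem_image, cellBasis_apply]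
    constructor
    · rintro ⟨h, h'⟩
      exact ⟨⟨y, h⟩, h', rfl⟩
    · rintro ⟨j, hj, rfl⟩
      exact ⟨j.2, hj⟩
  rw [h2, mem_convexHull_image_iff] at h1
  exact hi.ne' (h1.2 i hcon)

theorem eq_of_mem_interior {K K' : M.Cell} {x : Pt d} (hx : x ∈ interior (M.cellSet K))
    (hx' : x ∈ M.cellSet K') : K = K' := by
  have h := (M.mem_interior_cellSet_iff K x).1 hx
  refine Subtype.ext (Finset.eq_of_subset_of_card_le (fun i hi => ?_) (by rw [K.2.2, K'.2.2]))
  exact M.mem_of_coord_pos (interior_subset hx) hx' (h ⟨i, hi⟩)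

variable [NeZero d]

/-- The relative interior of the edge (face) of `K` opposite to `a`. -/
def RelInt (K : M.Cell) (a : {x // x ∈ K.1}) (x : Pt d) : Prop :=
  (M.cellBasis K).coord a x = 0 ∧ ∀ i, i ≠ a → 0 < (M.cellBasis K).coord i x

theorem mem_facetSet_opp_iff (K : M.Cell) (a : {x // x ∈ K.1}) (x : Pt d) :
    x ∈ M.facetSet (M.opp K a).1 ↔
      (∀ i, 0 ≤ (M.cellBasis K).coord i x) ∧ (M.cellBasis K).coord a x = 0 := by
  rw [facetSet_opp, mem_convexHull_image_iff]
  simp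

theorem RelInt.mem_cellSet {M : Mesh d} {K : M.Cell} {a : {x // x ∈ K.1}} {x : Pt d}
    (h : M.RelInt K a x) : x ∈ M.cellSet K := by
  rw [mem_cellSet_iff]
  intro i
  by_cases hi : i = a
  · rw [hi, h.1]
  · exact (h.2 i hi).le

/-- Two vanishing barycentric weights would place the point in the hull of `d - 1` vertices, which a
generic point avoids. -/
theorem Generic.interior_or_relInt {M : Mesh d} {x : Pt d} (hx : M.Generic x) {K : M.Cell}
    (hK : x ∈ M.cellSet K) : x ∈ interior (M.cellSet K) ∨ ∃ a, M.RelInt K a x := by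
  classical
  have h0 := (M.mem_cellSet_iff K x).1 hK
  by_cases hall : ∀ i, 0 < (M.cellBasis K).coord i x
  · exact Or.inl ((M.mem_interior_cellSet_iff K x).2 hall)
  · push Not at hall
    obtain ⟨a, ha⟩ := hall
    have ha0 : (M.cellBasis K).coord a x = 0 := le_antisymm ha (h0 a)
    refine Or.inr ⟨a, ha0, fun i hi => lt_of_le_of_ne (h0 i) fun hi0 => ?_⟩
    refine hx K ((K.1.erase a).erase i)
      ((Finset.erase_subset _ _).trans (Finset.erase_subset _ _)) ?_ ?_
    · rw [Finset.card_erase_of_mem, Finset.card_erase_of_mem a.2, K.2.2]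
      · have := NeZero.pos d
        omega
      · exact Finset.mem_erase.2 ⟨fun h => hi (Subtype.ext h), i.2⟩
    · refine convexHull_subset_affineSpan _ ?_
      have : (((K.1.erase a).erase i : Finset (Pt d)) : Set (Pt d)) =
          M.cellBasis K '' {j | j ≠ a ∧ j ≠ i} := by
        ext y
        simp only [Finset.mem_coe, Finset.mem_erase, Set.mem_image, cellBasis_apply]
        constructor
        · rintro ⟨h1, h2, h3⟩
          exact ⟨⟨y, h3⟩, ⟨fun h => h2 (congrArg Subtype.val h),
            fun h => h1 (congrArg Subtype.val h)⟩, rfl⟩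
        · rintro ⟨j, ⟨h1, h2⟩, rfl⟩
          exact ⟨fun h => h2 (Subtype.ext h), fun h => h1 (Subtype.ext h), j.2⟩
      rw [this, mem_convexHull_image_iff]
      refine ⟨h0, fun j hj => ?_⟩
      have hj : j = a ∨ j = i := by
        by_contra hc
        push Not at hc
        exact hj hc
      rcases hj with rfl | rfl
      · exact ha0
      · exact hi0.symm

/-- Conformity of the mesh: all vertices of the facet carry positive weight at `x`, so each is also
a vertex of `K'`. -/
theorem opp_subset_of_relInt {K K' : M.Cell} {a : {x // x ∈ K.1}} {x : Pt d}
    (hx : M.RelInt K a x) (hx' : x ∈ M.cellSet K') : (M.opp K a).1.1 ⊆ K'.1 := by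
  intro y hy
  obtain ⟨h1, h2⟩ := (M.mem_opp_iff K a y).1 hy
  exact M.mem_of_coord_pos hx.mem_cellSet hx' (i := ⟨y, h2⟩)
    (hx.2 _ fun h => h1 (congrArg Subtype.val h))

/-- The union of the elements in `C`. -/
def cover (C : Finset M.Cell) : Set (Pt d) := ⋃ K ∈ C, M.cellSet K

theorem isClosed_cover (C : Finset M.Cell) : IsClosed (M.cover C) :=
  C.finite_toSet.isClosed_biUnion fun K _ => (M.isCompact_cellSet K).isClosed

theorem mem_cover_iff {C : Finset M.Cell} {x : Pt d} :
    x ∈ M.cover C ↔ ∃ K ∈ C, x ∈ M.cellSet K := by simp [cover]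

theorem lineMap_coord (K : M.Cell) (i : {x // x ∈ K.1}) (x y : Pt d) (t : ℝ) :
    (M.cellBasis K).coord i (AffineMap.lineMap x y t) =
      (1 - t) * (M.cellBasis K).coord i x + t * (M.cellBasis K).coord i y := by
  rw [AffineMap.apply_lineMap, AffineMap.lineMap_apply_module]
  simp

/-- If an edge (face) of an element of `C` meets the interior of the covered region, then its
relative interior is contained in it. -/
theorem relInt_mem_interior_cover {C : Finset M.Cell} {K : M.Cell} (hK : K ∈ C)
    {a : {x // x ∈ K.1}} {z z' : Pt d} (hz : M.RelInt K a z)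
    (hz' : z' ∈ M.facetSet (M.opp K a).1) (hint : z' ∈ interior (M.cover C)) :
    z ∈ interior (M.cover C) := by
  classical
  set b := M.cellBasis K with hb
  have hz'c := (M.mem_facetSet_opp_iff K a z').1 hz'
  have hlc (x y : Pt d) : Continuous fun t : ℝ => (AffineMap.lineMap x y t : Pt d) :=
    AffineMap.lineMap_continuous
  -- The given point `z'` may lie on a lower-dimensional face; a small move towards `z` reaches the
  -- relative interior without leaving the open set.
  obtain ⟨z₂, hz₂, hz₂i⟩ : ∃ z₂, M.RelInt K a z₂ ∧ z₂ ∈ interior (M.cover C) := by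
    have h1 : ∀ᶠ t : ℝ in nhdsWithin 0 (Set.Ioi 0),
        (AffineMap.lineMap z' z t : Pt d) ∈ interior (M.cover C) := by
      refine Filter.Eventually.filter_mono nhdsWithin_le_nhds ?_
      refine (hlc z' z).continuousAt.eventually_mem (isOpen_interior.mem_nhds ?_)
      simpa using hint
    have h2 : ∀ᶠ t : ℝ in nhdsWithin 0 (Set.Ioi 0), t ∈ Set.Ioo (0 : ℝ) 1 :=
      Ioo_mem_nhdsGT one_pos
    obtain ⟨t, ht1, ht2⟩ := (h1.and h2).exists
    refine ⟨_, ⟨?_, fun i hi => ?_⟩, ht1⟩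
    · rw [lineMap_coord, hz'c.2, hz.1]
      simp
    · rw [lineMap_coord]
      have e1 := hz'c.1 i
      have e2 := hz.2 i hi
      have e3 : 0 < t := ht2.1
      have e4 : 0 < 1 - t := by linarith [ht2.2]
      positivity
  have htend : Filter.Tendsto (fun t : ℝ => (AffineMap.lineMap z₂ a.1 (-t) : Pt d))
      (nhdsWithin 0 (Set.Ioi 0)) (nhds z₂) := by
    have : Filter.Tendsto (fun t : ℝ => (AffineMap.lineMap z₂ a.1 (-t) : Pt d)) (nhds 0)
        (nhds (AffineMap.lineMap z₂ a.1 (-(0 : ℝ)))) :=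
      ((hlc z₂ a.1).comp continuous_neg).continuousAt
    simp only [neg_zero, AffineMap.lineMap_apply_zero] at this
    exact this.mono_left nhdsWithin_le_nhds
  -- Points just behind the facet, on the side away from `a`, are covered. As `C` is finite, one
  -- element contains them for arbitrarily small `t`; being closed it also contains `z₂`, and so it
  -- shares the whole facet.
  obtain ⟨K', hK', hfreq⟩ : ∃ K' ∈ C, ∃ᶠ t : ℝ in nhdsWithin 0 (Set.Ioi 0),
      (AffineMap.lineMap z₂ a.1 (-t) : Pt d) ∈ M.cellSet K' := by
    by_contra hcon
    push Not at hcon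
    have h1 := (Filter.eventually_all_finset C).2 hcon
    have h2 := htend.eventually (isOpen_interior.mem_nhds hz₂i)
    obtain ⟨t, ht1, ht2⟩ := (h1.and h2).exists
    obtain ⟨K', hK', hm⟩ := M.mem_cover_iff.1 (interior_subset ht2)
    exact ht1 K' hK' hm
  have hz₂K' : z₂ ∈ M.cellSet K' :=
    (M.isCompact_cellSet K').isClosed.mem_of_frequently_of_tendsto hfreq htend
  have hsub := M.opp_subset_of_relInt hz₂ hz₂K'
  obtain ⟨a', ha'⟩ := (M.opp_bijective K').2 ⟨(M.opp K a).1, hsub⟩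
  have ha'1 : (M.opp K' a').1.1 = (M.opp K a).1.1 := by rw [ha']
  set b' := M.cellBasis K' with hb'
  have hopp (i : {x // x ∈ K'.1}) (hi : i ≠ a') : ∃ h : i.1 ∈ K.1, (⟨i.1, h⟩ : {x // x ∈ K.1}) ≠ a := by
    have h1 : i.1 ∈ (M.opp K' a').1.1 :=
      (M.mem_opp_iff K' a' i).2 ⟨fun h => hi (Subtype.ext h), i.2⟩
    rw [ha'1, mem_opp_iff] at h1
    exact ⟨h1.2, fun h => h1.1 (congrArg Subtype.val h)⟩
  have hopp' (i : {x // x ∈ K.1}) (hi : i ≠ a) :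
      ∃ h : i.1 ∈ K'.1, (⟨i.1, h⟩ : {x // x ∈ K'.1}) ≠ a' := by
    have h1 : i.1 ∈ (M.opp K a).1.1 :=
      (M.mem_opp_iff K a i).2 ⟨fun h => hi (Subtype.ext h), i.2⟩
    rw [← ha'1, mem_opp_iff] at h1
    exact ⟨h1.2, fun h => h1.1 (congrArg Subtype.val h)⟩
  -- The coordinate of `a` vanishes at every vertex of `K'` other than `a'`, so it is a multiple of
  -- the coordinate of `a'`.
  have hlam (w : Pt d) : b.coord a w = b'.coord a' w * b.coord a a'.1 := by
    rw [affineMap_eq_sum_coord b' (b.coord a) w, Finset.sum_eq_single a']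
    · rfl
    · intro i _ hi
      obtain ⟨h1, h2⟩ := hopp i hi
      have : b.coord a (b' i) = 0 := b.coord_apply_ne (i := a) (j := ⟨i.1, h1⟩) h2.symm
      rw [this, mul_zero]
    · simp
  -- The points behind the facet have `a`-coordinate `-t` and belong to `K'`, so `a'` lies on the
  -- other side of the facet from `a`.
  have hneg : b.coord a a'.1 < 0 := by
    obtain ⟨t, ht1, ht2⟩ := (hfreq.and_eventually self_mem_nhdsWithin).exists
    have e1 : b.coord a (AffineMap.lineMap z₂ a.1 (-t)) = -t := by
      have e2 : b.coord a a.1 = 1 := b.coord_apply_eq a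
      rw [lineMap_coord, hz₂.1, ← hb, e2]
      ring
    have e3 := (M.mem_cellSet_iff K' _).1 ht1 a'
    have e4 := hlam (AffineMap.lineMap z₂ a.1 (-t))
    rw [e1] at e4
    have ht : (0 : ℝ) < t := ht2
    by_contra hc
    push Not at hc
    have := mul_nonneg e3 hc
    linarith
  have hpos' (i : {x // x ∈ K'.1}) (hi : i ≠ a') : 0 < b'.coord i z := by
    obtain ⟨h1, h2⟩ := hopp i hi
    rw [affineMap_eq_sum_coord b (b'.coord i) z, Finset.sum_eq_single ⟨i.1, h1⟩]
    · have : b'.coord i (b ⟨i.1, h1⟩) = 1 := b'.coord_apply_eq i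
      rw [this, mul_one]
      exact hz.2 _ h2
    · intro j _ hj
      by_cases hja : j = a
      · rw [hja, hz.1, zero_mul]
      · obtain ⟨h3, -⟩ := hopp' j hja
        have : b'.coord i (b j) = 0 := b'.coord_apply_ne (i := i) (j := ⟨j.1, h3⟩)
          fun h => hj (Subtype.ext (congrArg Subtype.val h).symm)
        rw [this, mul_zero]
    · simp
  rw [mem_interior_iff_mem_nhds]
  have n1 : ∀ᶠ w in nhds z, ∀ i, i ≠ a → 0 < b.coord i w := by
    rw [Filter.eventually_all]
    intro i
    by_cases hi : i = a
    · simp [hi]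
    · filter_upwards [(continuous_coord b i).continuousAt.eventually_const_lt (hz.2 i hi)] with w hw _
      exact hw
  have n2 : ∀ᶠ w in nhds z, ∀ i, i ≠ a' → 0 < b'.coord i w := by
    rw [Filter.eventually_all]
    intro i
    by_cases hi : i = a'
    · simp [hi]
    · filter_upwards [(continuous_coord b' i).continuousAt.eventually_const_lt (hpos' i hi)]
        with w hw _
      exact hw
  filter_upwards [n1, n2] with w h1 h2
  rw [mem_cover_iff]
  -- Near `z` all other weights are positive in both elements, so the sign of the `a`-coordinate
  -- alone decides which of them contains `w`.
  by_cases hw : 0 ≤ b.coord a w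
  · refine ⟨K, hK, (M.mem_cellSet_iff K w).2 fun i => ?_⟩
    by_cases hi : i = a
    · rw [hi]
      exact hw
    · exact (h1 i hi).le
  · refine ⟨K', hK', (M.mem_cellSet_iff K' w).2 fun i => ?_⟩
    by_cases hi : i = a'
    · rw [hi]
      have := hlam w
      by_contra hc
      push Not at hc hw
      have := mul_pos_of_neg_of_neg hc hneg
      linarith
    · exact (h2 i hi).le

theorem cellSet_subset_closure {C : Finset M.Cell} {K : M.Cell} (hK : K ∈ C) :
    M.cellSet K ⊆ closure (interior (M.cover C)) := by
  have hc : Convex ℝ (M.cellSet K) := convex_convexHull ℝ _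
  have h1 := hc.closure_interior_eq_closure_of_nonempty_interior (M.interior_cellSet_nonempty K)
  refine subset_closure.trans (h1.symm.subset.trans (closure_mono (interior_mono ?_)))
  exact fun x hx => M.mem_cover_iff.2 ⟨K, hK, hx⟩

/-- The edges (faces) with a point in the interior of the covered region, or whose relative interior
meets its complement. -/
theorem facetSet_subset_frontier {C : Finset M.Cell} {K : M.Cell} (hK : K ∈ C)
    {a : {x // x ∈ K.1}} {z : Pt d} (hz : M.RelInt K a z) (hn : z ∉ interior (M.cover C)) :
    M.facetSet (M.opp K a).1 ⊆ frontier (interior (M.cover C)) := by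
  intro z' hz'
  have hK' : z' ∈ M.cellSet K :=
    (M.mem_cellSet_iff K z').2 ((M.mem_facetSet_opp_iff K a z').1 hz').1
  rw [isOpen_interior.frontier_eq]
  exact ⟨M.cellSet_subset_closure hK hK', fun hi => hn (M.relInt_mem_interior_cover hK hz hz' hi)⟩

/-! ### Cellwise constants on a covered region. -/

section Constants

variable {C : Finset M.Cell} {c : M.Cell → ℝ}

/-- Two elements meeting at a generic point either coincide or share a facet, so adjacency of
elements suffices. -/
theorem Generic.eq_of_mem {M : Mesh d} {C : Finset M.Cell} {c : M.Cell → ℝ}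
    (hadj : ∀ K ∈ C, ∀ K' ∈ C, ∀ e : M.Facet, e.1 ⊆ K.1 → e.1 ⊆ K'.1 → c K = c K')
    {x : Pt d} (hx : M.Generic x) {K K' : M.Cell} (hK : K ∈ C) (hK' : K' ∈ C)
    (h : x ∈ M.cellSet K) (h' : x ∈ M.cellSet K') : c K = c K' := by
  rcases hx.interior_or_relInt h with hi | ⟨a, ha⟩
  · rw [M.eq_of_mem_interior hi h']
  · exact hadj K hK K' hK' (M.opp K a).1 (M.opp K a).2 (M.opp_subset_of_relInt ha h')

theorem isClosed_level (p : M.Cell → Prop) :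
    IsClosed {x | ∃ K ∈ C, p K ∧ x ∈ M.cellSet K} := by
  classical
  have : {x | ∃ K ∈ C, p K ∧ x ∈ M.cellSet K} = M.cover (C.filter p) := by
    ext x
    rw [mem_cover_iff]
    simp [and_assoc]
  rw [this]
  exact M.isClosed_cover _

/-- Cellwise constants that agree across edges (faces) and vanish at the boundary edges (faces)
are zero. -/
theorem const_eq_zero
    (hadj : ∀ K ∈ C, ∀ K' ∈ C, ∀ e : M.Facet, e.1 ⊆ K.1 → e.1 ⊆ K'.1 → c K = c K')
    (hbd : ∀ K ∈ C, ∀ e : M.FacetOf K, M.facetSet e.1 ⊆ frontier (interior (M.cover C)) → c K = 0) :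
    ∀ K ∈ C, c K = 0 := by
  intro K₀ hK₀
  by_contra hc0
  have hne : ((M.cover C)ᶜ).Nonempty := by
    have hbdd : Bornology.IsBounded (M.cover C) :=
      (C.finite_toSet.isCompact_biUnion fun K _ => M.isCompact_cellSet K).isBounded
    by_contra hcon
    rw [Set.not_nonempty_iff_eq_empty, Set.compl_empty_iff] at hcon
    rw [hcon] at hbdd
    exact NormedSpace.unbounded_univ ℝ (Pt d) hbdd
  obtain ⟨x, hx, y, hy, hgen⟩ := M.exists_generic_segment isOpen_interior
    (M.interior_cellSet_nonempty K₀) (M.isClosed_cover C).isOpen_compl hne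
  let γ : ℝ → Pt d := fun t => AffineMap.lineMap x y t
  have hγ : Continuous γ := AffineMap.lineMap_continuous
  -- Along a generic line from `K₀` to the outside, the closed sets `A` and `B` cover everything and
  -- are both met, hence they meet. The meeting point lies either on a boundary facet, where the
  -- constant is zero, or in two elements with different constants, which genericity excludes.
  let A : Set (Pt d) := {x | ∃ K ∈ C, c K = c K₀ ∧ x ∈ M.cellSet K}
  let B : Set (Pt d) := (interior (M.cover C))ᶜ ∪ {x | ∃ K ∈ C, c K ≠ c K₀ ∧ x ∈ M.cellSet K}
  have hA : IsClosed A := M.isClosed_level _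
  have hB : IsClosed B := isOpen_interior.isClosed_compl.union (M.isClosed_level _)
  have hcov : (Set.univ : Set ℝ) ⊆ γ ⁻¹' A ∪ γ ⁻¹' B := fun t _ => by
    by_cases ht : γ t ∈ interior (M.cover C)
    · obtain ⟨K, hK, hm⟩ := M.mem_cover_iff.1 (interior_subset ht)
      by_cases hcK : c K = c K₀
      · exact Or.inl ⟨K, hK, hcK, hm⟩
      · exact Or.inr (Or.inr ⟨K, hK, hcK, hm⟩)
    · exact Or.inr (Or.inl ht)
  obtain ⟨t, -, ⟨K, hK, hcK, hm⟩, ht⟩ := isPreconnected_closed_iff.1 isPreconnected_univ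
    _ _ (hA.preimage hγ) (hB.preimage hγ) hcov
    ⟨0, trivial, K₀, hK₀, rfl, by simpa [γ] using interior_subset hx⟩
    ⟨1, trivial, Or.inl (by
      simp only [γ, AffineMap.lineMap_apply_one]
      exact fun h => hy (interior_subset h))⟩
  rcases ht with ht | ⟨K', hK', hcK', hm'⟩
  · rcases (hgen t).interior_or_relInt hm with hi | ⟨a, ha⟩
    · exact ht (interior_mono (fun z hz => M.mem_cover_iff.2 ⟨K, hK, hz⟩) hi)
    · exact hc0 (hcK ▸ hbd K hK (M.opp K a) (M.facetSet_subset_frontier hK ha ht))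
  · exact hcK' ((hgen t).eq_of_mem hadj hK' hK hm' hm |>.trans hcK)

/-- Cellwise constants that agree across edges (faces) are equal if the covered region is
connected. -/
theorem const_eq_const
    (hadj : ∀ K ∈ C, ∀ K' ∈ C, ∀ e : M.Facet, e.1 ⊆ K.1 → e.1 ⊆ K'.1 → c K = c K')
    (hconn : IsConnected (interior (M.cover C))) :
    ∀ K ∈ C, ∀ K' ∈ C, c K = c K' := by
  intro K₀ hK₀ K₁ hK₁
  by_contra hc
  have hint (K : M.Cell) (hK : K ∈ C) : ((interior (M.cover C)) ∩ M.cellSet K).Nonempty := by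
    obtain ⟨x, hx⟩ := M.interior_cellSet_nonempty K
    exact ⟨x, interior_mono (fun z hz => M.mem_cover_iff.2 ⟨K, hK, hz⟩) hx, interior_subset hx⟩
  let A : Set (Pt d) := {x | ∃ K ∈ C, c K = c K₀ ∧ x ∈ M.cellSet K}
  let B : Set (Pt d) := {x | ∃ K ∈ C, c K ≠ c K₀ ∧ x ∈ M.cellSet K}
  have hA : IsClosed A := M.isClosed_level _
  have hB : IsClosed B := M.isClosed_level _
  have hAB : M.cover C ⊆ A ∪ B := fun z hz => by
    obtain ⟨K, hK, hm⟩ := M.mem_cover_iff.1 hz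
    by_cases hcK : c K = c K₀
    · exact Or.inl ⟨K, hK, hcK, hm⟩
    · exact Or.inr ⟨K, hK, hcK, hm⟩
  obtain ⟨x₀, hx₀, hx₀'⟩ := hint K₀ hK₀
  obtain ⟨x₁, hx₁, hx₁'⟩ := hint K₁ hK₁
  obtain ⟨z, hz, ⟨K, hK, hcK, hzK⟩, K', hK', hcK', hzK'⟩ :=
    isPreconnected_closed_iff.1 hconn.isPreconnected A B hA hB (interior_subset.trans hAB)
      ⟨x₀, hx₀, K₀, hK₀, rfl, hx₀'⟩ ⟨x₁, hx₁, K₁, hK₁, fun h => hc h.symm, hx₁'⟩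
  -- The point `z` shared by both closed sets need not be generic. A ball around `z` inside the
  -- region meets the interiors of `K` and `K'`, and the connectedness argument is repeated on a
  -- generic segment within this ball.
  obtain ⟨r, hr, hball⟩ := Metric.isOpen_iff.1 isOpen_interior z hz
  have hne (K : M.Cell) (hzK : z ∈ M.cellSet K) :
      (interior (M.cellSet K) ∩ Metric.ball z r).Nonempty := by
    have hcv : Convex ℝ (M.cellSet K) := convex_convexHull ℝ _
    have h1 := hcv.closure_interior_eq_closure_of_nonempty_interior (M.interior_cellSet_nonempty K)
    have h2 : z ∈ closure (interior (M.cellSet K)) := h1 ▸ subset_closure hzK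
    rw [Set.inter_comm]
    exact mem_closure_iff.1 h2 _ Metric.isOpen_ball (Metric.mem_ball_self hr)
  obtain ⟨x, hx, y, hy, hgen⟩ := M.exists_generic_segment
    (isOpen_interior.inter Metric.isOpen_ball) (hne K hzK)
    (isOpen_interior.inter Metric.isOpen_ball) (hne K' hzK')
  let γ : ℝ → Pt d := fun t => AffineMap.lineMap x y t
  have hγ : Continuous γ := AffineMap.lineMap_continuous
  have hcov : Set.Icc (0 : ℝ) 1 ⊆ γ ⁻¹' A ∪ γ ⁻¹' B := fun t ht =>
    hAB (interior_subset (hball ((convex_ball z r).lineMap_mem hx.2 hy.2 ht)))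
  obtain ⟨t, -, ⟨L, hL, hcL, hm⟩, L', hL', hcL', hm'⟩ :=
    isPreconnected_closed_iff.1 isPreconnected_Icc _ _ (hA.preimage hγ) (hB.preimage hγ) hcov
    ⟨0, by simp, K, hK, hcK, by simpa [γ] using interior_subset hx.1⟩
    ⟨1, by simp, K', hK', hcK', by simpa [γ] using interior_subset hy.1⟩
  exact hcL' ((hgen t).eq_of_mem hadj hL' hL hm' hm |>.trans hcL)

end Constants

end Mesh

/-! ### Spaces of polynomial functions, and integrals as functionals on polynomials. -/

section Functions

variable {d : ℕ}

/-- Restrictions of polynomials to `D`. -/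
noncomputable def polyFun (D : Set (Pt d)) : Subalgebra ℝ (D → ℝ) := (restr D).range

theorem restr_mem (D : Set (Pt d)) (p : MvPolynomial (Fin d) ℝ) : restr D p ∈ polyFun D := ⟨p, rfl⟩

theorem mem_polyOn {D : Set (Pt d)} {j : ℕ} {F : D → ℝ} :
    F ∈ polyOn D j ↔ ∃ p : MvPolynomial (Fin d) ℝ, p.totalDegree ≤ j ∧ restr D p = F := by
  constructor
  · rintro ⟨p, hp, h⟩
    exact ⟨p, hp, funext fun x => by rw [restr_apply, h]⟩
  · rintro ⟨p, hp, rfl⟩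
    exact ⟨p, hp, fun x => restr_apply D p x⟩

theorem polyFun_of_polyOn {D : Set (Pt d)} {j : ℕ} {F : D → ℝ} (h : F ∈ polyOn D j) :
    F ∈ polyFun D := by
  obtain ⟨p, -, rfl⟩ := mem_polyOn.1 h
  exact restr_mem D p

instance finiteDimensional_polyOn (D : Set (Pt d)) (j : ℕ) : FiniteDimensional ℝ (polyOn D j) := by
  have : polyOn D j =
      (MvPolynomial.restrictTotalDegree (Fin d) ℝ j).map (restr D).toLinearMap := by
    ext F
    rw [mem_polyOn, Submodule.mem_map]
    simp only [MvPolynomial.mem_restrictTotalDegree]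
    rfl
  rw [this]
  infer_instance

end Functions

namespace Mesh

variable {d : ℕ} (M : Mesh d)

theorem integrableOn_cell (K : M.Cell) (p : MvPolynomial (Fin d) ℝ) :
    IntegrableOn (pval p) (M.cellSet K) :=
  (continuous_pval p).continuousOn.integrableOn_compact (M.isCompact_cellSet K)

/-- The integral over an element as a linear functional on polynomials. -/
noncomputable def cellI (K : M.Cell) : MvPolynomial (Fin d) ℝ →ₗ[ℝ] ℝ where
  toFun p := ∫ x in M.cellSet K, pval p x
  map_add' p q := by
    simp only [pval_add]
    exact integral_add (M.integrableOn_cell K p) (M.integrableOn_cell K q)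
  map_smul' c p := by
    simp only [pval, MvPolynomial.smul_eval, integral_const_mul, RingHom.id_apply, smul_eq_mul]

theorem cellI_apply (K : M.Cell) (p : MvPolynomial (Fin d) ℝ) :
    M.cellI K p = ∫ x in M.cellSet K, pval p x := rfl

theorem cellInt_restr (K : M.Cell) (p : MvPolynomial (Fin d) ℝ) :
    M.cellInt K (restr _ p) = M.cellI K p := by
  have : restr (M.cellSet K) p = fun x : M.cellSet K => pval p x := funext fun x => restr_apply _ p x
  rw [this]
  exact M.cellInt_eq K (pval p)

variable [NeZero d]

theorem exists_cell (e : M.Facet) : ∃ K : M.Cell, e.1 ⊆ K.1 := by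
  obtain ⟨K, hK, h1, h2⟩ := M.pure e.1 e.2.1
  exact ⟨⟨K, hK, h2⟩, h1⟩

theorem exists_eq_opp (e : M.Facet) : ∃ K : M.Cell, ∃ a o : {x // x ∈ K.1}, a ≠ o ∧
    e = (M.opp K a).1 := by
  obtain ⟨K, hK⟩ := M.exists_cell e
  obtain ⟨a, ha⟩ := (M.opp_bijective K).2 ⟨e, hK⟩
  obtain ⟨o, ho⟩ := M.exists_ne_vertex K a
  exact ⟨K, a, o, ho.symm, by rw [ha]⟩

theorem facet_measure_lt_top (e : M.Facet) :
    (Measure.euclideanHausdorffMeasure (d - 1) : Measure (Pt d)) (M.facetSet e) < ⊤ := by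
  classical
  obtain ⟨K, a, o, hao, rfl⟩ := M.exists_eq_opp e
  rw [facetSet_opp]
  exact WG.facet_measure_lt_top (M.splits K hao) finrank_pt

theorem integrableOn_facet (e : M.Facet) (p : MvPolynomial (Fin d) ℝ) :
    IntegrableOn (pval p) (M.facetSet e) (Measure.euclideanHausdorffMeasure (d - 1)) :=
  (continuous_pval p).continuousOn.integrableOn_of_subset_isCompact (M.isCompact_facetSet e)
    (M.isCompact_facetSet e).measurableSet subset_rfl (M.facet_measure_lt_top e).ne

/-- The integral over an edge (face) as a linear functional on polynomials. -/
noncomputable def facetI (e : M.Facet) : MvPolynomial (Fin d) ℝ →ₗ[ℝ] ℝ where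
  toFun p := ∫ x in M.facetSet e, pval p x ∂(Measure.euclideanHausdorffMeasure (d - 1))
  map_add' p q := by
    simp only [pval_add]
    exact integral_add (M.integrableOn_facet e p) (M.integrableOn_facet e q)
  map_smul' c p := by
    simp only [pval, MvPolynomial.smul_eval, integral_const_mul, RingHom.id_apply, smul_eq_mul]

theorem facetI_apply (e : M.Facet) (p : MvPolynomial (Fin d) ℝ) :
    M.facetI e p = ∫ x in M.facetSet e, pval p x ∂(Measure.euclideanHausdorffMeasure (d - 1)) := rfl

theorem facetInt_restr (e : M.Facet) (p : MvPolynomial (Fin d) ℝ) :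
    M.facetInt e (restr _ p) = M.facetI e p := by
  have : restr (M.facetSet e) p = fun x : M.facetSet e => pval p x := funext fun x => restr_apply _ p x
  rw [this]
  exact M.facetInt_eq e (pval p)

theorem cellI_pderiv (K : M.Cell) (p : MvPolynomial (Fin d) ℝ) (i : Fin d) :
    M.cellI K (MvPolynomial.pderiv i p) = ∑ e : M.FacetOf K, M.normal K e i * M.facetI e.1 p := by
  have := M.integral_pderiv K p i
  simp only [cellInt_eq, facetInt_eq] at this
  exact this

theorem cellInt_add {K : M.Cell} {F G : M.cellSet K → ℝ} (hF : F ∈ polyFun _) (hG : G ∈ polyFun _) :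
    M.cellInt K (F + G) = M.cellInt K F + M.cellInt K G := by
  obtain ⟨p, rfl⟩ := hF
  obtain ⟨q, rfl⟩ := hG
  change M.cellInt K (restr _ p + restr _ q) = M.cellInt K (restr _ p) + M.cellInt K (restr _ q)
  rw [← map_add, cellInt_restr, cellInt_restr, cellInt_restr, map_add]

theorem cellInt_smul (K : M.Cell) (c : ℝ) (F : M.cellSet K → ℝ) :
    M.cellInt K (c • F) = c * M.cellInt K F := integral_const_mul _ _

theorem facetInt_add {e : M.Facet} {F G : M.facetSet e → ℝ} (hF : F ∈ polyFun _)
    (hG : G ∈ polyFun _) : M.facetInt e (F + G) = M.facetInt e F + M.facetInt e G := by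
  obtain ⟨p, rfl⟩ := hF
  obtain ⟨q, rfl⟩ := hG
  change M.facetInt e (restr _ p + restr _ q) = M.facetInt e (restr _ p) + M.facetInt e (restr _ q)
  rw [← map_add, facetInt_restr, facetInt_restr, facetInt_restr, map_add]

theorem facetInt_smul (e : M.Facet) (c : ℝ) (F : M.facetSet e → ℝ) :
    M.facetInt e (c • F) = c * M.facetInt e F := integral_const_mul _ _

theorem cellI_sq_eq_zero {K : M.Cell} {p : MvPolynomial (Fin d) ℝ} (h : M.cellI K (p * p) = 0) :
    ∀ x ∈ M.cellSet K, pval p x = 0 := by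
  refine eqOn_zero_of_integral_sq volume (convex_convexHull ℝ _) (M.isCompact_cellSet K)
    (M.interior_cellSet_nonempty K) (continuous_pval p) ?_
  rw [← h, cellI_apply]
  simp only [pval_mul, pow_two]
  rfl

theorem facetI_sq_eq_zero {e : M.Facet} {p : MvPolynomial (Fin d) ℝ}
    (h : M.facetI e (p * p) = 0) : ∀ x ∈ M.facetSet e, pval p x = 0 := by
  classical
  obtain ⟨K, a, o, hao, rfl⟩ := M.exists_eq_opp e
  rw [facetSet_opp]
  refine eq_zero_of_integral_facet_sq (M.splits K hao) finrank_pt (continuous_pval p) ?_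
  rw [← facetSet_opp, ← h, facetI_apply]
  simp only [pval_mul, pow_two]

theorem cellI_sq_nonneg (K : M.Cell) (p : MvPolynomial (Fin d) ℝ) : 0 ≤ M.cellI K (p * p) := by
  rw [cellI_apply]
  simp only [pval_mul]
  exact integral_nonneg fun x => mul_self_nonneg _

/-- The interior of the element contains a product of intervals, and a polynomial vanishing on a
product of infinite sets is zero. -/
theorem poly_eq_zero {K : M.Cell} {p : MvPolynomial (Fin d) ℝ}
    (h : ∀ x ∈ M.cellSet K, pval p x = 0) : p = 0 := by
  obtain ⟨x, hx⟩ := M.interior_cellSet_nonempty K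
  have hc : Continuous fun y : Fin d → ℝ => (WithLp.toLp 2 y : Pt d) := by fun_prop
  have ho : IsOpen ((fun y : Fin d → ℝ => (WithLp.toLp 2 y : Pt d)) ⁻¹' interior (M.cellSet K)) :=
    isOpen_interior.preimage hc
  obtain ⟨r, hr, hball⟩ := Metric.isOpen_iff.1 ho x.ofLp hx
  refine MvPolynomial.funext_set (fun i => Metric.ball (x i) r) (fun i => ?_) fun y hy => ?_
  · rw [Real.ball_eq_Ioo]
    exact Set.Ioo_infinite (by linarith)
  · rw [← ball_pi _ hr] at hy
    have := h _ (interior_subset (hball hy))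
    simpa [pval] using this

end Mesh

/-- Definiteness makes `β` injective into the dual, hence surjective by dimension. This is the
existence argument for the weak gradient, the weak divergence and the facet projection. -/
theorem exists_riesz {T : Type*} [AddCommGroup T] [Module ℝ T] [FiniteDimensional ℝ T]
    (β : T →ₗ[ℝ] T →ₗ[ℝ] ℝ) (hβ : ∀ t, β t t = 0 → t = 0) (φ : T →ₗ[ℝ] ℝ) :
    ∃ g, ∀ t, β g t = φ t := by
  have hinj : Function.Injective (β : T →ₗ[ℝ] Module.Dual ℝ T) := by
    rw [injective_iff_map_eq_zero]
    exact fun v hv => hβ v (by rw [hv]; rfl)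
  obtain ⟨w, hw⟩ := ((LinearMap.injective_iff_surjective_of_finrank_eq_finrank
    (Subspace.dual_finrank_eq (K := ℝ) (V := T)).symm).1 hinj) φ
  exact ⟨w, fun t => by rw [hw]⟩

/-! ### The discrete weak gradient. -/

section Operators

variable {d : ℕ} (M : Mesh d)

/-- Weak functions with polynomial entries. -/
noncomputable def polyWeak : Submodule ℝ (Scal M) where
  carrier := {v | (∀ K, v.1 K ∈ polyFun (M.cellSet K)) ∧ ∀ e, v.2 e ∈ polyFun (M.facetSet e)}
  add_mem' := fun h g => ⟨fun K => add_mem (h.1 K) (g.1 K), fun e => add_mem (h.2 e) (g.2 e)⟩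
  zero_mem' := ⟨fun _ => zero_mem _, fun _ => zero_mem _⟩
  smul_mem' := fun c _ h => ⟨fun K => (polyFun _).smul_mem (h.1 K) c,
    fun e => (polyFun _).smul_mem (h.2 e) c⟩

variable {M}

theorem polyWeak_mul {v w : Scal M} (hv : v ∈ polyWeak M) (hw : w ∈ polyWeak M) :
    v * w ∈ polyWeak M :=
  ⟨fun K => mul_mem (hv.1 K) (hw.1 K), fun e => mul_mem (hv.2 e) (hw.2 e)⟩

theorem polyWeak_of_wgSpace {C : Finset M.Cell} {Z : Set M.Facet} {j l : ℕ} {v : Scal M}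
    (hv : v ∈ wgSpace M C Z j l) : v ∈ polyWeak M := by
  refine ⟨fun K => ?_, fun e => polyFun_of_polyOn (hv.2.2.1 e)⟩
  by_cases hK : K ∈ C
  · exact polyFun_of_polyOn (hv.1 K hK)
  · rw [hv.2.1 K hK]
    exact zero_mem _

theorem exists_poly {K : M.Cell} {v : Scal M} (hv : v ∈ polyWeak M) :
    ∃ (p : MvPolynomial (Fin d) ℝ) (q : M.FacetOf K → MvPolynomial (Fin d) ℝ),
      v.1 K = restr _ p ∧ ∀ e : M.FacetOf K, v.2 e.1 = restr _ (q e) := by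
  obtain ⟨p, hp⟩ := hv.1 K
  choose q hq using fun e : M.FacetOf K => hv.2 e.1
  exact ⟨p, q, hp.symm, fun e => (hq e).symm⟩

variable [NeZero d]

/-- For polynomial data the defining equations become identities between the linear functionals
`cellI` and `facetI`, so later arguments need no integrability conditions. -/
theorem isWeakGrad_iff {r : ℕ} {K : M.Cell} {v : Scal M} {p : MvPolynomial (Fin d) ℝ}
    {q : M.FacetOf K → MvPolynomial (Fin d) ℝ} (hp : v.1 K = restr _ p)
    (hq : ∀ e : M.FacetOf K, v.2 e.1 = restr _ (q e))
    {g : Fin d → MvPolynomial (Fin d) ℝ} (hg : ∀ i, (g i).totalDegree ≤ r) :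
    IsWeakGrad M r K v (fun i => restr _ (g i)) ↔
      ∀ t : Fin d → MvPolynomial (Fin d) ℝ, (∀ i, (t i).totalDegree ≤ r) →
        M.cellI K (∑ i, g i * t i) = - M.cellI K (p * ∑ i, MvPolynomial.pderiv i (t i)) +
          ∑ e : M.FacetOf K, M.facetI e.1 (q e * ∑ i, t i * MvPolynomial.C (M.normal K e i)) := by
  have h1 (t : Fin d → MvPolynomial (Fin d) ℝ) :
      M.cellInt K (fun x => ∑ i, restr _ (g i) x * pval (t i) x) = M.cellI K (∑ i, g i * t i) := by
    rw [← M.cellInt_restr]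
    congr 1
    funext x
    simp only [restr_apply, pval_sum, pval_mul]
  have h2 (t : Fin d → MvPolynomial (Fin d) ℝ) :
      M.cellInt K (fun x => v.1 K x * ∑ i, pval (MvPolynomial.pderiv i (t i)) x) =
        M.cellI K (p * ∑ i, MvPolynomial.pderiv i (t i)) := by
    rw [← M.cellInt_restr, hp]
    congr 1
    funext x
    simp only [restr_apply, pval_sum, pval_mul]
  have h3 (t : Fin d → MvPolynomial (Fin d) ℝ) (e : M.FacetOf K) :
      M.facetInt e.1 (fun x => v.2 e.1 x * ∑ i, pval (t i) x * M.normal K e i) =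
        M.facetI e.1 (q e * ∑ i, t i * MvPolynomial.C (M.normal K e i)) := by
    rw [← M.facetInt_restr, hq]
    congr 1
    funext x
    simp only [restr_apply, pval_sum, pval_mul, pval_C]
  unfold IsWeakGrad
  simp only [h1, h2, h3]
  exact and_iff_right fun i => mem_polyOn.2 ⟨g i, hg i, rfl⟩

theorem IsWeakGrad.exists_poly {r : ℕ} {K : M.Cell} {v : Scal M} {G : Fin d → M.cellSet K → ℝ}
    (h : IsWeakGrad M r K v G) : ∃ g : Fin d → MvPolynomial (Fin d) ℝ,
      (∀ i, (g i).totalDegree ≤ r) ∧ G = fun i => restr _ (g i) := by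
  choose g hg hG using fun i => mem_polyOn.1 (h.1 i)
  exact ⟨g, hg, funext fun i => (hG i).symm⟩

theorem cellI_sum_sq_eq_zero {K : M.Cell} {t : Fin d → MvPolynomial (Fin d) ℝ}
    (h : M.cellI K (∑ i, t i * t i) = 0) : t = 0 := by
  rw [map_sum, Finset.sum_eq_zero_iff_of_nonneg fun i _ => M.cellI_sq_nonneg K _] at h
  funext i
  exact M.poly_eq_zero (M.cellI_sq_eq_zero (h i (Finset.mem_univ i)))

/-- Polynomial vector fields of degree at most `r`. -/
abbrev TestFields (d r : ℕ) := Fin d → MvPolynomial.restrictTotalDegree (Fin d) ℝ r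

theorem exists_isWeakGrad (r : ℕ) (K : M.Cell) {v : Scal M} (hv : v ∈ polyWeak M) :
    ∃ G, IsWeakGrad M r K v G := by
  obtain ⟨p, q, hp, hq⟩ := WG.exists_poly (K := K) hv
  let β : TestFields d r →ₗ[ℝ] TestFields d r →ₗ[ℝ] ℝ := LinearMap.mk₂ ℝ (fun s t => M.cellI K (∑ i, (s i).1 * (t i).1))
    (fun s s' t => by simp [add_mul, Finset.sum_add_distrib])
    (fun c s t => by simp [Finset.mul_sum])
    (fun s s' t => by simp [mul_add, Finset.sum_add_distrib])
    (fun c s t => by simp [Finset.mul_sum])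
  let φ : TestFields d r →ₗ[ℝ] ℝ :=
    { toFun := fun t => - M.cellI K (p * ∑ i, MvPolynomial.pderiv i (t i).1) +
          ∑ e : M.FacetOf K, M.facetI e.1 (q e * ∑ i, (t i).1 * MvPolynomial.C (M.normal K e i))
      map_add' := fun s t => by
        simp only [Pi.add_apply, Submodule.coe_add, map_add, Finset.sum_add_distrib, mul_add,
          add_mul]
        ring
      map_smul' := fun c t => by
        simp only [Pi.smul_apply, Submodule.coe_smul, Derivation.map_smul, map_smul, ← Finset.smul_sum, smul_mul_assoc,
          mul_smul_comm, smul_eq_mul, RingHom.id_apply, ← Finset.mul_sum]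
        ring }
  obtain ⟨g, hg⟩ := exists_riesz β (fun t ht => by
    have := cellI_sum_sq_eq_zero (t := fun i => (t i).1) ht
    funext i
    exact Subtype.ext (congrFun this i)) φ
  refine ⟨_, (isWeakGrad_iff hp hq (g := fun i => (g i).1) fun i =>
    (MvPolynomial.mem_restrictTotalDegree _ _ _).1 (g i).2).2 fun t ht => ?_⟩
  exact hg fun i => ⟨t i, (MvPolynomial.mem_restrictTotalDegree _ _ _).2 (ht i)⟩

/-- Testing both equations with the difference of the candidates gives it zero `L²` norm. With
existence, this turns the choice in `wgrad` into a well-defined operator that is linear on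
polynomial weak functions. -/
theorem IsWeakGrad.unique {r : ℕ} {K : M.Cell} {v : Scal M} {G H : Fin d → M.cellSet K → ℝ}
    (hv : v ∈ polyWeak M) (hG : IsWeakGrad M r K v G) (hH : IsWeakGrad M r K v H) : G = H := by
  obtain ⟨p, q, hp, hq⟩ := WG.exists_poly (K := K) hv
  obtain ⟨g, hg, rfl⟩ := hG.exists_poly
  obtain ⟨h, hh, rfl⟩ := hH.exists_poly
  rw [isWeakGrad_iff hp hq hg] at hG
  rw [isWeakGrad_iff hp hq hh] at hH
  have hd : ∀ i, (g i - h i).totalDegree ≤ r := fun i =>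
    (MvPolynomial.totalDegree_sub _ _).trans (max_le (hg i) (hh i))
  have h1 := (hG (fun i => g i - h i) hd).trans (hH (fun i => g i - h i) hd).symm
  have h2 : (fun i => g i - h i) = 0 := by
    refine cellI_sum_sq_eq_zero (K := K) ?_
    simp only [sub_mul, Finset.sum_sub_distrib, map_sub]
    rw [h1, sub_self]
  have h3 : g = h := funext fun i => sub_eq_zero.1 (congrFun h2 i)
  rw [h3]

theorem isWeakGrad_wgrad (r : ℕ) (K : M.Cell) {v : Scal M} (hv : v ∈ polyWeak M) :
    IsWeakGrad M r K v (wgrad M r K v) :=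
  Classical.epsilon_spec (exists_isWeakGrad r K hv)

theorem IsWeakGrad.eq_wgrad {r : ℕ} {K : M.Cell} {v : Scal M} {G : Fin d → M.cellSet K → ℝ}
    (hv : v ∈ polyWeak M) (hG : IsWeakGrad M r K v G) : wgrad M r K v = G :=
  (isWeakGrad_wgrad r K hv).unique hv hG

theorem wgrad_mem (r : ℕ) (K : M.Cell) {v : Scal M} (hv : v ∈ polyWeak M) (i : Fin d) :
    wgrad M r K v i ∈ polyOn (M.cellSet K) r := (isWeakGrad_wgrad r K hv).1 i

theorem wgrad_add (r : ℕ) (K : M.Cell) {v w : Scal M} (hv : v ∈ polyWeak M)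
    (hw : w ∈ polyWeak M) : wgrad M r K (v + w) = wgrad M r K v + wgrad M r K w := by
  have hG := isWeakGrad_wgrad r K hv
  have hH := isWeakGrad_wgrad r K hw
  refine IsWeakGrad.eq_wgrad (add_mem hv hw) ?_
  obtain ⟨p, q, hp, hq⟩ := WG.exists_poly (K := K) hv
  obtain ⟨p', q', hp', hq'⟩ := WG.exists_poly (K := K) hw
  obtain ⟨g, hg, hge⟩ := hG.exists_poly
  obtain ⟨h, hh, hhe⟩ := hH.exists_poly
  rw [hge] at hG ⊢
  rw [hhe] at hH ⊢
  rw [isWeakGrad_iff hp hq hg] at hG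
  rw [isWeakGrad_iff hp' hq' hh] at hH
  have e : ((fun i => restr (M.cellSet K) (g i)) + fun i => restr (M.cellSet K) (h i)) =
      fun i => restr _ (g i + h i) := funext fun i => (map_add _ _ _).symm
  rw [e, isWeakGrad_iff (p := p + p') (q := fun e => q e + q' e)]
  · intro t ht
    have h1 := hG t ht
    have h2 := hH t ht
    simp only [add_mul, Finset.sum_add_distrib, map_add]
    rw [h1, h2]
    ring
  · simp [hp, hp']
  · intro e
    simp [hq, hq']
  · exact fun i => (MvPolynomial.totalDegree_add _ _).trans (max_le (hg i) (hh i))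

theorem wgrad_smul (r : ℕ) (K : M.Cell) (c : ℝ) {v : Scal M} (hv : v ∈ polyWeak M) :
    wgrad M r K (c • v) = c • wgrad M r K v := by
  have hG := isWeakGrad_wgrad r K hv
  refine IsWeakGrad.eq_wgrad ((polyWeak M).smul_mem c hv) ?_
  obtain ⟨p, q, hp, hq⟩ := WG.exists_poly (K := K) hv
  obtain ⟨g, hg, hge⟩ := hG.exists_poly
  rw [hge] at hG ⊢
  rw [isWeakGrad_iff hp hq hg] at hG
  have e : c • (fun i => restr (M.cellSet K) (g i) : Fin d → M.cellSet K → ℝ) =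
      fun i => restr _ (c • g i) := funext fun i => (map_smul (restr (M.cellSet K)) c (g i)).symm
  rw [e, isWeakGrad_iff (p := c • p) (q := fun e => c • q e)]
  · intro t ht
    have h1 := hG t ht
    simp only [smul_mul_assoc, ← Finset.smul_sum, map_smul]
    rw [h1]
    simp only [smul_eq_mul, ← Finset.mul_sum]
    ring
  · simp [hp]
  · intro e
    simp [hq]
  · exact fun i => (MvPolynomial.totalDegree_smul_le _ _).trans (hg i)

end Operators

/-! ### The weak divergence, the facet projection and the energy form. -/

section Operators

variable {d : ℕ} {M : Mesh d} [NeZero d]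

theorem exists_poly_vect {K : M.Cell} {w : Vect M} (hw : ∀ i, w i ∈ polyWeak M) :
    ∃ (p : Fin d → MvPolynomial (Fin d) ℝ) (q : M.FacetOf K → Fin d → MvPolynomial (Fin d) ℝ),
      (∀ i, (w i).1 K = restr _ (p i)) ∧ ∀ (e : M.FacetOf K) i, (w i).2 e.1 = restr _ (q e i) := by
  choose p q hp hq using fun i => exists_poly (K := K) (hw i)
  exact ⟨p, fun e i => q i e, hp, fun e i => hq i e⟩

theorem isWeakDiv_iff {r : ℕ} {K : M.Cell} {w : Vect M} {p : Fin d → MvPolynomial (Fin d) ℝ}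
    {q : M.FacetOf K → Fin d → MvPolynomial (Fin d) ℝ} (hp : ∀ i, (w i).1 K = restr _ (p i))
    (hq : ∀ (e : M.FacetOf K) i, (w i).2 e.1 = restr _ (q e i))
    {g : MvPolynomial (Fin d) ℝ} (hg : g.totalDegree ≤ r) :
    IsWeakDiv M r K w (restr _ g) ↔
      ∀ t : MvPolynomial (Fin d) ℝ, t.totalDegree ≤ r →
        M.cellI K (g * t) = - M.cellI K (∑ i, p i * MvPolynomial.pderiv i t) +
          ∑ e : M.FacetOf K,
            M.facetI e.1 ((∑ i, q e i * MvPolynomial.C (M.normal K e i)) * t) := by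
  have h1 (t : MvPolynomial (Fin d) ℝ) :
      M.cellInt K (fun x => restr _ g x * pval t x) = M.cellI K (g * t) := by
    rw [← M.cellInt_restr]
    congr 1
    funext x
    simp only [restr_apply, pval_mul]
  have h2 (t : MvPolynomial (Fin d) ℝ) :
      M.cellInt K (fun x => ∑ i, (w i).1 K x * pval (MvPolynomial.pderiv i t) x) =
        M.cellI K (∑ i, p i * MvPolynomial.pderiv i t) := by
    rw [← M.cellInt_restr]
    congr 1
    funext x
    simp only [hp, restr_apply, pval_sum, pval_mul]
  have h3 (t : MvPolynomial (Fin d) ℝ) (e : M.FacetOf K) :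
      M.facetInt e.1 (fun x => (∑ i, (w i).2 e.1 x * M.normal K e i) * pval t x) =
        M.facetI e.1 ((∑ i, q e i * MvPolynomial.C (M.normal K e i)) * t) := by
    rw [← M.facetInt_restr]
    congr 1
    funext x
    simp only [hq, restr_apply, pval_sum, pval_mul, pval_C]
  unfold IsWeakDiv
  simp only [h1, h2, h3]
  exact and_iff_right (mem_polyOn.2 ⟨g, hg, rfl⟩)

theorem exists_isWeakDiv (r : ℕ) (K : M.Cell) {w : Vect M} (hw : ∀ i, w i ∈ polyWeak M) :
    ∃ D, IsWeakDiv M r K w D := by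
  obtain ⟨p, q, hp, hq⟩ := exists_poly_vect (K := K) hw
  let β : MvPolynomial.restrictTotalDegree (Fin d) ℝ r →ₗ[ℝ]
      MvPolynomial.restrictTotalDegree (Fin d) ℝ r →ₗ[ℝ] ℝ :=
    LinearMap.mk₂ ℝ (fun s t => M.cellI K (s.1 * t.1))
    (fun s s' t => by simp [add_mul]) (fun c s t => by simp)
    (fun s s' t => by simp [mul_add]) (fun c s t => by simp)
  let φ : MvPolynomial.restrictTotalDegree (Fin d) ℝ r →ₗ[ℝ] ℝ :=
    { toFun := fun t => - M.cellI K (∑ i, p i * MvPolynomial.pderiv i t.1) +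
          ∑ e : M.FacetOf K,
            M.facetI e.1 ((∑ i, q e i * MvPolynomial.C (M.normal K e i)) * t.1)
      map_add' := fun s t => by
        simp only [Submodule.coe_add, map_add, Finset.sum_add_distrib, mul_add]
        ring
      map_smul' := fun c t => by
        simp only [Submodule.coe_smul, Derivation.map_smul, map_smul, ← Finset.smul_sum,
          mul_smul_comm, smul_eq_mul, RingHom.id_apply, ← Finset.mul_sum]
        ring }
  obtain ⟨g, hg⟩ := exists_riesz β (fun t ht =>
    Subtype.ext (M.poly_eq_zero (M.cellI_sq_eq_zero ht))) φ
  refine ⟨_, (isWeakDiv_iff hp hq (g := g.1)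
    ((MvPolynomial.mem_restrictTotalDegree _ _ _).1 g.2)).2 fun t ht => ?_⟩
  exact hg ⟨t, (MvPolynomial.mem_restrictTotalDegree _ _ _).2 ht⟩

theorem IsWeakDiv.unique {r : ℕ} {K : M.Cell} {w : Vect M} {G H : M.cellSet K → ℝ}
    (hw : ∀ i, w i ∈ polyWeak M) (hG : IsWeakDiv M r K w G) (hH : IsWeakDiv M r K w H) : G = H := by
  obtain ⟨p, q, hp, hq⟩ := exists_poly_vect (K := K) hw
  obtain ⟨g, hg, rfl⟩ := mem_polyOn.1 hG.1
  obtain ⟨h, hh, rfl⟩ := mem_polyOn.1 hH.1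
  rw [isWeakDiv_iff hp hq hg] at hG
  rw [isWeakDiv_iff hp hq hh] at hH
  have hd : (g - h).totalDegree ≤ r := (MvPolynomial.totalDegree_sub _ _).trans (max_le hg hh)
  have h1 := (hG (g - h) hd).trans (hH (g - h) hd).symm
  have h2 : g - h = 0 := by
    refine M.poly_eq_zero (K := K) (M.cellI_sq_eq_zero ?_)
    simp only [sub_mul (a := g), map_sub]
    rw [h1, sub_self]
  rw [sub_eq_zero.1 h2]

theorem isWeakDiv_wdiv (r : ℕ) (K : M.Cell) {w : Vect M} (hw : ∀ i, w i ∈ polyWeak M) :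
    IsWeakDiv M r K w (wdiv M r K w) :=
  Classical.epsilon_spec (exists_isWeakDiv r K hw)

theorem wdiv_mem (r : ℕ) (K : M.Cell) {w : Vect M} (hw : ∀ i, w i ∈ polyWeak M) :
    wdiv M r K w ∈ polyFun (M.cellSet K) := polyFun_of_polyOn (isWeakDiv_wdiv r K hw).1

theorem wdiv_add (r : ℕ) (K : M.Cell) {v w : Vect M} (hv : ∀ i, v i ∈ polyWeak M)
    (hw : ∀ i, w i ∈ polyWeak M) : wdiv M r K (v + w) = wdiv M r K v + wdiv M r K w := by
  have hG := isWeakDiv_wdiv r K hv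
  have hH := isWeakDiv_wdiv r K hw
  have hvw : ∀ i, (v + w) i ∈ polyWeak M := fun i => add_mem (hv i) (hw i)
  refine (isWeakDiv_wdiv r K hvw).unique hvw ?_
  obtain ⟨p, q, hp, hq⟩ := exists_poly_vect (K := K) hv
  obtain ⟨p', q', hp', hq'⟩ := exists_poly_vect (K := K) hw
  obtain ⟨g, hg, hge⟩ := mem_polyOn.1 hG.1
  obtain ⟨h, hh, hhe⟩ := mem_polyOn.1 hH.1
  rw [← hge] at hG ⊢
  rw [← hhe] at hH ⊢
  rw [isWeakDiv_iff hp hq hg] at hG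
  rw [isWeakDiv_iff hp' hq' hh] at hH
  rw [← map_add, isWeakDiv_iff (p := p + p') (q := fun e => q e + q' e)]
  · intro t ht
    have h1 := hG t ht
    have h2 := hH t ht
    simp only [Pi.add_apply, add_mul, Finset.sum_add_distrib, map_add]
    rw [h1, h2]
    ring
  · intro i
    simp [hp, hp']
  · intro e i
    simp [hq, hq']
  · exact (MvPolynomial.totalDegree_add _ _).trans (max_le hg hh)

theorem wdiv_smul (r : ℕ) (K : M.Cell) (c : ℝ) {w : Vect M} (hw : ∀ i, w i ∈ polyWeak M) :
    wdiv M r K (c • w) = c • wdiv M r K w := by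
  have hG := isWeakDiv_wdiv r K hw
  have hcw : ∀ i, (c • w) i ∈ polyWeak M := fun i => (polyWeak M).smul_mem c (hw i)
  refine (isWeakDiv_wdiv r K hcw).unique hcw ?_
  obtain ⟨p, q, hp, hq⟩ := exists_poly_vect (K := K) hw
  obtain ⟨g, hg, hge⟩ := mem_polyOn.1 hG.1
  rw [← hge] at hG ⊢
  rw [isWeakDiv_iff hp hq hg] at hG
  rw [← map_smul, isWeakDiv_iff (p := c • p) (q := fun e => c • q e)]
  · intro t ht
    have h1 := hG t ht
    simp only [Pi.smul_apply, smul_mul_assoc, ← Finset.smul_sum, map_smul]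
    rw [h1]
    simp only [smul_eq_mul, ← Finset.mul_sum]
    ring
  · intro i
    simp [hp]
  · intro e i
    simp [hq]
  · exact (MvPolynomial.totalDegree_smul_le _ _).trans hg

/-- The Riesz argument runs on functions on the facet instead of polynomials, because distinct
polynomials can agree on a facet and the form would not be definite. -/
theorem exists_isProj (j : ℕ) (e : M.Facet) {v : M.facetSet e → ℝ} (hv : v ∈ polyFun _) :
    ∃ q, IsProj M j e v q := by
  have hp (s : polyOn (M.facetSet e) j) : s.1 ∈ polyFun (M.facetSet e) := polyFun_of_polyOn s.2
  let β : polyOn (M.facetSet e) j →ₗ[ℝ] polyOn (M.facetSet e) j →ₗ[ℝ] ℝ :=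
    LinearMap.mk₂ ℝ (fun s t => M.facetInt e (s.1 * t.1))
    (fun s s' t => by
      rw [Submodule.coe_add, add_mul, M.facetInt_add (mul_mem (hp s) (hp t))
        (mul_mem (hp s') (hp t))])
    (fun c s t => by rw [Submodule.coe_smul, smul_mul_assoc, M.facetInt_smul, smul_eq_mul])
    (fun s t t' => by
      rw [Submodule.coe_add, mul_add, M.facetInt_add (mul_mem (hp s) (hp t))
        (mul_mem (hp s) (hp t'))])
    (fun c s t => by rw [Submodule.coe_smul, mul_smul_comm, M.facetInt_smul, smul_eq_mul])
  let φ : polyOn (M.facetSet e) j →ₗ[ℝ] ℝ :=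
    { toFun := fun t => M.facetInt e (v * t.1)
      map_add' := fun t t' => by
        rw [Submodule.coe_add, mul_add, M.facetInt_add (mul_mem hv (hp t)) (mul_mem hv (hp t'))]
      map_smul' := fun c t => by
        rw [Submodule.coe_smul, mul_smul_comm, M.facetInt_smul, RingHom.id_apply, smul_eq_mul] }
  obtain ⟨g, hg⟩ := exists_riesz β (fun t ht => by
    obtain ⟨p, hp⟩ := hp t
    have hp : restr _ p = t.1 := hp
    have ht : M.facetInt e (t.1 * t.1) = 0 := ht
    rw [← hp, ← map_mul, M.facetInt_restr] at ht
    refine Subtype.ext (funext fun x => ?_)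
    rw [← hp, restr_apply]
    exact M.facetI_sq_eq_zero ht x x.2) φ
  exact ⟨g.1, g.2, fun t ht => hg ⟨t, ht⟩⟩

theorem facetInt_sq_eq_zero {e : M.Facet} {F : M.facetSet e → ℝ} (hF : F ∈ polyFun _)
    (h : M.facetInt e (F * F) = 0) : F = 0 := by
  obtain ⟨p, hp⟩ := hF
  have hp : restr _ p = F := hp
  rw [← hp, ← map_mul, M.facetInt_restr] at h
  refine funext fun x => ?_
  rw [← hp, restr_apply]
  exact M.facetI_sq_eq_zero h x x.2

theorem facetInt_sub {e : M.Facet} {F G : M.facetSet e → ℝ} (hF : F ∈ polyFun _)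
    (hG : G ∈ polyFun _) : M.facetInt e (F - G) = M.facetInt e F - M.facetInt e G := by
  have h := M.facetInt_add hF ((polyFun _).smul_mem hG (-1))
  rw [M.facetInt_smul, neg_one_smul, ← sub_eq_add_neg] at h
  rw [h]
  ring

theorem IsProj.unique {j : ℕ} {e : M.Facet} {v q q' : M.facetSet e → ℝ}
    (h : IsProj M j e v q) (h' : IsProj M j e v q') : q = q' := by
  have hq := polyFun_of_polyOn h.1
  have hq' := polyFun_of_polyOn h'.1
  have hs : q - q' ∈ polyOn (M.facetSet e) j := sub_mem h.1 h'.1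
  have h1 : M.facetInt e (q * (q - q')) = M.facetInt e (q' * (q - q')) :=
    (h.2 _ hs).trans (h'.2 _ hs).symm
  have h2 : q - q' = 0 := by
    refine facetInt_sq_eq_zero (sub_mem hq hq') ?_
    rw [sub_mul (a := q), facetInt_sub (mul_mem hq (sub_mem hq hq')) (mul_mem hq' (sub_mem hq hq')),
      h1, sub_self]
  exact sub_eq_zero.1 h2

theorem isProj_Qb (j : ℕ) (e : M.Facet) {v : M.facetSet e → ℝ} (hv : v ∈ polyFun _) :
    IsProj M j e v (Qb M j e v) := Classical.epsilon_spec (exists_isProj j e hv)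

theorem Qb_add (j : ℕ) (e : M.Facet) {v w : M.facetSet e → ℝ} (hv : v ∈ polyFun _)
    (hw : w ∈ polyFun _) : Qb M j e (v + w) = Qb M j e v + Qb M j e w := by
  have h1 := isProj_Qb j e hv
  have h2 := isProj_Qb j e hw
  refine (isProj_Qb j e (add_mem hv hw)).unique ⟨add_mem h1.1 h2.1, fun t ht => ?_⟩
  have e1 := h1.2 t ht
  have e2 := h2.2 t ht
  have p1 := polyFun_of_polyOn h1.1
  have p2 := polyFun_of_polyOn h2.1
  have pt := polyFun_of_polyOn ht
  have a1 := M.facetInt_add (mul_mem p1 pt) (mul_mem p2 pt)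
  have a2 := M.facetInt_add (mul_mem hv pt) (mul_mem hw pt)
  rw [← add_mul] at a1 a2
  exact a1.trans ((congrArg₂ (· + ·) e1 e2).trans a2.symm)

theorem Qb_smul (j : ℕ) (e : M.Facet) (c : ℝ) {v : M.facetSet e → ℝ} (hv : v ∈ polyFun _) :
    Qb M j e (c • v) = c • Qb M j e v := by
  have h1 := isProj_Qb j e hv
  refine (isProj_Qb j e ((polyFun _).smul_mem hv c)).unique
    ⟨Submodule.smul_mem _ c h1.1, fun t ht => ?_⟩
  have e1 := h1.2 t ht
  have a1 := M.facetInt_smul e c (Qb M j e v * t)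
  have a2 := M.facetInt_smul e c (v * t)
  rw [← smul_mul_assoc] at a1 a2
  exact a1.trans ((congrArg (c * ·) e1).trans a2.symm)

theorem trace_mem {K : M.Cell} {e : M.FacetOf K} {F : M.cellSet K → ℝ} (hF : F ∈ polyFun _) :
    M.trace K e F ∈ polyFun (M.facetSet e.1) := by
  obtain ⟨p, hp⟩ := hF
  have hp : restr _ p = F := hp
  refine ⟨p, funext fun x => ?_⟩
  change restr _ p x = F _
  rw [← hp, restr_apply, restr_apply]

/-- The jump `Q_l^b v_0 - v_b` on the edge (face) `e` of `K`. -/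
noncomputable def jump (l : ℕ) (K : M.Cell) (e : M.FacetOf K) (v : Scal M) : M.facetSet e.1 → ℝ :=
  Qb M l e.1 (M.trace K e (v.1 K)) - v.2 e.1

theorem jump_mem (l : ℕ) (K : M.Cell) (e : M.FacetOf K) {v : Scal M} (hv : v ∈ polyWeak M) :
    jump l K e v ∈ polyFun (M.facetSet e.1) :=
  sub_mem (polyFun_of_polyOn (isProj_Qb l e.1 (trace_mem (hv.1 K))).1) (hv.2 e.1)

theorem jump_add (l : ℕ) (K : M.Cell) (e : M.FacetOf K) {v w : Scal M} (hv : v ∈ polyWeak M)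
    (hw : w ∈ polyWeak M) : jump l K e (v + w) = jump l K e v + jump l K e w := by
  have h := Qb_add l e.1 (trace_mem (e := e) (hv.1 K)) (trace_mem (hw.1 K))
  have e1 : M.trace K e ((v + w).1 K) = M.trace K e (v.1 K) + M.trace K e (w.1 K) := rfl
  simp only [jump, e1, h, Prod.snd_add, Pi.add_apply]
  abel

theorem jump_smul (l : ℕ) (K : M.Cell) (e : M.FacetOf K) (c : ℝ) {v : Scal M}
    (hv : v ∈ polyWeak M) : jump l K e (c • v) = c • jump l K e v := by
  have h := Qb_smul l e.1 c (trace_mem (e := e) (hv.1 K))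
  have e1 : M.trace K e ((c • v).1 K) = c • M.trace K e (v.1 K) := rfl
  simp only [jump, e1, h, smul_sub]
  rfl

/-- The `L²(K)` inner product of vector fields. -/
noncomputable def dotInt (K : M.Cell) (G H : Fin d → M.cellSet K → ℝ) : ℝ :=
  M.cellInt K (fun x => ∑ i, G i x * H i x)

theorem dotInt_comm (K : M.Cell) (G H : Fin d → M.cellSet K → ℝ) :
    dotInt K G H = dotInt K H G := by simp only [dotInt, mul_comm]

theorem dotInt_add_left {K : M.Cell} {G G' H : Fin d → M.cellSet K → ℝ}
    (hG : ∀ i, G i ∈ polyFun (M.cellSet K)) (hG' : ∀ i, G' i ∈ polyFun (M.cellSet K))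
    (hH : ∀ i, H i ∈ polyFun (M.cellSet K)) :
    dotInt K (G + G') H = dotInt K G H + dotInt K G' H := by
  have h := M.cellInt_add (F := ∑ i, G i * H i) (G := ∑ i, G' i * H i)
    (sum_mem fun i _ => mul_mem (hG i) (hH i)) (sum_mem fun i _ => mul_mem (hG' i) (hH i))
  have e (G : Fin d → M.cellSet K → ℝ) : dotInt K G H = M.cellInt K (∑ i, G i * H i) := by
    unfold dotInt
    congr 1
    funext x
    simp
  rw [e, e, e, ← h, ← Finset.sum_add_distrib]
  simp only [Pi.add_apply, add_mul]

theorem dotInt_smul_left (K : M.Cell) (c : ℝ) (G H : Fin d → M.cellSet K → ℝ) :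
    dotInt K (c • G) H = c * dotInt K G H := by
  rw [dotInt, dotInt, ← M.cellInt_smul]
  congr 1
  funext x
  simp [Finset.mul_sum, mul_assoc]

theorem dotInt_add_right {K : M.Cell} {G H H' : Fin d → M.cellSet K → ℝ}
    (hG : ∀ i, G i ∈ polyFun (M.cellSet K)) (hH : ∀ i, H i ∈ polyFun (M.cellSet K))
    (hH' : ∀ i, H' i ∈ polyFun (M.cellSet K)) :
    dotInt K G (H + H') = dotInt K G H + dotInt K G H' := by
  rw [dotInt_comm, dotInt_add_left hH hH' hG, dotInt_comm K H, dotInt_comm K H']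

theorem dotInt_smul_right (K : M.Cell) (c : ℝ) (G H : Fin d → M.cellSet K → ℝ) :
    dotInt K G (c • H) = c * dotInt K G H := by
  rw [dotInt_comm, dotInt_smul_left, dotInt_comm]

theorem dotInt_self_nonneg (K : M.Cell) (G : Fin d → M.cellSet K → ℝ) : 0 ≤ dotInt K G G :=
  integral_nonneg fun _ => Finset.sum_nonneg fun _ _ => mul_self_nonneg _

theorem dotInt_self_eq_zero {K : M.Cell} {G : Fin d → M.cellSet K → ℝ}
    (hG : ∀ i, G i ∈ polyFun (M.cellSet K)) (h : dotInt K G G = 0) : G = 0 := by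
  choose g hg using hG
  have hg : ∀ i, restr _ (g i) = G i := hg
  have e : dotInt K G G = M.cellI K (∑ i, g i * g i) := by
    rw [← M.cellInt_restr, dotInt]
    congr 1
    funext x
    simp only [restr_apply, pval_sum, pval_mul, ← hg]
  rw [e] at h
  have h1 := cellI_sum_sq_eq_zero h
  funext i
  rw [← hg i, h1, Pi.zero_apply, map_zero, Pi.zero_apply]

theorem mulInt_add_left {K : M.Cell} {F F' G : M.cellSet K → ℝ} (hF : F ∈ polyFun _)
    (hF' : F' ∈ polyFun _) (hG : G ∈ polyFun _) :
    M.cellInt K ((F + F') * G) = M.cellInt K (F * G) + M.cellInt K (F' * G) := by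
  rw [add_mul, M.cellInt_add (mul_mem hF hG) (mul_mem hF' hG)]

theorem diffusion_eq (C : Finset M.Cell) (l m : ℕ) (v w : Scal M) :
    diffusion M C l m v w = ∑ K ∈ C, (dotInt K (wgrad M m K v) (wgrad M m K w) +
      ∑ e : M.FacetOf K, (M.hK K)⁻¹ * M.facetInt e.1 (jump l K e v * jump l K e w)) := rfl

theorem diffusion_comm (C : Finset M.Cell) (l m : ℕ) (v w : Scal M) :
    diffusion M C l m v w = diffusion M C l m w v := by
  simp only [diffusion_eq, dotInt_comm _ (wgrad M m _ v), mul_comm (jump l _ _ v)]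

theorem diffusion_add_left (C : Finset M.Cell) (l m : ℕ) {v v' w : Scal M} (hv : v ∈ polyWeak M)
    (hv' : v' ∈ polyWeak M) (hw : w ∈ polyWeak M) :
    diffusion M C l m (v + v') w = diffusion M C l m v w + diffusion M C l m v' w := by
  rw [diffusion_eq, diffusion_eq, diffusion_eq, ← Finset.sum_add_distrib]
  refine Finset.sum_congr rfl fun K _ => ?_
  have hg {v : Scal M} (hv : v ∈ polyWeak M) (i : Fin d) :
    wgrad M m K v i ∈ polyFun (M.cellSet K) := polyFun_of_polyOn (wgrad_mem m K hv i)
  have h2 (e : M.FacetOf K) : M.facetInt e.1 (jump l K e (v + v') * jump l K e w) =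
      M.facetInt e.1 (jump l K e v * jump l K e w) +
        M.facetInt e.1 (jump l K e v' * jump l K e w) := by
    rw [jump_add l K e hv hv', add_mul, M.facetInt_add (mul_mem (jump_mem l K e hv)
      (jump_mem l K e hw)) (mul_mem (jump_mem l K e hv') (jump_mem l K e hw))]
  simp only [wgrad_add m K hv hv', dotInt_add_left (hg hv) (hg hv') (hg hw), h2, mul_add,
    Finset.sum_add_distrib]
  ring

theorem diffusion_smul_left (C : Finset M.Cell) (l m : ℕ) (c : ℝ) {v : Scal M} (w : Scal M)
    (hv : v ∈ polyWeak M) :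
    diffusion M C l m (c • v) w = c * diffusion M C l m v w := by
  rw [diffusion_eq, diffusion_eq, Finset.mul_sum]
  refine Finset.sum_congr rfl fun K _ => ?_
  have h2 (e : M.FacetOf K) : M.facetInt e.1 (jump l K e (c • v) * jump l K e w) =
      c * M.facetInt e.1 (jump l K e v * jump l K e w) := by
    rw [jump_smul l K e c hv, smul_mul_assoc, M.facetInt_smul]
  simp only [wgrad_smul m K c hv, dotInt_smul_left, h2, mul_add, Finset.mul_sum]
  congr 1
  exact Finset.sum_congr rfl fun e _ => by ring

theorem facetInt_sq_nonneg {e : M.Facet} (F : M.facetSet e → ℝ) : 0 ≤ M.facetInt e (F * F) :=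
  integral_nonneg fun _ => mul_self_nonneg _

theorem diffusion_self_nonneg (C : Finset M.Cell) (l m : ℕ) (v : Scal M) :
    0 ≤ diffusion M C l m v v := by
  rw [diffusion_eq]
  refine Finset.sum_nonneg fun K _ => add_nonneg (dotInt_self_nonneg K _)
    (Finset.sum_nonneg fun e _ => mul_nonneg ?_ (facetInt_sq_nonneg _))
  exact inv_nonneg.2 Metric.diam_nonneg

/-- If the energy of a weak function vanishes, its weak gradients and its jumps vanish. -/
theorem eq_zero_of_diffusion_self (C : Finset M.Cell) (l m : ℕ) {v : Scal M} (hv : v ∈ polyWeak M)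
    (h : diffusion M C l m v v = 0) {K : M.Cell} (hK : K ∈ C) :
    wgrad M m K v = 0 ∧ ∀ e, jump l K e v = 0 := by
  -- The element has two distinct vertices, so its diameter is positive and the jump term is not
  -- trivially zero.
  have hh : 0 < (M.hK K)⁻¹ := by
    refine inv_pos.2 ?_
    obtain ⟨a⟩ : Nonempty {x // x ∈ K.1} := by
      have : 0 < K.1.card := by rw [K.2.2]; omega
      obtain ⟨x, hx⟩ := Finset.card_pos.1 this
      exact ⟨⟨x, hx⟩⟩
    obtain ⟨o, ho⟩ := M.exists_ne_vertex K a
    have h1 : dist o.1 a.1 ≤ M.hK K := Metric.dist_le_diam_of_mem (M.isCompact_cellSet K).isBounded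
      (subset_convexHull ℝ _ o.2) (subset_convexHull ℝ _ a.2)
    exact (dist_pos.2 fun h => ho (Subtype.ext h)).trans_le h1
  have hn (K : M.Cell) (e : M.FacetOf K) :
      0 ≤ (M.hK K)⁻¹ * M.facetInt e.1 (jump l K e v * jump l K e v) :=
    mul_nonneg (inv_nonneg.2 Metric.diam_nonneg) (facetInt_sq_nonneg _)
  rw [diffusion_eq, Finset.sum_eq_zero_iff_of_nonneg fun K _ => add_nonneg (dotInt_self_nonneg K _)
    (Finset.sum_nonneg fun e _ => hn K e)] at h
  have h1 := (add_eq_zero_iff_of_nonneg (dotInt_self_nonneg K _)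
    (Finset.sum_nonneg fun e _ => hn K e)).1 (h K hK)
  refine ⟨dotInt_self_eq_zero (fun i => polyFun_of_polyOn (wgrad_mem m K hv i)) h1.1, fun e => ?_⟩
  have h2 := (Finset.sum_eq_zero_iff_of_nonneg fun e _ => hn K e).1 h1.2 e (Finset.mem_univ e)
  exact facetInt_sq_eq_zero (jump_mem l K e hv) ((mul_eq_zero.1 h2).resolve_left hh.ne')

end Operators

/-! ### Degrees, derivatives and barycentric coordinates as polynomials. -/

section Polynomials

variable {d : ℕ}

theorem totalDegree_pderiv_le (i : Fin d) (p : MvPolynomial (Fin d) ℝ) :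
    (MvPolynomial.pderiv i p).totalDegree ≤ p.totalDegree - 1 := by
  refine Finset.sup_le fun s hs => ?_
  rw [MvPolynomial.mem_support_iff, MvPolynomial.coeff_pderiv] at hs
  have h := MvPolynomial.le_totalDegree (MvPolynomial.mem_support_iff.2 (left_ne_zero_of_mul hs))
  rw [Finsupp.sum_add_index' (by simp) (by simp), Finsupp.sum_single_index rfl] at h
  omega

/-- A coefficient at an exponent `s` with `s i ≠ 0` reappears in the derivative in direction `i`,
multiplied by `s i`, so it must vanish. -/
theorem eq_C_of_pderiv_eq_zero {p : MvPolynomial (Fin d) ℝ}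
    (h : ∀ i, MvPolynomial.pderiv i p = 0) : ∃ c, p = MvPolynomial.C c := by
  refine ⟨p.coeff 0, ?_⟩
  ext s
  rw [MvPolynomial.coeff_C]
  split_ifs with hs
  · rw [hs]
  obtain ⟨i, hi⟩ : ∃ i, s i ≠ 0 := by
    by_contra hcon
    push Not at hcon
    exact hs (Finsupp.ext hcon).symm
  have h1 := MvPolynomial.coeff_pderiv (i := i) p (s - Finsupp.single i 1)
  rw [h i, MvPolynomial.coeff_zero,
    tsub_add_cancel_of_le (Finsupp.single_le_iff.2 (Nat.one_le_iff_ne_zero.2 hi))] at h1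
  have h2 : ((((s - Finsupp.single i 1 : Fin d →₀ ℕ)) i : ℕ) : ℝ) + 1 ≠ 0 := by positivity
  exact (mul_eq_zero.1 h1.symm).resolve_right h2

theorem totalDegree_dirDeriv_le (t : Pt d) (p : MvPolynomial (Fin d) ℝ) :
    (dirDeriv t p).totalDegree ≤ p.totalDegree - 1 :=
  MvPolynomial.totalDegree_finsetSum_le fun i _ => (MvPolynomial.totalDegree_mul _ _).trans <| by
    rw [MvPolynomial.totalDegree_C, zero_add]
    exact totalDegree_pderiv_le i p

/-- A linear functional vanishing on products of coordinates with polynomials of lower degree, and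
on these polynomials, vanishes. -/
theorem eq_zero_of_linear_mul {k : ℕ} (hk : 1 ≤ k) (φ : MvPolynomial (Fin d) ℝ →ₗ[ℝ] ℝ)
    (h0 : ∀ m : MvPolynomial (Fin d) ℝ, m.totalDegree ≤ k - 1 → φ m = 0)
    (h1 : ∀ (i : Fin d) (m : MvPolynomial (Fin d) ℝ), m.totalDegree ≤ k - 1 →
      φ (MvPolynomial.X i * m) = 0) {p : MvPolynomial (Fin d) ℝ} (hp : p.totalDegree ≤ k) :
    φ p = 0 := by
  rw [← MvPolynomial.support_sum_monomial_coeff p, map_sum]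
  refine Finset.sum_eq_zero fun s hs => ?_
  have hd := (MvPolynomial.le_totalDegree hs).trans hp
  by_cases h : ∀ i, s i = 0
  · refine h0 _ ((MvPolynomial.totalDegree_monomial_le _ _).trans ?_)
    have : s = 0 := Finsupp.ext h
    simp [this]
  · push Not at h
    obtain ⟨i, hi⟩ := h
    have hs' := tsub_add_cancel_of_le (Finsupp.single_le_iff.2 (Nat.one_le_iff_ne_zero.2 hi))
    rw [← hs'] at hd
    rw [Finsupp.sum_add_index' (by simp) (by simp), Finsupp.sum_single_index rfl] at hd
    -- A nonconstant monomial is split into one of its variables and a monomial of degree one less.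
    have e : MvPolynomial.monomial s (MvPolynomial.coeff s p) = MvPolynomial.X i *
        MvPolynomial.monomial (s - Finsupp.single i 1) (MvPolynomial.coeff s p) := by
      rw [MvPolynomial.X, MvPolynomial.monomial_mul, one_mul, add_comm, hs']
    rw [e]
    refine h1 _ _ ((MvPolynomial.totalDegree_monomial_le _ _).trans ?_)
    change (s - Finsupp.single i 1).sum (fun _ e => e) ≤ _
    omega

end Polynomials

namespace Mesh

variable {d : ℕ} (M : Mesh d)

/-- The barycentric coordinates of an element as polynomials. -/
noncomputable def bary (K : M.Cell) (a : {x // x ∈ K.1}) : MvPolynomial (Fin d) ℝ :=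
  MvPolynomial.C ((M.cellBasis K).coord a 0) + ∑ i, MvPolynomial.C
    (((M.cellBasis K).coord a).linear (EuclideanSpace.single i 1)) * MvPolynomial.X i

theorem pval_bary (K : M.Cell) (a : {x // x ∈ K.1}) (x : Pt d) :
    pval (M.bary K a) x = (M.cellBasis K).coord a x := by
  have hx : x = ∑ i, x i • EuclideanSpace.single i (1 : ℝ) := by
    ext j
    simp [Pi.single_apply]
  have h1 : (M.cellBasis K).coord a x =
      ((M.cellBasis K).coord a).linear x + (M.cellBasis K).coord a 0 :=
    congrFun ((M.cellBasis K).coord a).decomp x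
  rw [h1, bary, pval_add, pval_C, pval_sum, add_comm]
  congr 1
  conv_rhs => rw [hx, map_sum]
  refine Finset.sum_congr rfl fun i _ => ?_
  rw [pval_mul, pval_C, map_smul, smul_eq_mul, mul_comm]
  simp [pval]

theorem totalDegree_bary_le (K : M.Cell) (a : {x // x ∈ K.1}) : (M.bary K a).totalDegree ≤ 1 := by
  refine (MvPolynomial.totalDegree_add _ _).trans (max_le (by simp) ?_)
  refine MvPolynomial.totalDegree_finsetSum_le fun i _ =>
    (MvPolynomial.totalDegree_mul _ _).trans ?_
  rw [MvPolynomial.totalDegree_C, MvPolynomial.totalDegree_X]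

theorem bary_ne_zero (K : M.Cell) (a : {x // x ∈ K.1}) : M.bary K a ≠ 0 := by
  intro h
  have h1 := M.pval_bary K a a.1
  have h2 := (M.cellBasis K).coord_apply_eq a
  rw [cellBasis_apply] at h2
  rw [h, h2] at h1
  simp [pval] at h1

variable [NeZero d]

/-- The square root of `p` is continuous and its square has zero integral, so `p` vanishes on the
element. -/
theorem eq_zero_of_cellI_nonneg {K : M.Cell} {p : MvPolynomial (Fin d) ℝ}
    (hp : ∀ x ∈ M.cellSet K, 0 ≤ pval p x) (h : M.cellI K p = 0) : p = 0 := by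
  refine M.poly_eq_zero (K := K) fun x hx => ?_
  have h1 := eqOn_zero_of_integral_sq volume (convex_convexHull ℝ _) (M.isCompact_cellSet K)
    (M.interior_cellSet_nonempty K) (f := fun x => √(pval p x)) (continuous_pval p).sqrt (by
      rw [← h, cellI_apply]
      refine setIntegral_congr_fun (M.isCompact_cellSet K).measurableSet fun x hx => ?_
      exact Real.sq_sqrt (hp x hx)) x hx
  exact (Real.sqrt_eq_zero (hp x hx)).1 h1

theorem facetI_congr {e : M.Facet} {p q : MvPolynomial (Fin d) ℝ}
    (h : ∀ x ∈ M.facetSet e, pval p x = pval q x) : M.facetI e p = M.facetI e q := by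
  rw [facetI_apply, facetI_apply]
  exact setIntegral_congr_fun (M.isCompact_facetSet e).measurableSet h

theorem facetI_eq_zero {e : M.Facet} {p : MvPolynomial (Fin d) ℝ}
    (h : ∀ x ∈ M.facetSet e, pval p x = 0) : M.facetI e p = 0 := by
  rw [← map_zero (M.facetI e)]
  exact M.facetI_congr fun x hx => by rw [h x hx]; simp [pval]

theorem facetSet_nonempty (e : M.Facet) : (M.facetSet e).Nonempty := by
  have : 0 < e.1.card := by rw [e.2.2]; exact NeZero.pos d
  obtain ⟨x, hx⟩ := Finset.card_pos.1 this
  exact ⟨x, subset_convexHull ℝ _ hx⟩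

/-- The divergence theorem for the products `p * t i`, summed over `i`. -/
theorem cellI_integration_by_parts (K : M.Cell) (p : MvPolynomial (Fin d) ℝ)
    (t : Fin d → MvPolynomial (Fin d) ℝ) :
    M.cellI K (p * ∑ i, MvPolynomial.pderiv i (t i)) +
      M.cellI K (∑ i, MvPolynomial.pderiv i p * t i) =
      ∑ e : M.FacetOf K, M.facetI e.1 (p * ∑ i, t i * MvPolynomial.C (M.normal K e i)) := by
  have h (i : Fin d) := M.cellI_pderiv K (p * t i) i
  have h' : ∑ i, M.cellI K (MvPolynomial.pderiv i (p * t i)) =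
      ∑ e : M.FacetOf K, M.facetI e.1 (p * ∑ i, t i * MvPolynomial.C (M.normal K e i)) := by
    rw [Finset.sum_congr rfl fun i _ => h i, Finset.sum_comm]
    refine Finset.sum_congr rfl fun e _ => ?_
    rw [Finset.mul_sum, map_sum]
    refine Finset.sum_congr rfl fun i _ => ?_
    rw [← smul_eq_mul, ← map_smul, MvPolynomial.smul_eq_C_mul]
    congr 1
    ring
  rw [← h', ← map_add, ← map_sum]
  congr 1
  rw [Finset.mul_sum, ← Finset.sum_add_distrib]
  refine Finset.sum_congr rfl fun i _ => ?_
  rw [Derivation.leibniz, smul_eq_mul, smul_eq_mul]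
  ring

end Mesh

/-! ### Weak functions of zero energy. -/

section Kernels

variable {d : ℕ} {M : Mesh d} [NeZero d]

/-- Integration by parts in the definition of the weak gradient replaces the interior term by `(∇p,
t)` and leaves only the mismatch `q - p` on the boundary. Both kernel arguments consist in choosing
`t` so that the boundary part disappears or can be isolated. -/
theorem cellI_add_sum_facetI_eq_zero {r : ℕ} {K : M.Cell} {v : Scal M} (hv : v ∈ polyWeak M)
    (h : wgrad M r K v = 0) {p : MvPolynomial (Fin d) ℝ}
    {q : M.FacetOf K → MvPolynomial (Fin d) ℝ} (hp : v.1 K = restr _ p)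
    (hq : ∀ e : M.FacetOf K, v.2 e.1 = restr _ (q e)) (t : Fin d → MvPolynomial (Fin d) ℝ)
    (ht : ∀ i, (t i).totalDegree ≤ r) :
    M.cellI K (∑ i, MvPolynomial.pderiv i p * t i) +
      ∑ e : M.FacetOf K,
        M.facetI e.1 ((q e - p) * ∑ i, t i * MvPolynomial.C (M.normal K e i)) = 0 := by
  have h1 := isWeakGrad_wgrad r K hv
  have h2 : (0 : Fin d → M.cellSet K → ℝ) = fun _ => restr _ 0 := by
    funext i
    simp
  rw [h, h2, isWeakGrad_iff hp hq (g := fun _ => 0) (by simp)] at h1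
  have h3 := h1 t ht
  have h4 := M.cellI_integration_by_parts K p t
  simp only [sub_mul, map_sub, Finset.sum_sub_distrib]
  simp only [zero_mul, Finset.sum_const_zero, map_zero] at h3
  linarith

theorem restr_C (D : Set (Pt d)) (c : ℝ) : restr D (MvPolynomial.C c) = fun _ => c := by
  funext x
  rw [restr_apply, pval_C]

theorem const_mem_polyOn (D : Set (Pt d)) (j : ℕ) (c : ℝ) : (fun _ => c) ∈ polyOn D j :=
  mem_polyOn.2 ⟨MvPolynomial.C c, by simp, restr_C D c⟩

/-- A vanishing jump says that the trace is the projection of the interior value, so their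
difference is orthogonal to polynomials of degree at most `l`. -/
theorem facetI_eq_of_jump_eq_zero {l : ℕ} {K : M.Cell} {e : M.FacetOf K} {v : Scal M}
    (hv : v ∈ polyWeak M) (h : jump l K e v = 0) {p q : MvPolynomial (Fin d) ℝ}
    (hp : v.1 K = restr _ p) (hq : v.2 e.1 = restr _ q) {t : MvPolynomial (Fin d) ℝ}
    (ht : t.totalDegree ≤ l) : M.facetI e.1 ((q - p) * t) = 0 := by
  have h1 := isProj_Qb l e.1 (trace_mem (e := e) (hv.1 K))
  have h2 : Qb M l e.1 (M.trace K e (v.1 K)) = v.2 e.1 := sub_eq_zero.1 h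
  rw [h2, hq] at h1
  have h3 := h1.2 (restr _ t) (mem_polyOn.2 ⟨t, ht, rfl⟩)
  have h4 : M.trace K e (v.1 K) = restr _ p := by
    funext x
    rw [hp, restr_apply]
    exact restr_apply _ p _
  rw [h4] at h3
  have e1 : M.facetI e.1 (q * t) = M.facetI e.1 (p * t) := by
    rw [← M.facetInt_restr, ← M.facetInt_restr, map_mul, map_mul]
    exact h3
  rw [sub_mul, map_sub, e1, sub_self]

/-- A discrete weak function of zero energy is constant on each element, with the same constant on
the edges (faces) of the element. -/
theorem eq_const_of_diffusion_self {C : Finset M.Cell} {Z : Set M.Facet} {k l m : ℕ}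
    (hkm : k - 1 ≤ m) (hml : m ≤ l) {v : Scal M} (hv : v ∈ wgSpace M C Z k l)
    (h : diffusion M C l m v v = 0) {K : M.Cell} (hK : K ∈ C) :
    ∃ c : ℝ, (v.1 K = fun _ => c) ∧ ∀ e : M.FacetOf K, v.2 e.1 = fun _ => c := by
  have hv' := polyWeak_of_wgSpace hv
  obtain ⟨hg, hj⟩ := eq_zero_of_diffusion_self C l m hv' h hK
  obtain ⟨p, hpk, hp⟩ := mem_polyOn.1 (hv.1 K hK)
  choose q hq using fun e : M.FacetOf K => hv'.2 e.1
  have hq : ∀ e, restr _ (q e) = v.2 e.1 := hq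
  have hdeg (i : Fin d) : (MvPolynomial.pderiv i p).totalDegree ≤ m :=
    (totalDegree_pderiv_le i p).trans ((Nat.sub_le_sub_right hpk 1).trans hkm)
  -- The test field is the gradient of `p` itself, admissible because `k - 1 ≤ m`. The boundary
  -- terms vanish because its normal component has degree at most `m ≤ l`; what remains is the
  -- squared norm of the gradient.
  have h1 := cellI_add_sum_facetI_eq_zero hv' hg hp.symm (fun e => (hq e).symm)
    (fun i => MvPolynomial.pderiv i p) hdeg
  rw [Finset.sum_eq_zero (s := Finset.univ) (f := fun e : M.FacetOf K => M.facetI e.1 _), add_zero] at h1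
  · obtain ⟨c, rfl⟩ := eq_C_of_pderiv_eq_zero fun i => congrFun (cellI_sum_sq_eq_zero h1) i
    have hc : v.1 K = fun _ => c := by rw [← hp, restr_C]
    refine ⟨c, hc, fun e => ?_⟩
    have h2 : Qb M l e.1 (M.trace K e (v.1 K)) = v.2 e.1 := sub_eq_zero.1 (hj e)
    have h3 : M.trace K e (v.1 K) = fun _ => c := by
      rw [hc]
      rfl
    rw [← h2, h3]
    have h4 := const_mem_polyOn (M.facetSet e.1) l c
    exact (isProj_Qb l e.1 (polyFun_of_polyOn h4)).unique ⟨h4, fun t _ => rfl⟩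
  · intro e _
    refine facetI_eq_of_jump_eq_zero hv' (hj e) hp.symm (hq e).symm
      (MvPolynomial.totalDegree_finsetSum_le fun i _ => ?_)
    refine (MvPolynomial.totalDegree_mul _ _).trans ?_
    rw [MvPolynomial.totalDegree_C, add_zero]
    exact (hdeg i).trans hml

/-- The energy is definite on the discrete weak functions which vanish on the boundary. -/
theorem eq_zero_of_diffusion_self_eq_zero {C : Finset M.Cell} {k l m : ℕ} (hkm : k - 1 ≤ m)
    (hml : m ≤ l) {v : Scal M}
    (hv : v ∈ wgSpace M C {e | M.facetSet e ⊆ frontier (interior (M.cover C))} k l)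
    (h : diffusion M C l m v v = 0) : v = 0 := by
  have key : ∀ K : M.Cell, ∃ c : ℝ, K ∈ C →
      (v.1 K = fun _ => c) ∧ ∀ e : M.FacetOf K, v.2 e.1 = fun _ => c := fun K => by
    by_cases hK : K ∈ C
    · obtain ⟨c, hc⟩ := eq_const_of_diffusion_self hkm hml hv h hK
      exact ⟨c, fun _ => hc⟩
    · exact ⟨0, fun h => absurd h hK⟩
  choose c hc using key
  have hc0 : ∀ K ∈ C, c K = 0 := by
    refine M.const_eq_zero (fun K hK K' hK' e he he' => ?_) fun K hK e he => ?_
    · obtain ⟨x, hx⟩ := M.facetSet_nonempty e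
      have h1 := congrFun ((hc K hK).2 ⟨e, he⟩) ⟨x, hx⟩
      have h2 := congrFun ((hc K' hK').2 ⟨e, he'⟩) ⟨x, hx⟩
      exact h1.symm.trans h2
    · obtain ⟨x, hx⟩ := M.facetSet_nonempty e.1
      have h1 := congrFun ((hc K hK).2 e) ⟨x, hx⟩
      rw [hv.2.2.2 e.1 (Or.inr he)] at h1
      exact h1.symm
  refine Prod.ext (funext fun K => ?_) (funext fun e => ?_)
  · by_cases hK : K ∈ C
    · rw [(hc K hK).1, hc0 K hK]
      rfl
    · exact hv.2.1 K hK
  · by_cases he : ∃ K ∈ C, e.1 ⊆ K.1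
    · obtain ⟨K, hK, heK⟩ := he
      rw [(hc K hK).2 ⟨e, heK⟩, hc0 K hK]
      rfl
    · exact hv.2.2.2 e (Or.inl he)

/-- The derivative is linear in the direction, and the edges from one vertex form a basis. -/
theorem pderiv_eq_zero_of_dirDeriv {K : M.Cell} {p : MvPolynomial (Fin d) ℝ}
    (h : ∀ a b : {x // x ∈ K.1}, a ≠ b → dirDeriv (a.1 - b.1) p = 0) (i : Fin d) :
    MvPolynomial.pderiv i p = 0 := by
  let φ : Pt d →ₗ[ℝ] MvPolynomial (Fin d) ℝ :=
    ∑ i : Fin d, (LinearMap.toSpanSingleton ℝ _ (MvPolynomial.pderiv i p)) ∘ₗ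
      (EuclideanSpace.proj i : Pt d →L[ℝ] ℝ).toLinearMap
  have hφ (t : Pt d) : φ t = dirDeriv t p := by
    simp [φ, dirDeriv, MvPolynomial.smul_eq_C_mul]
  obtain ⟨o⟩ : Nonempty {x // x ∈ K.1} := by
    have : 0 < K.1.card := by rw [K.2.2]; omega
    obtain ⟨x, hx⟩ := Finset.card_pos.1 this
    exact ⟨⟨x, hx⟩⟩
  have h0 : φ = 0 := by
    refine ((M.cellBasis K).basisOf o).ext fun j => ?_
    obtain ⟨a, hao⟩ := j
    rw [AffineBasis.basisOf_apply, hφ, vsub_eq_sub]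
    exact h a o hao
  have h1 := hφ (EuclideanSpace.single i 1)
  rw [h0, dirDeriv, Finset.sum_eq_single i] at h1
  · simpa using h1.symm
  · intro j _ hj
    simp [hj]
  · simp

theorem sum_mul_C_normal (K : M.Cell) (e : M.FacetOf K) (m : MvPolynomial (Fin d) ℝ) (t : Pt d) :
    ∑ i, m * MvPolynomial.C (t i) * MvPolynomial.C (M.normal K e i) =
      m * MvPolynomial.C (inner ℝ (M.normal K e) t) := by
  rw [PiLp.inner_apply, map_sum, Finset.mul_sum]
  refine Finset.sum_congr rfl fun i _ => ?_
  simp only [RCLike.inner_apply, conj_trivial, map_mul]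
  ring

end Kernels

/-! ### The form b_h separates the pressures. -/

section Pressure

variable {d : ℕ} {M : Mesh d} [NeZero d]

theorem pval_bary_opp {K : M.Cell} {a : {x // x ∈ K.1}} {x : Pt d}
    (hx : x ∈ M.facetSet (M.opp K a).1) : pval (M.bary K a) x = 0 := by
  rw [M.pval_bary]
  exact ((M.mem_facetSet_opp_iff K a x).1 hx).2

/-- If the weak gradient of a pressure vanishes, its interior part is constant. -/
theorem exists_eq_C_of_wgrad_eq_zero {k : ℕ} {K : M.Cell} {v : Scal M} (hv : v ∈ polyWeak M)
    (h : wgrad M k K v = 0) {p : MvPolynomial (Fin d) ℝ} (hpk : p.totalDegree ≤ k - 1)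
    (hp : v.1 K = restr _ p) : ∃ c, p = MvPolynomial.C c := by
  choose q hq using fun e : M.FacetOf K => hv.2 e.1
  have hq : ∀ e, restr _ (q e) = v.2 e.1 := hq
  refine eq_C_of_pderiv_eq_zero (pderiv_eq_zero_of_dirDeriv (K := K) fun a b hab => ?_)
  set t : Pt d := a.1 - b.1 with ht
  set m := dirDeriv t p with hm
  by_contra hm0
  -- Two spare degrees are needed for the two barycentric factors. As `m ≠ 0`, the degree of `p` is
  -- at least one, so the truncated subtraction loses nothing.
  have hdeg : m.totalDegree + 2 ≤ k := by
    have h1 : m.totalDegree ≤ p.totalDegree - 1 := totalDegree_dirDeriv_le t p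
    have h2 : 1 ≤ p.totalDegree := by
      by_contra hcon
      have h3 : p.totalDegree = 0 := by omega
      rw [MvPolynomial.totalDegree_eq_zero_iff_eq_C] at h3
      apply hm0
      rw [hm, dirDeriv, h3]
      simp
    omega
  -- The test field is the bubble `λ_a λ_b m` times the edge direction `t`. The bubble vanishes on
  -- the facets opposite `a` and `b`, and on all other facets `t` is tangential, so only the
  -- interior integral of `λ_a λ_b m²` survives.
  set B := M.bary K a * M.bary K b * m with hB
  have hBd : B.totalDegree ≤ k := by
    have h1 : B.totalDegree ≤ _ := MvPolynomial.totalDegree_mul (M.bary K a * M.bary K b) m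
    have h2 := MvPolynomial.totalDegree_mul (M.bary K a) (M.bary K b)
    have h3 := M.totalDegree_bary_le K a
    have h4 := M.totalDegree_bary_le K b
    omega
  have h1 := cellI_add_sum_facetI_eq_zero hv h hp (fun e => (hq e).symm)
    (fun i => B * MvPolynomial.C (t i)) fun i => by
      refine (MvPolynomial.totalDegree_mul _ _).trans ?_
      rwa [MvPolynomial.totalDegree_C, add_zero]
  simp only [sum_mul_C_normal] at h1
  rw [Finset.sum_eq_zero (s := Finset.univ) (f := fun e : M.FacetOf K => M.facetI e.1 _),
    add_zero] at h1
  · have e1 : ∑ i, MvPolynomial.pderiv i p * (B * MvPolynomial.C (t i)) = B * m := by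
      rw [hm, dirDeriv, Finset.mul_sum]
      exact Finset.sum_congr rfl fun i _ => by ring
    rw [e1] at h1
    have h2 : B * m = 0 := M.eq_zero_of_cellI_nonneg (fun x hx => ?_) h1
    · exact mul_ne_zero (mul_ne_zero (mul_ne_zero (M.bary_ne_zero K a) (M.bary_ne_zero K b)) hm0)
        hm0 h2
    · have hc := (M.mem_cellSet_iff K x).1 hx
      rw [hB, mul_assoc, pval_mul, pval_mul, pval_mul, M.pval_bary, M.pval_bary]
      exact mul_nonneg (mul_nonneg (hc a) (hc b)) (mul_self_nonneg _)
  · intro e _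
    obtain ⟨s, rfl⟩ := (M.opp_bijective K).2 e
    by_cases hs : s ≠ a ∧ s ≠ b
    · have h2 := (M.isNormal_normal K s).inner_eq a b (Ne.symm hs.1) (Ne.symm hs.2)
      rw [M.cellBasis_apply, M.cellBasis_apply] at h2
      rw [ht, h2]
      simp
    · refine M.facetI_eq_zero fun x hx => ?_
      have h2 := pval_bary_opp hx
      have h3 : pval B x = 0 := by
        rw [hB, pval_mul, pval_mul]
        by_cases hsa : s = a
        · rw [← hsa, h2, zero_mul, zero_mul]
        · have hsb : s = b := by
            by_contra hsb
            exact hs ⟨hsa, hsb⟩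
          rw [← hsb, h2, mul_zero, zero_mul]
      rw [pval_mul, pval_mul, h3, zero_mul, mul_zero]

/-- A polynomial on an edge (face) which is orthogonal to the products of the barycentric
coordinates with polynomials of lower degree vanishes. -/
theorem eq_zero_of_facetI_bary {k : ℕ} (hk : 1 ≤ k) {K : M.Cell} {a : {x // x ∈ K.1}}
    {r : MvPolynomial (Fin d) ℝ} (hr : r.totalDegree ≤ k)
    (h : ∀ s, s ≠ a → ∀ m : MvPolynomial (Fin d) ℝ, m.totalDegree ≤ k - 1 →
      M.facetI (M.opp K a).1 (r * (M.bary K s * m)) = 0) :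
    ∀ x ∈ M.facetSet (M.opp K a).1, pval r x = 0 := by
  -- An affine function is the combination of barycentric coordinates with its vertex values as
  -- coefficients, and the coordinate of `a` vanishes on the facet. Orthogonality to all `λ_s m`
  -- thus extends to products of `m` with affine functions.
  have key (f : Pt d →ᵃ[ℝ] ℝ) (m g : MvPolynomial (Fin d) ℝ) (hm : m.totalDegree ≤ k - 1)
      (hg : ∀ x, pval g x = f x * pval m x) : M.facetI (M.opp K a).1 (r * g) = 0 := by
    have h1 : M.facetI (M.opp K a).1 (r * g) = M.facetI (M.opp K a).1
        (∑ s, f (M.cellBasis K s) • (r * (M.bary K s * m))) := by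
      refine M.facetI_congr fun x hx => ?_
      rw [pval_mul, hg, affineMap_eq_sum_coord (M.cellBasis K) f x, pval_sum, Finset.sum_mul,
        Finset.mul_sum]
      refine Finset.sum_congr rfl fun s _ => ?_
      rw [MvPolynomial.smul_eq_C_mul, pval_mul, pval_mul, pval_mul, pval_C, M.pval_bary]
      ring
    rw [h1, map_sum]
    refine Finset.sum_eq_zero fun s _ => ?_
    rw [map_smul]
    by_cases hs : s = a
    · rw [M.facetI_eq_zero fun x hx => ?_, smul_zero]
      rw [hs, pval_mul, pval_mul, pval_bary_opp hx, zero_mul, mul_zero]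
    · rw [h s hs m hm, smul_zero]
  refine M.facetI_sq_eq_zero ?_
  -- Constants and coordinates as affine factors generate every polynomial of degree at most `k`, in
  -- particular `r`, so `r` is orthogonal to itself on the facet.
  refine eq_zero_of_linear_mul hk ((M.facetI (M.opp K a).1) ∘ₗ LinearMap.mulLeft ℝ r)
    (fun m hm => ?_) (fun i m hm => ?_) hr
  · exact key (AffineMap.const ℝ (Pt d) 1) m m hm fun x => by simp
  · exact key (EuclideanSpace.proj i : Pt d →L[ℝ] ℝ).toLinearMap.toAffineMap m _ hm fun x => by
      rw [pval_mul]
      simp [pval]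

/-- Once the interior part is a constant `c`, only boundary terms remain; suitable test fields
isolate one facet and show that the trace minus `c` is orthogonal to enough polynomials there. -/
theorem eq_const_of_wgrad_eq_zero {C : Finset M.Cell} {Z : Set M.Facet} {k : ℕ} (hk : 1 ≤ k)
    {v : Scal M} (hv : v ∈ wgSpace M C Z (k - 1) k) {K : M.Cell} (hK : K ∈ C)
    (h : wgrad M k K v = 0) :
    ∃ c : ℝ, (v.1 K = fun _ => c) ∧ ∀ e : M.FacetOf K, v.2 e.1 = fun _ => c := by
  classical
  have hv' := polyWeak_of_wgSpace hv
  obtain ⟨p, hpk, hp⟩ := mem_polyOn.1 (hv.1 K hK)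
  choose q hqk hq using fun e : M.FacetOf K => mem_polyOn.1 (hv.2.2.1 e.1)
  obtain ⟨c, rfl⟩ := exists_eq_C_of_wgrad_eq_zero hv' h hpk hp.symm
  refine ⟨c, by rw [← hp, restr_C], fun e => ?_⟩
  obtain ⟨a, rfl⟩ := (M.opp_bijective K).2 e
  have h0 : ∀ x ∈ M.facetSet (M.opp K a).1, pval (q (M.opp K a) - MvPolynomial.C c) x = 0 := by
    refine eq_zero_of_facetI_bary hk ((MvPolynomial.totalDegree_sub _ _).trans
      (max_le (hqk _) (by simp))) fun s hs m hm => ?_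
    -- The field `λ_s m t` sees only the facet opposite `a`: on the facet opposite `s` the factor
    -- `λ_s` vanishes, and every other facet contains the edge `t`. The normal component of `t` on
    -- the remaining facet is nonzero.
    set t : Pt d := s.1 - a.1 with ht
    have h1 := cellI_add_sum_facetI_eq_zero hv' h hp.symm (fun e => (hq e).symm)
      (fun i => (M.bary K s * m) * MvPolynomial.C (t i)) fun i => by
        refine (MvPolynomial.totalDegree_mul _ _).trans ?_
        rw [MvPolynomial.totalDegree_C, add_zero]
        have h1 := MvPolynomial.totalDegree_mul (M.bary K s) m
        have h2 := M.totalDegree_bary_le K s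
        omega
    simp only [sum_mul_C_normal, MvPolynomial.pderiv_C, zero_mul, Finset.sum_const_zero, map_zero,
      zero_add] at h1
    rw [M.sum_facetOf K, Finset.sum_eq_single a] at h1
    · rw [mul_comm (M.bary K s * m), ← MvPolynomial.smul_eq_C_mul, mul_smul_comm, map_smul] at h1
      refine (smul_eq_zero.1 h1).resolve_left ?_
      have h2 := (M.isNormal_normal K a).inner_neg s hs
      rw [M.cellBasis_apply, M.cellBasis_apply, ← neg_sub, inner_neg_right, neg_lt_zero] at h2
      exact h2.ne'
    · intro b _ hb
      by_cases hbs : b = s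
      · refine M.facetI_eq_zero fun x hx => ?_
        rw [pval_mul, pval_mul, pval_mul, ← hbs, pval_bary_opp hx]
        ring
      · have h2 := (M.isNormal_normal K b).inner_eq s a (Ne.symm hbs) (Ne.symm hb)
        rw [M.cellBasis_apply, M.cellBasis_apply] at h2
        rw [ht, h2]
        simp
    · simp
  funext x
  have h1 := h0 x x.2
  rw [← hq, restr_apply]
  have h2 : pval (q (M.opp K a) - MvPolynomial.C c) x.1 = pval (q (M.opp K a)) x.1 - c := by
    simp [pval]
  rw [h2] at h1
  exact sub_eq_zero.1 h1

theorem mem_cellsF {K : M.Cell} : K ∈ M.cellsF ↔ K.1 ∈ M.fluidCells := by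
  simp [Mesh.cellsF]

theorem OmF_eq : M.OmF = interior (M.cover M.cellsF) := by
  unfold Mesh.OmF
  congr 1
  ext x
  rw [M.mem_cover_iff]
  simp only [Set.mem_iUnion]
  constructor
  · rintro ⟨K, hK, hx⟩
    exact ⟨⟨K, M.fluidCells_subset K hK⟩, mem_cellsF.2 hK, hx⟩
  · rintro ⟨K, hK, hx⟩
    exact ⟨K.1, mem_cellsF.1 hK, hx⟩

theorem Om_eq : M.Om = interior (M.cover M.cells) := by
  unfold Mesh.Om
  congr 1
  ext x
  rw [M.mem_cover_iff, Geometry.SimplicialComplex.mem_space_iff]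
  constructor
  · rintro ⟨s, hs, hx⟩
    obtain ⟨K, hK, hsK, hc⟩ := M.pure s hs
    exact ⟨⟨K, hK, hc⟩, Finset.mem_univ _, convexHull_mono (Finset.coe_subset.2 hsK) hx⟩
  · rintro ⟨K, -, hx⟩
    exact ⟨K.1, K.2.1, hx⟩

theorem cellInt_const_pos (K : M.Cell) : 0 < M.cellInt K fun _ => 1 := by
  have h := M.cellInt_eq K fun _ => (1 : ℝ)
  rw [h, setIntegral_const, smul_eq_mul, mul_one]
  refine ENNReal.toReal_pos (fun h0 => ?_) (M.isCompact_cellSet K).measure_lt_top.ne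
  exact (isOpen_interior.measure_pos volume (M.interior_cellSet_nonempty K)).ne'
    (measure_mono_null interior_subset h0)

/-- A qualitative inf-sup condition. The weak gradient is itself an admissible velocity, so it
vanishes; elementwise constancy, connectedness of the fluid domain and the zero mean value then give
zero. -/
theorem eq_zero_of_bForm_eq_zero {k l : ℕ} (hk : 1 ≤ k) {q : Scal M} (hq : q ∈ Q0 M k)
    (h : ∀ v ∈ V0 M k l, bForm M k v q = 0) : q = 0 := by
  classical
  have hq' := polyWeak_of_wgSpace hq.1
  have hg : ∀ K ∈ M.cellsF, wgrad M k K q = 0 := by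
    -- The interior part is the weak gradient of `q`, of degree `k` as velocities allow. The trace
    -- is zero because b_h does not involve it.
    let v : Vect M := fun i => (fun K => if K ∈ M.cellsF then wgrad M k K q i else 0, 0)
    have hv : v ∈ V0 M k l := by
      rw [V0, Submodule.mem_pi]
      intro i _
      refine ⟨fun K hK => ?_, fun K hK => ?_, fun e => zero_mem _, fun e _ => rfl⟩
      · simp only [v, if_pos hK]
        exact wgrad_mem k K hq' i
      · simp only [v, if_neg hK]
    have h1 : ∑ K ∈ M.cellsF, dotInt K (wgrad M k K q) (wgrad M k K q) = 0 := by
      rw [← h v hv]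
      refine Finset.sum_congr rfl fun K hK => ?_
      simp only [v, if_pos hK]
      rfl
    rw [Finset.sum_eq_zero_iff_of_nonneg fun K _ => dotInt_self_nonneg K _] at h1
    exact fun K hK => dotInt_self_eq_zero (fun i => polyFun_of_polyOn (wgrad_mem k K hq' i)) (h1 K hK)
  have key : ∀ K : M.Cell, ∃ c : ℝ, K ∈ M.cellsF →
      (q.1 K = fun _ => c) ∧ ∀ e : M.FacetOf K, q.2 e.1 = fun _ => c := fun K => by
    by_cases hK : K ∈ M.cellsF
    · obtain ⟨c, hc⟩ := eq_const_of_wgrad_eq_zero hk hq.1 hK (hg K hK)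
      exact ⟨c, fun _ => hc⟩
    · exact ⟨0, fun h => absurd h hK⟩
  choose c hc using key
  have hcc : ∀ K ∈ M.cellsF, ∀ K' ∈ M.cellsF, c K = c K' := by
    refine M.const_eq_const (fun K hK K' hK' e he he' => ?_) ?_
    · obtain ⟨x, hx⟩ := M.facetSet_nonempty e
      have h1 := congrFun ((hc K hK).2 ⟨e, he⟩) ⟨x, hx⟩
      have h2 := congrFun ((hc K' hK').2 ⟨e, he'⟩) ⟨x, hx⟩
      exact h1.symm.trans h2
    · rw [← OmF_eq]
      exact M.fluid_connected
  have hc0 : ∀ K ∈ M.cellsF, c K = 0 := by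
    intro K hK
    have h1 := hq.2
    have h2 : ∑ K' ∈ M.cellsF, M.cellInt K' (q.1 K') =
        c K * ∑ K' ∈ M.cellsF, M.cellInt K' fun _ => 1 := by
      rw [Finset.mul_sum]
      refine Finset.sum_congr rfl fun K' hK' => ?_
      rw [(hc K' hK').1, ← M.cellInt_smul, hcc K hK K' hK']
      congr 1
      funext x
      simp
    rw [h2] at h1
    exact (mul_eq_zero.1 h1).resolve_right
      (Finset.sum_pos (fun K' _ => cellInt_const_pos K') ⟨K, hK⟩).ne'
  refine Prod.ext (funext fun K => ?_) (funext fun e => ?_)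
  · by_cases hK : K ∈ M.cellsF
    · rw [(hc K hK).1, hc0 K hK]
      rfl
    · exact hq.1.2.1 K hK
  · by_cases he : ∃ K ∈ M.cellsF, e.1 ⊆ K.1
    · obtain ⟨K, hK, heK⟩ := he
      rw [(hc K hK).2 ⟨e, heK⟩, hc0 K hK]
      rfl
    · exact hq.1.2.2.2 e (Or.inl he)

end Pressure

/-! ### The convection forms written componentwise. -/

section Forms

variable {d : ℕ} {M : Mesh d} [NeZero d]

theorem mulInt_add_right {K : M.Cell} {F G G' : M.cellSet K → ℝ} (hF : F ∈ polyFun _)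
    (hG : G ∈ polyFun _) (hG' : G' ∈ polyFun _) :
    M.cellInt K (F * (G + G')) = M.cellInt K (F * G) + M.cellInt K (F * G') := by
  rw [mul_add, M.cellInt_add (mul_mem hF hG) (mul_mem hF hG')]

/-- `(∇_{w,k} · (u w), v_0)` for scalar weak functions `u`, `v` and a velocity `w`. -/
noncomputable def convect (C : Finset M.Cell) (k : ℕ) (w : Vect M) (u v : Scal M) : ℝ :=
  ∑ K ∈ C, M.cellInt K (wdiv M k K (fun j => u * w j) * v.1 K)

section Convect

variable (C : Finset M.Cell) (k : ℕ) {w w' : Vect M} {u u' v v' : Scal M}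
  (c : ℝ)

theorem convect_add_vel (hw : ∀ j, w j ∈ polyWeak M) (hw' : ∀ j, w' j ∈ polyWeak M)
    (hu : u ∈ polyWeak M) (hv : v ∈ polyWeak M) :
    convect C k (w + w') u v = convect C k w u v + convect C k w' u v := by
  simp only [convect, ← Finset.sum_add_distrib]
  refine Finset.sum_congr rfl fun K _ => ?_
  have h1 (j : Fin d) := polyWeak_mul hu (hw j)
  have h2 (j : Fin d) := polyWeak_mul hu (hw' j)
  have e : (fun j => u * (w + w') j) = (fun j => u * w j) + fun j => u * w' j :=
    funext fun j => mul_add _ _ _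
  rw [e, wdiv_add k K h1 h2, mulInt_add_left (wdiv_mem k K h1) (wdiv_mem k K h2) (hv.1 K)]

theorem convect_smul_vel (hw : ∀ j, w j ∈ polyWeak M) (hu : u ∈ polyWeak M) (v : Scal M) :
    convect C k (c • w) u v = c * convect C k w u v := by
  simp only [convect, Finset.mul_sum]
  refine Finset.sum_congr rfl fun K _ => ?_
  have e : (fun j => u * (c • w) j) = c • (fun j => u * w j) :=
    funext fun j => mul_smul_comm c u (w j)
  rw [e, wdiv_smul k K c fun j => polyWeak_mul hu (hw j), smul_mul_assoc, M.cellInt_smul]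

theorem convect_add_left (hw : ∀ j, w j ∈ polyWeak M) (hu : u ∈ polyWeak M)
    (hu' : u' ∈ polyWeak M) (hv : v ∈ polyWeak M) :
    convect C k w (u + u') v = convect C k w u v + convect C k w u' v := by
  simp only [convect, ← Finset.sum_add_distrib]
  refine Finset.sum_congr rfl fun K _ => ?_
  have h1 (j : Fin d) := polyWeak_mul hu (hw j)
  have h2 (j : Fin d) := polyWeak_mul hu' (hw j)
  have e : (fun j => (u + u') * w j) = (fun j => u * w j) + fun j => u' * w j :=
    funext fun j => add_mul _ _ _
  rw [e, wdiv_add k K h1 h2, mulInt_add_left (wdiv_mem k K h1) (wdiv_mem k K h2) (hv.1 K)]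

theorem convect_smul_left (hw : ∀ j, w j ∈ polyWeak M) (hu : u ∈ polyWeak M) (v : Scal M) :
    convect C k w (c • u) v = c * convect C k w u v := by
  simp only [convect, Finset.mul_sum]
  refine Finset.sum_congr rfl fun K _ => ?_
  have e : (fun j => (c • u) * w j) = c • (fun j => u * w j) :=
    funext fun j => smul_mul_assoc _ _ _
  rw [e, wdiv_smul k K c fun j => polyWeak_mul hu (hw j), smul_mul_assoc, M.cellInt_smul]

theorem convect_add_right (hw : ∀ j, w j ∈ polyWeak M) (hu : u ∈ polyWeak M)
    (hv : v ∈ polyWeak M) (hv' : v' ∈ polyWeak M) :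
    convect C k w u (v + v') = convect C k w u v + convect C k w u v' := by
  simp only [convect, ← Finset.sum_add_distrib]
  refine Finset.sum_congr rfl fun K _ => ?_
  exact mulInt_add_right (wdiv_mem k K fun j => polyWeak_mul hu (hw j)) (hv.1 K) (hv'.1 K)

theorem convect_smul_right (w : Vect M) (u v : Scal M) :
    convect C k w u (c • v) = c * convect C k w u v := by
  simp only [convect, Finset.mul_sum]
  refine Finset.sum_congr rfl fun K _ => ?_
  have e : (c • v).1 K = c • v.1 K := rfl
  rw [e, mul_smul_comm, M.cellInt_smul]

end Convect

/-- The skew-symmetric part of `convect`. -/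
noncomputable def skew (C : Finset M.Cell) (k : ℕ) (w : Vect M) (u v : Scal M) : ℝ :=
  1 / 2 * convect C k w u v - 1 / 2 * convect C k w v u

theorem skew_comm (C : Finset M.Cell) (k : ℕ) (w : Vect M) (u v : Scal M) :
    skew C k w u v = - skew C k w v u := by
  unfold skew
  ring

theorem cBar_eq_skew (k : ℕ) (u : Vect M) (T s : Scal M) :
    cBar M k u T s = skew M.cells k u T s := by
  simp only [cBar, mul_comm (u _)]
  rfl

theorem cellInt_sum {K : M.Cell} {α : Type*} (I : Finset α) {F : α → M.cellSet K → ℝ}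
    (hF : ∀ i ∈ I, F i ∈ polyFun _) : M.cellInt K (∑ i ∈ I, F i) = ∑ i ∈ I, M.cellInt K (F i) := by
  classical
  induction I using Finset.induction_on with
  | empty =>
    rw [Finset.sum_empty, Finset.sum_empty, ← zero_smul ℝ (0 : M.cellSet K → ℝ), M.cellInt_smul,
      zero_mul]
  | insert i I hi ih =>
    have h1 := hF i (Finset.mem_insert_self i I)
    have h2 := fun j hj => hF j (Finset.mem_insert_of_mem hj)
    rw [Finset.sum_insert hi, Finset.sum_insert hi, M.cellInt_add h1 (sum_mem h2), ih h2]

/-- The tensor product acts row by row, so the vector form is a sum of scalar skew forms, the same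
kind that gives the heat convection form. -/
theorem cForm_eq_skew (k : ℕ) {w u v : Vect M} (hw : ∀ j, w j ∈ polyWeak M)
    (hu : ∀ j, u j ∈ polyWeak M) (hv : ∀ j, v j ∈ polyWeak M) :
    cForm M k w u v = ∑ i, skew M.cellsF k w (u i) (v i) := by
  have key {u v : Vect M} (hu : ∀ j, u j ∈ polyWeak M) (hv : ∀ j, v j ∈ polyWeak M) :
      ∑ K ∈ M.cellsF, M.cellInt K (fun x => ∑ i, wdiv M k K (fun j => u i * w j) x * (v i).1 K x) =
        ∑ i, convect M.cellsF k w (u i) (v i) := by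
    simp only [convect]
    rw [Finset.sum_comm]
    refine Finset.sum_congr rfl fun K _ => ?_
    rw [← cellInt_sum _ fun i _ =>
      mul_mem (wdiv_mem k K fun j => polyWeak_mul (hu i) (hw j)) ((hv i).1 K)]
    congr 1
    funext x
    simp
  simp only [cForm, key hu hv, key hv hu, skew, Finset.sum_sub_distrib, Finset.mul_sum]

theorem bForm_eq (k : ℕ) (v : Vect M) (q : Scal M) :
    bForm M k v q = ∑ K ∈ M.cellsF, dotInt K (wgrad M k K q) fun i => (v i).1 K := rfl

theorem buoyancy_eq (T : Scal M) (v : Vect M) :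
    buoyancy M T v = ∑ K ∈ M.cellsF, dotInt K (fun i => jvec i • T.1 K) fun i => (v i).1 K := rfl

theorem normQ_eq (k : ℕ) (q : Scal M) :
    normQ M k q = √(∑ K ∈ M.cellsF, M.cellInt K (q.1 K * q.1 K) +
      ∑ K ∈ M.cellsF, dotInt K (wgrad M k K q) (wgrad M k K q)) := by
  simp only [normQ, pow_two]
  rfl

end Forms

/-! ### Load functionals for square-integrable data. -/

section Loads

variable {d : ℕ} {M : Mesh d} [NeZero d]

/-- The boundary of an element is a null set and its interior lies in the open domain. This
transfers integrability on the domain, an interior, to closed elements. -/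
theorem restrict_cellSet_le {C : Finset M.Cell} {K : M.Cell} (hK : K ∈ C) :
    (volume : Measure (Pt d)).restrict (M.cellSet K) ≤ volume.restrict (interior (M.cover C)) := by
  have h : (volume : Measure (Pt d)) (frontier (M.cellSet K)) = 0 :=
    (convex_convexHull ℝ _).addHaar_frontier volume
  rw [← Measure.restrict_congr_set (interior_ae_eq_of_null_frontier h)]
  exact Measure.restrict_mono_set _ (interior_mono fun x hx => M.mem_cover_iff.2 ⟨K, hK, hx⟩)

theorem integrableOn_mul_pval {C : Finset M.Cell} {K : M.Cell} (hK : K ∈ C) {g : Pt d → ℝ}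
    (hg : MemLp g 2 (volume.restrict (interior (M.cover C)))) (p : MvPolynomial (Fin d) ℝ) :
    IntegrableOn (fun x => g x * pval p x) (M.cellSet K) := by
  have : IsFiniteMeasure ((volume : Measure (Pt d)).restrict (M.cellSet K)) :=
    ⟨by rw [Measure.restrict_apply_univ]; exact (M.isCompact_cellSet K).measure_lt_top⟩
  have h1 : IntegrableOn g (M.cellSet K) := (hg.mono_measure (restrict_cellSet_le hK)).integrable one_le_two
  exact h1.mul_continuousOn (continuous_pval p).continuousOn (M.isCompact_cellSet K)

theorem loadInt_add {C : Finset M.Cell} {K : M.Cell} (hK : K ∈ C) {g : Pt d → ℝ}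
    (hg : MemLp g 2 (volume.restrict (interior (M.cover C)))) {F G : M.cellSet K → ℝ}
    (hF : F ∈ polyFun _) (hG : G ∈ polyFun _) :
    M.cellInt K (fun x => g x * (F + G) x) =
      M.cellInt K (fun x => g x * F x) + M.cellInt K (fun x => g x * G x) := by
  obtain ⟨p, hp⟩ := hF
  obtain ⟨q, hq⟩ := hG
  have hp : restr _ p = F := hp
  have hq : restr _ q = G := hq
  have h1 := M.cellInt_eq K fun x => g x * pval p x
  have h2 := M.cellInt_eq K fun x => g x * pval q x
  have h3 := M.cellInt_eq K fun x => g x * pval p x + g x * pval q x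
  rw [← hp, ← hq]
  simp only [Pi.add_apply, restr_apply, mul_add]
  rw [h1, h2, h3]
  exact integral_add (integrableOn_mul_pval hK hg p) (integrableOn_mul_pval hK hg q)

theorem loadInt_sum {C : Finset M.Cell} {K : M.Cell} (hK : K ∈ C) {f : Pt d → Pt d}
    (hf : MemLp f 2 (volume.restrict (interior (M.cover C)))) {F : Fin d → M.cellSet K → ℝ}
    (hF : ∀ i, F i ∈ polyFun _) :
    M.cellInt K (fun x => ∑ i, f x i * F i x) = ∑ i, M.cellInt K (fun x => f x i * F i x) := by
  choose p hp using hF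
  have hp : ∀ i, restr _ (p i) = F i := hp
  have h1 (i : Fin d) := M.cellInt_eq K fun x => f x i * pval (p i) x
  have h2 := M.cellInt_eq K fun x => ∑ i, f x i * pval (p i) x
  simp only [← hp, restr_apply]
  rw [h2, integral_finsetSum]
  · exact Finset.sum_congr rfl fun i _ => (h1 i).symm
  · exact fun i _ => integrableOn_mul_pval hK (hf.eval_piLp i) (p i)

theorem loadInt_smul (K : M.Cell) (g : Pt d → ℝ) (c : ℝ) (F : M.cellSet K → ℝ) :
    M.cellInt K (fun x => g x * (c • F) x) = c * M.cellInt K (fun x => g x * F x) := by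
  rw [← M.cellInt_smul]
  congr 1
  funext x
  simp only [Pi.smul_apply, smul_eq_mul]
  ring

end Loads

/-- A trilinear form from its values. -/
def mkTrilinear {U V S : Type*} [AddCommGroup U] [Module ℝ U] [AddCommGroup V] [Module ℝ V]
    [AddCommGroup S] [Module ℝ S] (f : U → V → S → ℝ)
    (h1 : ∀ u u' v s, f (u + u') v s = f u v s + f u' v s)
    (h2 : ∀ (c : ℝ) u v s, f (c • u) v s = c * f u v s)
    (h3 : ∀ u v v' s, f u (v + v') s = f u v s + f u v' s)
    (h4 : ∀ (c : ℝ) u v s, f u (c • v) s = c * f u v s)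
    (h5 : ∀ u v s s', f u v (s + s') = f u v s + f u v s')
    (h6 : ∀ (c : ℝ) u v s, f u v (c • s) = c * f u v s) : U →ₗ[ℝ] V →ₗ[ℝ] S →ₗ[ℝ] ℝ where
  toFun u := LinearMap.mk₂ ℝ (f u) (h3 u) (fun c => h4 c u) (h5 u) (fun c => h6 c u)
  map_add' u u' := LinearMap.ext₂ fun v s => h1 u u' v s
  map_smul' c u := LinearMap.ext₂ fun v s => h2 c u v s

/-! ### Finite dimensionality of the discrete spaces. -/

section Spaces

variable {d : ℕ} (M : Mesh d)

instance finiteDimensional_wgSpace (C : Finset M.Cell) (Z : Set M.Facet) (j l : ℕ) :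
    FiniteDimensional ℝ (wgSpace M C Z j l) := by
  have h (v : wgSpace M C Z j l) (K : M.Cell) : v.1.1 K ∈ polyOn (M.cellSet K) j := by
    by_cases hK : K ∈ C
    · exact v.2.1 K hK
    · rw [v.2.2.1 K hK]
      exact zero_mem _
  let φ : wgSpace M C Z j l →ₗ[ℝ]
      ((K : M.Cell) → polyOn (M.cellSet K) j) × ((e : M.Facet) → polyOn (M.facetSet e) l) :=
    { toFun := fun v => (fun K => ⟨v.1.1 K, h v K⟩, fun e => ⟨v.1.2 e, v.2.2.2.1 e⟩)
      map_add' := fun _ _ => rfl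
      map_smul' := fun _ _ => rfl }
  refine FiniteDimensional.of_injective φ fun v w hvw => Subtype.ext (Prod.ext ?_ ?_)
  · exact funext fun K => congrArg Subtype.val (congrFun (congrArg Prod.fst hvw) K)
  · exact funext fun e => congrArg Subtype.val (congrFun (congrArg Prod.snd hvw) e)

instance finiteDimensional_V0 (k l : ℕ) : FiniteDimensional ℝ (V0 M k l) := by
  let φ : V0 M k l →ₗ[ℝ]
      (Fin d → wgSpace M M.cellsF {e | M.facetSet e ⊆ frontier M.OmF} k l) :=
    { toFun := fun v i => ⟨v.1 i, v.2 i (Set.mem_univ i)⟩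
      map_add' := fun _ _ => rfl
      map_smul' := fun _ _ => rfl }
  exact FiniteDimensional.of_injective φ fun v w hvw => Subtype.ext <|
    funext fun i => congrArg Subtype.val (congrFun hvw i)

instance finiteDimensional_S0 (k l : ℕ) : FiniteDimensional ℝ (S0 M k l) :=
  finiteDimensional_wgSpace M _ _ k l

variable {M}

theorem polyWeak_of_V0 {k l : ℕ} {v : Vect M} (hv : v ∈ V0 M k l) (i : Fin d) :
    v i ∈ polyWeak M := polyWeak_of_wgSpace (hv i (Set.mem_univ i))

theorem polyWeak_of_S0 {k l : ℕ} {s : Scal M} (hs : s ∈ S0 M k l) : s ∈ polyWeak M :=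
  polyWeak_of_wgSpace hs

variable [NeZero d]

variable (M) in
/-- The pressure space as a subspace. -/
noncomputable def pressureSpace (k : ℕ) : Submodule ℝ (Scal M) where
  carrier := Q0 M k
  add_mem' := fun {p q} hp hq => ⟨add_mem hp.1 hq.1, by
    have h (K : M.Cell) := M.cellInt_add ((polyWeak_of_wgSpace hp.1).1 K)
      ((polyWeak_of_wgSpace hq.1).1 K)
    have e (K : M.Cell) : (p + q).1 K = p.1 K + q.1 K := rfl
    simp only [e, h, Finset.sum_add_distrib, hp.2, hq.2, add_zero]⟩
  zero_mem' := ⟨zero_mem _, Finset.sum_eq_zero fun K _ => by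
    have e : (0 : Scal M).1 K = (0 : ℝ) • (0 : M.cellSet K → ℝ) := (zero_smul _ _).symm
    rw [e, M.cellInt_smul, zero_mul]⟩
  smul_mem' := fun c p hp => ⟨Submodule.smul_mem _ c hp.1, by
    have e (K : M.Cell) : (c • p).1 K = c • p.1 K := rfl
    simp only [e, M.cellInt_smul, ← Finset.mul_sum, hp.2, mul_zero]⟩

variable (M) in
instance finiteDimensional_pressureSpace (k : ℕ) : FiniteDimensional ℝ (pressureSpace M k) :=
  Submodule.finiteDimensional_of_le (S₂ := wgSpace M M.cellsF ∅ (k - 1) k) fun _ hq => hq.1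

end Spaces

/-! ### The forms and functionals as linear maps. -/

section Bundled

variable {d : ℕ} (M : Mesh d) [NeZero d]

section Skew

variable {M} (C : Finset M.Cell) (k : ℕ) (c : ℝ) {w w' : Vect M} {u u' v : Scal M}

theorem skew_add_vel (hw : ∀ j, w j ∈ polyWeak M) (hw' : ∀ j, w' j ∈ polyWeak M)
    (hu : u ∈ polyWeak M) (hv : v ∈ polyWeak M) :
    skew C k (w + w') u v = skew C k w u v + skew C k w' u v := by
  unfold skew
  rw [convect_add_vel C k hw hw' hu hv, convect_add_vel C k hw hw' hv hu]
  ring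

theorem skew_smul_vel (hw : ∀ j, w j ∈ polyWeak M) (hu : u ∈ polyWeak M) (hv : v ∈ polyWeak M) :
    skew C k (c • w) u v = c * skew C k w u v := by
  unfold skew
  rw [convect_smul_vel C k c hw hu, convect_smul_vel C k c hw hv]
  ring

theorem skew_add_left (hw : ∀ j, w j ∈ polyWeak M) (hu : u ∈ polyWeak M) (hu' : u' ∈ polyWeak M)
    (hv : v ∈ polyWeak M) : skew C k w (u + u') v = skew C k w u v + skew C k w u' v := by
  unfold skew
  rw [convect_add_left C k hw hu hu' hv, convect_add_right C k hw hv hu hu']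
  ring

theorem skew_smul_left (hw : ∀ j, w j ∈ polyWeak M) (hu : u ∈ polyWeak M) (v : Scal M) :
    skew C k w (c • u) v = c * skew C k w u v := by
  unfold skew
  rw [convect_smul_left C k c hw hu, convect_smul_right C k c w v u]
  ring

theorem skew_add_right (hw : ∀ j, w j ∈ polyWeak M) (hu : u ∈ polyWeak M) (hu' : u' ∈ polyWeak M)
    (hv : v ∈ polyWeak M) : skew C k w v (u + u') = skew C k w v u + skew C k w v u' := by
  rw [skew_comm, skew_add_left C k hw hu hu' hv, skew_comm C k w v u, skew_comm C k w v u']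
  ring

theorem skew_smul_right (hw : ∀ j, w j ∈ polyWeak M) (hu : u ∈ polyWeak M) (v : Scal M) :
    skew C k w v (c • u) = c * skew C k w v u := by
  rw [skew_comm, skew_smul_left C k c hw hu, skew_comm C k w v u]
  ring

end Skew

/-- The convective form `c_h` on the velocity space. -/
noncomputable def convectionForm (k l : ℕ) :
    V0 M k l →ₗ[ℝ] V0 M k l →ₗ[ℝ] V0 M k l →ₗ[ℝ] ℝ :=
  have hp (v : V0 M k l) := polyWeak_of_V0 v.2
  mkTrilinear (fun w u v => ∑ i, skew M.cellsF k w.1 (u.1 i) (v.1 i))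
    (fun w w' u v => by
      simp only [← Finset.sum_add_distrib]
      exact Finset.sum_congr rfl fun i _ => skew_add_vel _ k (hp w) (hp w') (hp u i) (hp v i))
    (fun c w u v => by
      simp only [Finset.mul_sum]
      exact Finset.sum_congr rfl fun i _ => skew_smul_vel _ k c (hp w) (hp u i) (hp v i))
    (fun w u u' v => by
      simp only [← Finset.sum_add_distrib]
      exact Finset.sum_congr rfl fun i _ => skew_add_left _ k (hp w) (hp u i) (hp u' i) (hp v i))
    (fun c w u v => by
      simp only [Finset.mul_sum]
      exact Finset.sum_congr rfl fun i _ => skew_smul_left _ k c (hp w) (hp u i) _)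
    (fun w v u u' => by
      simp only [← Finset.sum_add_distrib]
      exact Finset.sum_congr rfl fun i _ => skew_add_right _ k (hp w) (hp u i) (hp u' i) (hp v i))
    (fun c w v u => by
      simp only [Finset.mul_sum]
      exact Finset.sum_congr rfl fun i _ => skew_smul_right _ k c (hp w) (hp u i) _)

theorem convectionForm_apply (k l : ℕ) (w u v : V0 M k l) :
    convectionForm M k l w u v = cForm M k w.1 u.1 v.1 :=
  (cForm_eq_skew k (polyWeak_of_V0 w.2) (polyWeak_of_V0 u.2) (polyWeak_of_V0 v.2)).symm

/-- The convective form `c̄_h` on the velocity and temperature spaces. -/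
noncomputable def heatConvectionForm (k l : ℕ) :
    V0 M k l →ₗ[ℝ] S0 M k l →ₗ[ℝ] S0 M k l →ₗ[ℝ] ℝ :=
  have hp (v : V0 M k l) := polyWeak_of_V0 v.2
  have hs (s : S0 M k l) := polyWeak_of_S0 s.2
  mkTrilinear (fun w T s => skew M.cells k w.1 T.1 s.1)
    (fun w w' u v => skew_add_vel _ k (hp w) (hp w') (hs u) (hs v))
    (fun c w u v => skew_smul_vel _ k c (hp w) (hs u) (hs v))
    (fun w u u' v => skew_add_left _ k (hp w) (hs u) (hs u') (hs v))
    (fun c w u v => skew_smul_left _ k c (hp w) (hs u) _)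
    (fun w v u u' => skew_add_right _ k (hp w) (hs u) (hs u') (hs v))
    (fun c w v u => skew_smul_right _ k c (hp w) (hs u) _)

theorem heatConvectionForm_apply (k l : ℕ) (w : V0 M k l) (T s : S0 M k l) :
    heatConvectionForm M k l w T s = cBar M k w.1 T.1 s.1 := (cBar_eq_skew k _ _ _).symm

/-- The energy form of the velocity space. -/
noncomputable def velocityForm (k l m : ℕ) : V0 M k l →ₗ[ℝ] V0 M k l →ₗ[ℝ] ℝ :=
  have hp (v : V0 M k l) := polyWeak_of_V0 v.2
  have h1 (u u' v : V0 M k l) : ∑ i, diffusion M M.cellsF l m ((u + u').1 i) (v.1 i) =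
      ∑ i, diffusion M M.cellsF l m (u.1 i) (v.1 i) +
        ∑ i, diffusion M M.cellsF l m (u'.1 i) (v.1 i) := by
    rw [← Finset.sum_add_distrib]
    exact Finset.sum_congr rfl fun i _ => diffusion_add_left _ l m (hp u i) (hp u' i) (hp v i)
  have h2 (c : ℝ) (u v : V0 M k l) : ∑ i, diffusion M M.cellsF l m ((c • u).1 i) (v.1 i) =
      c * ∑ i, diffusion M M.cellsF l m (u.1 i) (v.1 i) := by
    rw [Finset.mul_sum]
    exact Finset.sum_congr rfl fun i _ => diffusion_smul_left _ l m c _ (hp u i)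
  LinearMap.mk₂ ℝ (fun u v => ∑ i, diffusion M M.cellsF l m (u.1 i) (v.1 i)) h1 h2
    (fun v u u' => by simpa only [diffusion_comm _ l m (v.1 _)] using h1 u u' v)
    (fun c v u => by simpa only [smul_eq_mul, diffusion_comm _ l m (v.1 _)] using h2 c u v)

theorem velocityForm_apply (k l m : ℕ) (u v : V0 M k l) :
    velocityForm M k l m u v = ∑ i, diffusion M M.cellsF l m (u.1 i) (v.1 i) := rfl

/-- The energy form of the temperature space. -/
noncomputable def temperatureForm (k l m : ℕ) : S0 M k l →ₗ[ℝ] S0 M k l →ₗ[ℝ] ℝ :=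
  have hs (s : S0 M k l) := polyWeak_of_S0 s.2
  have h1 (u u' v : S0 M k l) : diffusion M M.cells l m (u + u').1 v.1 =
      diffusion M M.cells l m u.1 v.1 + diffusion M M.cells l m u'.1 v.1 :=
    diffusion_add_left _ l m (hs u) (hs u') (hs v)
  have h2 (c : ℝ) (u v : S0 M k l) : diffusion M M.cells l m (c • u).1 v.1 =
      c * diffusion M M.cells l m u.1 v.1 := diffusion_smul_left _ l m c _ (hs u)
  LinearMap.mk₂ ℝ (fun u v => diffusion M M.cells l m u.1 v.1) h1 h2
    (fun v u u' => by simpa only [diffusion_comm _ l m v.1] using h1 u u' v)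
    (fun c v u => by simpa only [smul_eq_mul, diffusion_comm _ l m v.1] using h2 c u v)

theorem polyFun_wgrad (r : ℕ) (K : M.Cell) {v : Scal M} (hv : v ∈ polyWeak M) (i : Fin d) :
    wgrad M r K v i ∈ polyFun (M.cellSet K) := polyFun_of_polyOn (wgrad_mem r K hv i)

/-- The form `b_h`. -/
noncomputable def pressureForm (k l : ℕ) : V0 M k l →ₗ[ℝ] pressureSpace M k →ₗ[ℝ] ℝ :=
  have hp (v : V0 M k l) := polyWeak_of_V0 v.2
  have hq (q : pressureSpace M k) : q.1 ∈ polyWeak M := polyWeak_of_wgSpace q.2.1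
  LinearMap.mk₂ ℝ (fun v q => bForm M k v.1 q.1)
    (fun v v' q => by
      simp only [bForm_eq, ← Finset.sum_add_distrib]
      exact Finset.sum_congr rfl fun K _ => dotInt_add_right (polyFun_wgrad M k K (hq q))
        (fun i => (hp v i).1 K) fun i => (hp v' i).1 K)
    (fun c v q => by
      simp only [bForm_eq, smul_eq_mul, Finset.mul_sum]
      exact Finset.sum_congr rfl fun K _ => dotInt_smul_right K c _ _)
    (fun v q q' => by
      simp only [bForm_eq, ← Finset.sum_add_distrib]
      refine Finset.sum_congr rfl fun K _ => ?_
      rw [Submodule.coe_add, wgrad_add k K (hq q) (hq q')]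
      exact dotInt_add_left (polyFun_wgrad M k K (hq q)) (polyFun_wgrad M k K (hq q'))
        fun i => (hp v i).1 K)
    (fun c v q => by
      simp only [bForm_eq, smul_eq_mul, Finset.mul_sum]
      refine Finset.sum_congr rfl fun K _ => ?_
      rw [Submodule.coe_smul, wgrad_smul k K c (hq q)]
      exact dotInt_smul_left K c _ _)

/-- The buoyancy form. -/
noncomputable def buoyancyForm (k l : ℕ) : S0 M k l →ₗ[ℝ] V0 M k l →ₗ[ℝ] ℝ :=
  have hp (v : V0 M k l) := polyWeak_of_V0 v.2
  have hs (s : S0 M k l) := polyWeak_of_S0 s.2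
  have hj (s : S0 M k l) (K : M.Cell) (i : Fin d) : jvec i • s.1.1 K ∈ polyFun (M.cellSet K) :=
    (polyFun _).smul_mem ((hs s).1 K) _
  LinearMap.mk₂ ℝ (fun s v => buoyancy M s.1 v.1)
    (fun s s' v => by
      simp only [buoyancy_eq, ← Finset.sum_add_distrib]
      refine Finset.sum_congr rfl fun K _ => ?_
      rw [← dotInt_add_left (hj s K) (hj s' K) fun i => (hp v i).1 K]
      congr 1
      exact funext fun i => smul_add _ _ _)
    (fun c s v => by
      simp only [buoyancy_eq, smul_eq_mul, Finset.mul_sum]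
      refine Finset.sum_congr rfl fun K _ => ?_
      rw [← dotInt_smul_left]
      congr 1
      exact funext fun i => smul_comm (jvec i) c (s.1.1 K))
    (fun s v v' => by
      simp only [buoyancy_eq, ← Finset.sum_add_distrib]
      exact Finset.sum_congr rfl fun K _ => dotInt_add_right (hj s K)
        (fun i => (hp v i).1 K) fun i => (hp v' i).1 K)
    (fun c s v => by
      simp only [buoyancy_eq, smul_eq_mul, Finset.mul_sum]
      exact Finset.sum_congr rfl fun K _ => dotInt_smul_right K c _ _)

/-- The inner product of the pressure norm. -/
noncomputable def pressureInner (k : ℕ) : pressureSpace M k →ₗ[ℝ] pressureSpace M k →ₗ[ℝ] ℝ :=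
  have hq (q : pressureSpace M k) : q.1 ∈ polyWeak M := polyWeak_of_wgSpace q.2.1
  have h1 (q q' r : pressureSpace M k) :
      ∑ K ∈ M.cellsF, M.cellInt K ((q + q').1.1 K * r.1.1 K) +
        ∑ K ∈ M.cellsF, dotInt K (wgrad M k K (q + q').1) (wgrad M k K r.1) =
      (∑ K ∈ M.cellsF, M.cellInt K (q.1.1 K * r.1.1 K) +
        ∑ K ∈ M.cellsF, dotInt K (wgrad M k K q.1) (wgrad M k K r.1)) +
      (∑ K ∈ M.cellsF, M.cellInt K (q'.1.1 K * r.1.1 K) +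
        ∑ K ∈ M.cellsF, dotInt K (wgrad M k K q'.1) (wgrad M k K r.1)) := by
    simp only [← Finset.sum_add_distrib]
    refine Finset.sum_congr rfl fun K _ => ?_
    rw [Submodule.coe_add, wgrad_add k K (hq q) (hq q'), dotInt_add_left
      (polyFun_wgrad M k K (hq q)) (polyFun_wgrad M k K (hq q')) (polyFun_wgrad M k K (hq r)),
      Prod.fst_add, Pi.add_apply, mulInt_add_left ((hq q).1 K) ((hq q').1 K) ((hq r).1 K)]
    ring
  have h2 (c : ℝ) (q r : pressureSpace M k) :
      ∑ K ∈ M.cellsF, M.cellInt K ((c • q).1.1 K * r.1.1 K) +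
        ∑ K ∈ M.cellsF, dotInt K (wgrad M k K (c • q).1) (wgrad M k K r.1) =
      c * (∑ K ∈ M.cellsF, M.cellInt K (q.1.1 K * r.1.1 K) +
        ∑ K ∈ M.cellsF, dotInt K (wgrad M k K q.1) (wgrad M k K r.1)) := by
    simp only [← Finset.sum_add_distrib, Finset.mul_sum]
    refine Finset.sum_congr rfl fun K _ => ?_
    rw [Submodule.coe_smul, wgrad_smul k K c (hq q), dotInt_smul_left,
      Prod.smul_fst, Pi.smul_apply, smul_mul_assoc, M.cellInt_smul]
    ring
  LinearMap.mk₂ ℝ (fun q r => ∑ K ∈ M.cellsF, M.cellInt K (q.1.1 K * r.1.1 K) +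
      ∑ K ∈ M.cellsF, dotInt K (wgrad M k K q.1) (wgrad M k K r.1)) h1 h2
    (fun v u u' => by simpa only [dotInt_comm _ (wgrad M k _ v.1), mul_comm (v.1.1 _)] using h1 u u' v)
    (fun c v u => by simpa only [smul_eq_mul, dotInt_comm _ (wgrad M k _ v.1), mul_comm (v.1.1 _)] using h2 c u v)

theorem sqrt_pressureInner (k : ℕ) (q : pressureSpace M k) :
    √(pressureInner M k q q) = normQ M k q.1 := (normQ_eq k q.1).symm

/-- The load functional of the momentum equation. -/
noncomputable def forceFunctional (k l : ℕ) {f : Pt d → Pt d}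
    (hf : MemLp f 2 (volume.restrict M.OmF)) : V0 M k l →ₗ[ℝ] ℝ :=
  have hp (v : V0 M k l) := polyWeak_of_V0 v.2
  have hf' : MemLp f 2 (volume.restrict (interior (M.cover M.cellsF))) := by rwa [← OmF_eq]
  have e (v : V0 M k l) : loadF M f v.1 =
      ∑ K ∈ M.cellsF, ∑ i, M.cellInt K (fun x => f x i * (v.1 i).1 K x) :=
    Finset.sum_congr rfl fun K hK => loadInt_sum hK hf' fun i => (hp v i).1 K
  { toFun := fun v => loadF M f v.1
    map_add' := fun v w => by
      rw [e, e, e, ← Finset.sum_add_distrib]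
      refine Finset.sum_congr rfl fun K hK => ?_
      rw [← Finset.sum_add_distrib]
      exact Finset.sum_congr rfl fun i _ =>
        loadInt_add hK (hf'.eval_piLp i) ((hp v i).1 K) ((hp w i).1 K)
    map_smul' := fun c v => by
      rw [e, e, RingHom.id_apply, smul_eq_mul, Finset.mul_sum]
      refine Finset.sum_congr rfl fun K hK => ?_
      rw [Finset.mul_sum]
      exact Finset.sum_congr rfl fun i _ => loadInt_smul K (fun x => f x i) c _ }

/-- The load functional of the heat equation. -/
noncomputable def sourceFunctional (k l : ℕ) {g : Pt d → ℝ}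
    (hg : MemLp g 2 (volume.restrict M.Om)) : S0 M k l →ₗ[ℝ] ℝ where
  toFun s := loadG M g s.1
  map_add' s s' := by
    have hg' : MemLp g 2 (volume.restrict (interior (M.cover M.cells))) := by rwa [← Om_eq]
    simp only [loadG, ← Finset.sum_add_distrib]
    exact Finset.sum_congr rfl fun K hK =>
      loadInt_add hK hg' ((polyWeak_of_S0 s.2).1 K) ((polyWeak_of_S0 s'.2).1 K)
  map_smul' c s := by
    simp only [loadG, RingHom.id_apply, smul_eq_mul, Finset.mul_sum]
    exact Finset.sum_congr rfl fun K _ => loadInt_smul K g c _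

end Bundled

/-- The supremum of the quotients of an odd by an even function is a bound for these quotients. -/
theorem le_sSup_quotient {α : Type*} {good : α → Prop} {num den : α → ℝ} {C : ℝ} (σ : α → α)
    (hσ : ∀ a, good a → good (σ a)) (hnum : ∀ a, num (σ a) = - num a)
    (hden : ∀ a, den (σ a) = den a) (hpos : ∀ a, good a → 0 < den a)
    (hC : ∀ a, good a → |num a| ≤ C * den a) :
    0 ≤ sSup {r | ∃ a, good a ∧ r = num a / den a} ∧
      ∀ a, good a → num a ≤ sSup {r | ∃ a, good a ∧ r = num a / den a} * den a := by
  set s := {r | ∃ a, good a ∧ r = num a / den a} with hs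
  have hb : BddAbove s := ⟨C, by
    rintro r ⟨a, ha, rfl⟩
    exact (div_le_iff₀ (hpos a ha)).2 ((le_abs_self _).trans (hC a ha))⟩
  constructor
  -- If an admissible argument exists, the involution puts a number and its negative in the set, so
  -- the supremum is nonnegative. Otherwise the set is empty and `sSup` takes its default value 0.
  · by_cases hne : ∃ a, good a
    · obtain ⟨a, ha⟩ := hne
      have h1 := le_csSup hb (show num a / den a ∈ s from ⟨a, ha, rfl⟩)
      have h2 := le_csSup hb (show num (σ a) / den (σ a) ∈ s from ⟨σ a, hσ a ha, rfl⟩)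
      rw [hnum, hden, neg_div] at h2
      linarith
    · have : s = ∅ := Set.eq_empty_of_forall_notMem fun r ⟨a, ha, _⟩ => hne ⟨a, ha⟩
      rw [this, Real.sSup_empty]
  · exact fun a ha => (div_le_iff₀ (hpos a ha)).1 (le_csSup hb ⟨a, ha, rfl⟩)

/-! ### The suprema are bounds, and the mesh problem is an instance of the abstract one. -/

section Bounds

variable {d : ℕ} {M : Mesh d} [NeZero d] {k l m : ℕ}

theorem velocityForm_symm (u v : V0 M k l) : velocityForm M k l m u v = velocityForm M k l m v u := by
  simp only [velocityForm_apply, diffusion_comm _ l m (u.1 _)]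

theorem velocityForm_self_nonneg (v : V0 M k l) : 0 ≤ velocityForm M k l m v v := by
  rw [velocityForm_apply]
  exact Finset.sum_nonneg fun _ _ => diffusion_self_nonneg _ l m _

theorem velocityForm_self_eq_zero (hkm : k - 1 ≤ m) (hml : m ≤ l) (v : V0 M k l)
    (h : velocityForm M k l m v v = 0) : v = 0 := by
  rw [velocityForm_apply,
    Finset.sum_eq_zero_iff_of_nonneg fun _ _ => diffusion_self_nonneg _ l m _] at h
  refine Subtype.ext (funext fun i => ?_)
  have hv := v.2 i (Set.mem_univ i)
  rw [OmF_eq] at hv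
  exact eq_zero_of_diffusion_self_eq_zero hkm hml hv (h i (Finset.mem_univ i))

theorem temperatureForm_symm (u v : S0 M k l) :
    temperatureForm M k l m u v = temperatureForm M k l m v u := diffusion_comm _ l m _ _

theorem temperatureForm_self_nonneg (v : S0 M k l) : 0 ≤ temperatureForm M k l m v v :=
  diffusion_self_nonneg _ l m _

theorem temperatureForm_self_eq_zero (hkm : k - 1 ≤ m) (hml : m ≤ l) (v : S0 M k l)
    (h : temperatureForm M k l m v v = 0) : v = 0 := by
  have hv : v.1 ∈ wgSpace M M.cells {e | M.facetSet e ⊆ frontier M.Om} k l := v.2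
  rw [Om_eq] at hv
  exact Subtype.ext (eq_zero_of_diffusion_self_eq_zero hkm hml hv h)

theorem sqrt_velocityForm (v : V0 M k l) : √(velocityForm M k l m v v) = normV M l m v.1 := rfl

theorem sqrt_temperatureForm (v : S0 M k l) :
    √(temperatureForm M k l m v v) = normS M l m v.1 := rfl

theorem dominates_normV (hkm : k - 1 ≤ m) (hml : m ≤ l) :
    Dominates fun v : V0 M k l => normV M l m v.1 :=
  dominates_sqrt velocityForm_symm velocityForm_self_nonneg (velocityForm_self_eq_zero hkm hml)

theorem dominates_normS (hkm : k - 1 ≤ m) (hml : m ≤ l) :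
    Dominates fun v : S0 M k l => normS M l m v.1 :=
  dominates_sqrt temperatureForm_symm temperatureForm_self_nonneg
    (temperatureForm_self_eq_zero hkm hml)

theorem normV_pos (hkm : k - 1 ≤ m) (hml : m ≤ l) {v : V0 M k l} (hv : v ≠ 0) :
    0 < normV M l m v.1 :=
  Real.sqrt_pos.2 <| (velocityForm_self_nonneg (m := m) v).lt_of_ne' fun h =>
    hv (velocityForm_self_eq_zero hkm hml v h)

theorem normS_pos (hkm : k - 1 ≤ m) (hml : m ≤ l) {v : S0 M k l} (hv : v ≠ 0) :
    0 < normS M l m v.1 :=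
  Real.sqrt_pos.2 <| (temperatureForm_self_nonneg (m := m) v).lt_of_ne' fun h =>
    hv (temperatureForm_self_eq_zero hkm hml v h)

theorem normV_neg (v : V0 M k l) : normV M l m (-v).1 = normV M l m v.1 := by
  rw [← sqrt_velocityForm, ← sqrt_velocityForm, map_neg, map_neg, LinearMap.neg_apply, neg_neg]

theorem normS_neg (v : S0 M k l) : normS M l m (-v).1 = normS M l m v.1 := by
  rw [← sqrt_temperatureForm, ← sqrt_temperatureForm, map_neg, map_neg, LinearMap.neg_apply,
    neg_neg]

/-- The discretely divergence-free velocities as a predicate on the velocity space. -/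
def DivFree (v : V0 M k l) : Prop := ∀ q, pressureForm M k l v q = 0

theorem divFree_iff (v : V0 M k l) : DivFree v ↔ v.1 ∈ W M k l :=
  ⟨fun h => ⟨v.2, fun q hq => h ⟨q, hq⟩⟩, fun h q => h.2 q.1 q.2⟩

theorem DivFree.neg {v : V0 M k l} (h : DivFree v) : DivFree (-v) := fun q => by
  rw [map_neg, LinearMap.neg_apply, h q, neg_zero]

/-- The definite energy on a finite-dimensional space bounds the trilinear form, so the real
supremum is over a bounded set and does bound every quotient. Negating the convecting velocity
supplies the sign symmetry for nonnegativity. -/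
theorem Nh_bound (hkm : k - 1 ≤ m) (hml : m ≤ l) : 0 ≤ Nh M k l m ∧
    ∀ w u v : V0 M k l, DivFree w → DivFree u → DivFree v → convectionForm M k l w u v ≤
      Nh M k l m * (normV M l m w.1 * normV M l m u.1 * normV M l m v.1) := by
  have hD := dominates_normV (M := M) hkm hml
  obtain ⟨C, -, hC⟩ := hD.bound₃ hD hD (convectionForm M k l)
  have e : Nh M k l m = sSup {r | ∃ a : V0 M k l × V0 M k l × V0 M k l,
      ((DivFree a.1 ∧ DivFree a.2.1 ∧ DivFree a.2.2) ∧ a.1 ≠ 0 ∧ a.2.1 ≠ 0 ∧ a.2.2 ≠ 0) ∧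
      r = convectionForm M k l a.1 a.2.1 a.2.2 /
        (normV M l m a.1.1 * normV M l m a.2.1.1 * normV M l m a.2.2.1)} := by
    unfold Nh
    congr 1
    ext r
    constructor
    · rintro ⟨w, hw, u, hu, v, hv, hw0, hu0, hv0, rfl⟩
      refine ⟨(⟨w, hw.1⟩, ⟨u, hu.1⟩, ⟨v, hv.1⟩), ⟨⟨(divFree_iff _).2 hw, (divFree_iff _).2 hu,
        (divFree_iff _).2 hv⟩, fun h => hw0 (congrArg Subtype.val h),
        fun h => hu0 (congrArg Subtype.val h), fun h => hv0 (congrArg Subtype.val h)⟩, ?_⟩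
      rw [convectionForm_apply]
    · rintro ⟨⟨w, u, v⟩, ⟨⟨hw, hu, hv⟩, hw0, hu0, hv0⟩, rfl⟩
      refine ⟨w.1, (divFree_iff _).1 hw, u.1, (divFree_iff _).1 hu, v.1, (divFree_iff _).1 hv,
        fun h => hw0 (Subtype.ext h), fun h => hu0 (Subtype.ext h),
        fun h => hv0 (Subtype.ext h), ?_⟩
      rw [convectionForm_apply]
  obtain ⟨h1, h2⟩ := le_sSup_quotient (α := V0 M k l × V0 M k l × V0 M k l)
    (good := fun a => (DivFree a.1 ∧ DivFree a.2.1 ∧ DivFree a.2.2) ∧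
      a.1 ≠ 0 ∧ a.2.1 ≠ 0 ∧ a.2.2 ≠ 0)
    (num := fun a => convectionForm M k l a.1 a.2.1 a.2.2)
    (den := fun a => normV M l m a.1.1 * normV M l m a.2.1.1 * normV M l m a.2.2.1)
    (fun a => (-a.1, a.2))
    (fun a ha => ⟨⟨ha.1.1.neg, ha.1.2⟩, neg_ne_zero.2 ha.2.1, ha.2.2⟩)
    (fun a => by simp only [map_neg, LinearMap.neg_apply])
    (fun a => by simp only [normV_neg])
    (fun a ha => mul_pos (mul_pos (normV_pos hkm hml ha.2.1) (normV_pos hkm hml ha.2.2.1))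
      (normV_pos hkm hml ha.2.2.2))
    (fun a _ => hC a.1 a.2.1 a.2.2)
  rw [← e] at h1 h2
  refine ⟨h1, fun w u v hw hu hv => ?_⟩
  -- The supremum ranges over nonzero arguments only; if one argument is zero, the form vanishes and
  -- the right-hand side is nonnegative.
  by_cases h0 : w ≠ 0 ∧ u ≠ 0 ∧ v ≠ 0
  · exact h2 (w, u, v) ⟨⟨hw, hu, hv⟩, h0⟩
  · have h3 : convectionForm M k l w u v = 0 := by
      by_cases hw0 : w = 0
      · rw [hw0]; simp
      by_cases hu0 : u = 0
      · rw [hu0]; simp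
      have hv0 : v = 0 := by
        by_contra hv0
        exact h0 ⟨hw0, hu0, hv0⟩
      rw [hv0]; simp
    rw [h3]
    exact mul_nonneg h1 (mul_nonneg (mul_nonneg (hD.1 w) (hD.1 u)) (hD.1 v))

theorem Mh_bound (hkm : k - 1 ≤ m) (hml : m ≤ l) : 0 ≤ Mh M k l m ∧
    ∀ (w : V0 M k l) (T s : S0 M k l), DivFree w → heatConvectionForm M k l w T s ≤
      Mh M k l m * (normV M l m w.1 * normS M l m T.1 * normS M l m s.1) := by
  have hD := dominates_normV (M := M) hkm hml
  have hE := dominates_normS (M := M) hkm hml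
  obtain ⟨C, -, hC⟩ := hD.bound₃ hE hE (heatConvectionForm M k l)
  have e : Mh M k l m = sSup {r | ∃ a : V0 M k l × S0 M k l × S0 M k l,
      (DivFree a.1 ∧ a.1 ≠ 0 ∧ a.2.1 ≠ 0 ∧ a.2.2 ≠ 0) ∧
      r = heatConvectionForm M k l a.1 a.2.1 a.2.2 /
        (normV M l m a.1.1 * normS M l m a.2.1.1 * normS M l m a.2.2.1)} := by
    unfold Mh
    congr 1
    ext r
    constructor
    · rintro ⟨w, hw, u, hu, v, hv, hw0, hu0, hv0, rfl⟩
      refine ⟨(⟨w, hw.1⟩, ⟨u, hu⟩, ⟨v, hv⟩), ⟨(divFree_iff _).2 hw,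
        fun h => hw0 (congrArg Subtype.val h),
        fun h => hu0 (congrArg Subtype.val h), fun h => hv0 (congrArg Subtype.val h)⟩, ?_⟩
      rw [heatConvectionForm_apply]
    · rintro ⟨⟨w, u, v⟩, ⟨hw, hw0, hu0, hv0⟩, rfl⟩
      refine ⟨w.1, (divFree_iff _).1 hw, u.1, u.2, v.1, v.2,
        fun h => hw0 (Subtype.ext h), fun h => hu0 (Subtype.ext h),
        fun h => hv0 (Subtype.ext h), ?_⟩
      rw [heatConvectionForm_apply]
  obtain ⟨h1, h2⟩ := le_sSup_quotient (α := V0 M k l × S0 M k l × S0 M k l)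
    (good := fun a => DivFree a.1 ∧ a.1 ≠ 0 ∧ a.2.1 ≠ 0 ∧ a.2.2 ≠ 0)
    (num := fun a => heatConvectionForm M k l a.1 a.2.1 a.2.2)
    (den := fun a => normV M l m a.1.1 * normS M l m a.2.1.1 * normS M l m a.2.2.1)
    (fun a => (-a.1, a.2))
    (fun a ha => ⟨ha.1.neg, neg_ne_zero.2 ha.2.1, ha.2.2⟩)
    (fun a => by simp only [map_neg, LinearMap.neg_apply])
    (fun a => by simp only [normV_neg])
    (fun a ha => mul_pos (mul_pos (normV_pos hkm hml ha.2.1) (normS_pos hkm hml ha.2.2.1))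
      (normS_pos hkm hml ha.2.2.2))
    (fun a _ => hC a.1 a.2.1 a.2.2)
  rw [← e] at h1 h2
  refine ⟨h1, fun w u v hw => ?_⟩
  by_cases h0 : w ≠ 0 ∧ u ≠ 0 ∧ v ≠ 0
  · exact h2 (w, u, v) ⟨hw, h0⟩
  · have h3 : heatConvectionForm M k l w u v = 0 := by
      by_cases hw0 : w = 0
      · rw [hw0]; simp
      by_cases hu0 : u = 0
      · rw [hu0]; simp
      have hv0 : v = 0 := by
        by_contra hv0
        exact h0 ⟨hw0, hu0, hv0⟩
      rw [hv0]; simp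
    rw [h3]
    exact mul_nonneg h1 (mul_nonneg (mul_nonneg (hD.1 w) (hE.1 u)) (hE.1 v))

/-- Nonnegativity of this constant makes every admissible `β` nonnegative, as the contraction
estimate requires. -/
theorem Dh_bound (hkm : k - 1 ≤ m) (hml : m ≤ l) : 0 ≤ Dh M k l m ∧
    ∀ (T : S0 M k l) (v : V0 M k l), DivFree v → buoyancyForm M k l T v ≤
      Dh M k l m * (normS M l m T.1 * normV M l m v.1) := by
  have hD := dominates_normV (M := M) hkm hml
  have hE := dominates_normS (M := M) hkm hml
  obtain ⟨C, -, hC⟩ := hE.bound₂ hD (buoyancyForm M k l)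
  have e : Dh M k l m = sSup {r | ∃ a : S0 M k l × V0 M k l,
      (DivFree a.2 ∧ a.1 ≠ 0 ∧ a.2 ≠ 0) ∧
      r = buoyancyForm M k l a.1 a.2 / (normS M l m a.1.1 * normV M l m a.2.1)} := by
    unfold Dh
    congr 1
    ext r
    constructor
    · rintro ⟨u, hu, v, hv, hu0, hv0, rfl⟩
      exact ⟨(⟨u, hu⟩, ⟨v, hv.1⟩), ⟨(divFree_iff _).2 hv,
        fun h => hu0 (congrArg Subtype.val h), fun h => hv0 (congrArg Subtype.val h)⟩, rfl⟩
    · rintro ⟨⟨u, v⟩, ⟨hv, hu0, hv0⟩, rfl⟩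
      exact ⟨u.1, u.2, v.1, (divFree_iff _).1 hv, fun h => hu0 (Subtype.ext h),
        fun h => hv0 (Subtype.ext h), rfl⟩
  obtain ⟨h1, h2⟩ := le_sSup_quotient (α := S0 M k l × V0 M k l)
    (good := fun a => DivFree a.2 ∧ a.1 ≠ 0 ∧ a.2 ≠ 0)
    (num := fun a => buoyancyForm M k l a.1 a.2)
    (den := fun a => normS M l m a.1.1 * normV M l m a.2.1)
    (fun a => (-a.1, a.2))
    (fun a ha => ⟨ha.1, neg_ne_zero.2 ha.2.1, ha.2.2⟩)
    (fun a => by simp only [map_neg, LinearMap.neg_apply])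
    (fun a => by simp only [normS_neg])
    (fun a ha => mul_pos (normS_pos hkm hml ha.2.1) (normV_pos hkm hml ha.2.2))
    (fun a _ => hC a.1 a.2)
  rw [← e] at h1 h2
  refine ⟨h1, fun u v hv => ?_⟩
  by_cases h0 : u ≠ 0 ∧ v ≠ 0
  · exact h2 (u, v) ⟨hv, h0⟩
  · have h3 : buoyancyForm M k l u v = 0 := by
      by_cases hu0 : u = 0
      · rw [hu0]; simp
      have hv0 : v = 0 := by
        by_contra hv0
        exact h0 ⟨hu0, hv0⟩
      rw [hv0]; simp
    rw [h3]
    exact mul_nonneg h1 (mul_nonneg (hE.1 u) (hD.1 v))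

theorem normF_bound (hkm : k - 1 ≤ m) (hml : m ≤ l) {f : Pt d → Pt d}
    (hf : MemLp f 2 (volume.restrict M.OmF)) : 0 ≤ normF M k l m f ∧
    ∀ v : V0 M k l, DivFree v → forceFunctional M k l hf v ≤ normF M k l m f * normV M l m v.1 := by
  have hD := dominates_normV (M := M) hkm hml
  obtain ⟨C, -, hC⟩ := hD.2 (forceFunctional M k l hf)
  have e : normF M k l m f = sSup {r | ∃ v : V0 M k l, (DivFree v ∧ v ≠ 0) ∧
      r = forceFunctional M k l hf v / normV M l m v.1} := by
    unfold normF
    congr 1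
    ext r
    constructor
    · rintro ⟨v, hv, hv0, rfl⟩
      exact ⟨⟨v, hv.1⟩, ⟨(divFree_iff _).2 hv, fun h => hv0 (congrArg Subtype.val h)⟩, rfl⟩
    · rintro ⟨v, ⟨hv, hv0⟩, rfl⟩
      exact ⟨v.1, (divFree_iff _).1 hv, fun h => hv0 (Subtype.ext h), rfl⟩
  obtain ⟨h1, h2⟩ := le_sSup_quotient (α := V0 M k l)
    (good := fun v => DivFree v ∧ v ≠ 0) (num := fun v => forceFunctional M k l hf v)
    (den := fun v => normV M l m v.1) (fun v => -v)
    (fun v hv => ⟨hv.1.neg, neg_ne_zero.2 hv.2⟩) (fun v => by simp only [map_neg])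
    (fun v => by simp only [normV_neg]) (fun v hv => normV_pos hkm hml hv.2) (fun v _ => hC v)
  rw [← e] at h1 h2
  refine ⟨h1, fun v hv => ?_⟩
  by_cases h0 : v = 0
  · rw [h0, map_zero]
    exact mul_nonneg h1 (hD.1 0)
  · exact h2 v ⟨hv, h0⟩

theorem normG_bound (hkm : k - 1 ≤ m) (hml : m ≤ l) {g : Pt d → ℝ}
    (hg : MemLp g 2 (volume.restrict M.Om)) : 0 ≤ normG M k l m g ∧
    ∀ s : S0 M k l, sourceFunctional M k l hg s ≤ normG M k l m g * normS M l m s.1 := by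
  have hE := dominates_normS (M := M) hkm hml
  obtain ⟨C, -, hC⟩ := hE.2 (sourceFunctional M k l hg)
  have e : normG M k l m g = sSup {r | ∃ s : S0 M k l, s ≠ 0 ∧
      r = sourceFunctional M k l hg s / normS M l m s.1} := by
    unfold normG
    congr 1
    ext r
    constructor
    · rintro ⟨v, hv, hv0, rfl⟩
      exact ⟨⟨v, hv⟩, fun h => hv0 (congrArg Subtype.val h), rfl⟩
    · rintro ⟨v, hv0, rfl⟩
      exact ⟨v.1, v.2, fun h => hv0 (Subtype.ext h), rfl⟩
  obtain ⟨h1, h2⟩ := le_sSup_quotient (α := S0 M k l)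
    (good := fun v => v ≠ 0) (num := fun v => sourceFunctional M k l hg v)
    (den := fun v => normS M l m v.1) (fun v => -v)
    (fun v hv => neg_ne_zero.2 hv) (fun v => by simp only [map_neg])
    (fun v => by simp only [normS_neg]) (fun v hv => normS_pos hkm hml hv) (fun v _ => hC v)
  rw [← e] at h1 h2
  refine ⟨h1, fun v => ?_⟩
  by_cases h0 : v = 0
  · rw [h0, map_zero]
    exact mul_nonneg h1 (hE.1 0)
  · exact h2 v h0

variable (M k l m) in
/-- The discrete natural convection problem as an abstract convection problem. -/
noncomputable def convectionData (hk : 1 ≤ k) (hkm : k - 1 ≤ m) (hml : m ≤ l) {Pr Ra κ : ℝ}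
    (hPr : 0 < Pr) (hRa : 0 < Ra) (hκ : 0 < κ) {f : Pt d → Pt d}
    (hf : MemLp f 2 (volume.restrict M.OmF)) {g : Pt d → ℝ}
    (hg : MemLp g 2 (volume.restrict M.Om)) {β : ℝ} (hβ : Dh M k l m ≤ β) :
    ConvectionData (V0 M k l) (S0 M k l) (pressureSpace M k) where
  A := velocityForm M k l m
  A_symm := velocityForm_symm
  A_nonneg := velocityForm_self_nonneg
  A_def := velocityForm_self_eq_zero hkm hml
  B := temperatureForm M k l m
  B_symm := temperatureForm_symm
  B_nonneg := temperatureForm_self_nonneg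
  B_def := temperatureForm_self_eq_zero hkm hml
  b := pressureForm M k l
  b_sep q h := Subtype.ext (eq_zero_of_bForm_eq_zero hk q.2 fun v hv => h ⟨v, hv⟩)
  j := buoyancyForm M k l
  c := convectionForm M k l
  c_self w u := by
    rw [convectionForm_apply]
    exact sub_self _
  cb := heatConvectionForm M k l
  cb_self w s := by
    rw [heatConvectionForm_apply]
    exact sub_self _
  F := forceFunctional M k l hf
  G := sourceFunctional M k l hg
  Pr := Pr
  Ra := Ra
  κ := κ
  Pr_pos := hPr
  Ra_pos := hRa
  κ_pos := hκ
  β := β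
  N := Nh M k l m
  L := Mh M k l m
  nF := normF M k l m f
  nG := normG M k l m g
  β_nonneg := (Dh_bound hkm hml).1.trans hβ
  N_nonneg := (Nh_bound hkm hml).1
  L_nonneg := (Mh_bound hkm hml).1
  nF_nonneg := (normF_bound hkm hml hf).1
  nG_nonneg := (normG_bound hkm hml hg).1
  j_le T v hv := ((Dh_bound hkm hml).2 T v hv).trans <| mul_le_mul_of_nonneg_right hβ <|
    mul_nonneg (Real.sqrt_nonneg _) (Real.sqrt_nonneg _)
  c_le w u v hw hu hv := (Nh_bound hkm hml).2 w u v hw hu hv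
  cb_le w T s hw := (Mh_bound hkm hml).2 w T s hw
  F_le v hv := (normF_bound hkm hml hf).2 v hv
  G_le s := (normG_bound hkm hml hg).2 s

end Bounds

end WG

/-! ### Transfer of the abstract convergence result to the WG scheme. -/

theorem mainTheorem5 {d : ℕ} (hd : d = 2 ∨ d = 3) (M : WG.Mesh d)
    (k l m : ℕ) (hk : 1 ≤ k) (hl : l = k ∨ l = k - 1) (hkm : k - 1 ≤ m) (hml : m ≤ l)
    (Pr Ra κ : ℝ) (hPr : 0 < Pr) (hRa : 0 < Ra) (hκ : 0 < κ)
    (f : WG.Pt d → WG.Pt d) (hf : MeasureTheory.MemLp f 2 (MeasureTheory.volume.restrict M.OmF))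
    (g : WG.Pt d → ℝ) (hg : MeasureTheory.MemLp g 2 (MeasureTheory.volume.restrict M.Om))
    (β : ℝ) (hβ : WG.Dh M k l m ≤ β)
    (hC0 : 0 < WG.C0 M k l m Pr Ra κ β f g)
    (uh : WG.Vect M) (ph Th : WG.Scal M)
    (hsol : WG.IsWGSolution M k l m Pr Ra κ f g uh ph Th)
    (u : ℕ → WG.Vect M) (p T : ℕ → WG.Scal M)
    (hu0 : u 0 ∈ WG.V0 M k l)
    (hiter : ∀ n, WG.IsOseenStep M k l m Pr Ra κ f g (u n) (u (n + 1)) (p (n + 1)) (T (n + 1))) :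
    Filter.Tendsto (fun n => WG.normV M l m (u n - uh)) Filter.atTop (nhds 0) ∧
    Filter.Tendsto (fun n => WG.normQ M k (p n - ph)) Filter.atTop (nhds 0) ∧
    Filter.Tendsto (fun n => WG.normS M l m (T n - Th)) Filter.atTop (nhds 0) ∧
    (∀ n, WG.normV M l m (u (n + 1) - uh) ≤
      (1 - WG.C0 M k l m Pr Ra κ β f g) ^ n * WG.normV M l m (u 1 - uh)) ∧
    (u 0 ∈ WG.W M k l → ∀ n, WG.normV M l m (u n - uh) ≤
      (1 - WG.C0 M k l m Pr Ra κ β f g) ^ n * WG.normV M l m (u 0 - uh)) := by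
  have : NeZero d := ⟨by omega⟩
  let D := WG.convectionData M k l m hk hkm hml hPr hRa hκ hf hg hβ
  -- The abstract factor unfolds to exactly the quantity subtracted from 1 in the definition of
  -- `C0`.
  have hρ : D.rho = 1 - WG.C0 M k l m Pr Ra κ β f g := (sub_sub_cancel 1 D.rho).symm
  let us : ℕ → WG.V0 M k l := fun n => ⟨u n, by
    cases n with
    | zero => exact hu0
    | succ n => exact (hiter n).1⟩
  -- The iteration does not constrain the pressure and temperature with index 0, so a dummy zero is
  -- put there; limits do not see it.
  let ps : ℕ → WG.pressureSpace M k := fun n => Nat.casesOn n 0 fun n => ⟨p (n + 1), (hiter n).2.1⟩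
  let Ts : ℕ → WG.S0 M k l := fun n => Nat.casesOn n 0 fun n => ⟨T (n + 1), (hiter n).2.2.1⟩
  let u' : WG.V0 M k l := ⟨uh, hsol.1⟩
  let p' : WG.pressureSpace M k := ⟨ph, hsol.2.1⟩
  let T' : WG.S0 M k l := ⟨Th, hsol.2.2.1⟩
  have hsol' : D.IsStep u' u' p' T' := by
    refine ⟨fun v q => ?_, fun s => ?_⟩
    · have h := hsol.2.2.2.1 v.1 v.2 q.1 q.2
      -- The other bundled forms agree with the originals by unfolding; the convection forms are
      -- bundled through their componentwise skew version and need this rewriting.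
      have h1 := WG.convectionForm_apply M k l u' u' v
      rw [sub_eq_iff_eq_add] at h
      change Pr * _ + WG.convectionForm M k l u' u' v + _ - _ = _
      rw [h1]
      exact h
    · have h := hsol.2.2.2.2 s.1 s.2
      have h1 := WG.heatConvectionForm_apply M k l u' T' s
      change κ * _ + WG.heatConvectionForm M k l u' T' s = _
      rw [h1]
      exact h
  have hiter' : ∀ n, D.IsStep (us n) (us (n + 1)) (ps (n + 1)) (Ts (n + 1)) := by
    intro n
    refine ⟨fun v q => ?_, fun s => ?_⟩
    · have h := (hiter n).2.2.2.1 v.1 v.2 q.1 q.2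
      have h1 := WG.convectionForm_apply M k l (us n) (us (n + 1)) v
      change Pr * _ + WG.convectionForm M k l (us n) (us (n + 1)) v + _ - _ = _
      rw [h1]
      exact h
    · have h := (hiter n).2.2.2.2 s.1 s.2
      have h1 := WG.heatConvectionForm_apply M k l (us n) (Ts (n + 1)) s
      change κ * _ + WG.heatConvectionForm M k l (us n) (Ts (n + 1)) s = _
      rw [h1]
      exact h
  obtain ⟨h1, h2, h3, h4, h5⟩ := D.tendsto (by rw [hρ]; linarith) (WG.pressureInner M k) hsol'
    us ps Ts hiter'
  rw [hρ] at h1 h2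
  refine ⟨h3, ?_, ?_, h1, fun hW n => h2 ((WG.divFree_iff (us 0)).2 hW) n⟩
  -- The shift discards index 0, where the bundled sequence holds the dummy value instead of `p 0`.
  · rw [← Filter.tendsto_add_atTop_iff_nat 1] at h5 ⊢
    have h6 := h5.sqrt
    rw [Real.sqrt_zero] at h6
    exact h6.congr fun n => WG.sqrt_pressureInner M k (ps (n + 1) - p')
  · rw [← Filter.tendsto_add_atTop_iff_nat 1] at h4 ⊢
    exact h4
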